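/- All manifolds are smooth, Hausdorff, second countable, simply connected and of positive dimension. A \emph{Hesse-Frobenius structure} on a manifold consists of a flat pseudo-Riemannian metric $g$ with Levi-Civita connection $\nabla$ and a smooth commutative, associative product $\star$ of vector fields (bilinear over the smooth functions) such that $g(X\star Y,Z)=g(X,Y\star Z)$ and $(\nabla_Z\star)(X,Y)=X\star Y\star Z$. In dimension $n$, write $X\star Y=C_{ij}{}^kX^iY^j\partial_k$ and $\hat T_{ij}^k=3\left(C_{ij}{}^k-\frac1n g_{ij}g^{ab}C_{ab}{}^k\right)$. The \emph{Wilczynski equation} for a smooth function $V$ is $$\nabla^2_{ij}V=\hat T_{ij}^k\,\partial_kV+\tfrac1n\,g_{ij}\,\Delta V .\qquad(\mathrm W)$$ A smooth symmetric tensor $K_{ij}$ is called a \emph{compatible Killing tensor} if it is a Killing tensor of $g$ and if $\left(K^a{}_{i,j}+K^b{}_i\hat T^a_{bj}\right)\partial_aV$ is symmetric in $i,j$ for all solutions $V$ of (W). A potential $V$ is \emph{second-order maximally superintegrable} if there are $2n-2$ integrals $F=K^{ij}p_ip_j+f$ of $H=g^{ij}p_ip_j+V$, with smooth symmetric $K$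 and smooth functions $f$ of the position, that together with $H$ are functionally independent, i.e. have linearly independent differentials on a dense subset of the cotangent bundle. Let $(U,g,\star)$ and $(W,h,\ast)$ be Hesse-Frobenius manifolds, and let $M=U\times W$, $n=\dim M$, with the metric $G=g+h$ and the product $\star+\ast$, where both are extended trivially (cross products vanish). Then: 1. $(M,G,\star+\ast)$ is a Hesse-Frobenius manifold: $\star+\ast$ is commutative, associative, has the Frobenius property for $G$, and $\nabla^G(\star+\ast)=(\star+\ast)\circ(\star+\ast)$; and $G$ is flat. 2. It gives rise to second-order maximally superintegrable systems on $(M,G)$: the solutions of (W) on $M$ form a vector space of dimension $n+2$, the compatible Killing tensors on $M$ form a vector space of dimension $\frac12n(n+1)$, and for every solution $V$ and every compatible Killing tensor $K$ there is a smooth function $F$ on $M$ such that $K^{ij}p_ip_j+F$ is an integral of $H=G^{ij}p_ip_j+V$. Every solution $V$ is second-order maximally superintegrable; if $V$ is not constant, the required $2n-2$ integrals can be chosen with compatible Killing tensors $K$. 3. Every solution $V$ of (W) on $M$ is additively separated, $V(x,y)=V_U(x)+V_W(y)$, where $V_U$ and $V_W$ are solutions of the Wilczynski equations of $U$ and $W$.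 Conversely, for functions $V_U$ on $U$ and $V_W$ on $W$, the sum $V_U(x)+V_W(y)$ solves (W) on $M$ if and only if $V_U$ and $V_W$ solve the Wilczynski equations of $U$ and $W$ and $$\tfrac1{\dim U}\left(\Delta_gV_U-3\,g^{ab}C_{ab}{}^k\partial_kV_U\right)(x)=\tfrac1{\dim W}\left(\Delta_hV_W-3\,h^{ab}\tilde C_{ab}{}^k\partial_kV_W\right)(y)\quad\text{for all }x\in U,\ y\in W,$$ where $C$ and $\tilde C$ belong to $\star$ and $\ast$, respectively. -/

import Mathlib

set_option maxSynthPendingDepth 3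

open Set Topology
open scoped Manifold ContDiff

noncomputable section

namespace HesseFrobenius

/-! ### Coordinate expressions

Everything in this section lives in the coordinate space `E` of a chart: `g`, `m`, `K`, `V` are the
coordinate expressions of a metric, a product of vector fields, a covariant 2-tensor and a function,
`y : E` is a point and `u v w : E` are constant coordinate vector fields. -/

section Coordinates

variable {E : Type*} [NormedAddCommGroup E] [NormedSpace ℝ E]

/-- The Christoffel symbols of the first kind,
`Γ₁(u,v)(w) = ½ (∂_u g(v,w) + ∂_v g(u,w) - ∂_w g(u,v))`. -/
def christoffelFirst (g : E → E →L[ℝ] E →L[ℝ] ℝ) (y : E) : E →L[ℝ] E →L[ℝ] E →L[ℝ] ℝ :=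
  let D : E →L[ℝ] E →L[ℝ] E →L[ℝ] ℝ := fderiv ℝ g y
  let T : E →L[ℝ] E →L[ℝ] E →L[ℝ] ℝ :=
    (ContinuousLinearMap.flipₗᵢ ℝ E E ℝ).toContinuousLinearEquiv.toContinuousLinearMap.comp D.flip
  (1 / 2 : ℝ) • (D + D.flip - T)

theorem christoffelFirst_apply (g : E → E →L[ℝ] E →L[ℝ] ℝ) (y u v w : E) :
    christoffelFirst g y u v w =
      (1 / 2 : ℝ) * (fderiv ℝ g y u v w + fderiv ℝ g y v u w - fderiv ℝ g y w u v) := by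
  simp [christoffelFirst]

/-- The Christoffel symbols `Γ(u,v) = ∇_u v` of the Levi-Civita connection of `g`: the index of
`christoffelFirst` is raised with the inverse of `g y : E → E*`. -/
def christoffel (g : E → E →L[ℝ] E →L[ℝ] ℝ) (y : E) : E →L[ℝ] E →L[ℝ] E :=
  (ContinuousLinearMap.compL ℝ E (E →L[ℝ] ℝ) E (g y).inverse).comp (christoffelFirst g y)

/-- `(∇_w m)(u,v)` for a product `m` of vector fields. -/
def covDerivMul (g : E → E →L[ℝ] E →L[ℝ] ℝ) (m : E → E →L[ℝ] E →L[ℝ] E) (y w u v : E) : E :=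
  fderiv ℝ m y w u v + christoffel g y w (m y u v)
    - m y (christoffel g y w u) v - m y u (christoffel g y w v)

/-- `(∇_w K)(u,v)` for a covariant 2-tensor `K`. -/
def covDerivForm (g K : E → E →L[ℝ] E →L[ℝ] ℝ) (y w u v : E) : ℝ :=
  fderiv ℝ K y w u v - K y (christoffel g y w u) v - K y u (christoffel g y w v)

/-- The Hessian `∇²V(u,v) = ∂_u ∂_v V - dV(Γ(u,v))`. -/
def hessian (g : E → E →L[ℝ] E →L[ℝ] ℝ) (V : E → ℝ) (y : E) : E →L[ℝ] E →L[ℝ] ℝ :=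
  fderiv ℝ (fderiv ℝ V) y
    - (ContinuousLinearMap.compL ℝ E E ℝ (fderiv ℝ V y)).comp (christoffel g y)

/-- The gradient, `g(grad V, ·) = dV`. -/
def gradient (g : E → E →L[ℝ] E →L[ℝ] ℝ) (V : E → ℝ) (y : E) : E :=
  (g y).inverse (fderiv ℝ V y)

variable [FiniteDimensional ℝ E]

/-- The contraction `g^{ab} β_{ab}` of a (scalar or vector valued) bilinear map `β`. -/
def metricTrace {X : Type*} [NormedAddCommGroup X] [NormedSpace ℝ X]
    (g : E →L[ℝ] E →L[ℝ] ℝ) (β : E →L[ℝ] E →L[ℝ] X) : X :=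
  ∑ i, β (Module.finBasis ℝ E i)
    (g.inverse (LinearMap.toContinuousLinearMap ((Module.finBasis ℝ E).coord i)))

/-- The Laplace-Beltrami operator `Δ V = g^{ab} ∇²_{ab} V`. -/
def laplacian (g : E → E →L[ℝ] E →L[ℝ] ℝ) (V : E → ℝ) (y : E) : ℝ :=
  metricTrace (g y) (hessian g V y)

/-- The structure tensor `T̂(u,v) = 3 (u ⋆ v - (1/n) g(u,v) t)` with `t^k = g^{ab} C_{ab}^k`. -/
def structureTensor (g : E → E →L[ℝ] E →L[ℝ] ℝ) (m : E → E →L[ℝ] E →L[ℝ] E) (y u v : E) : E :=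
  (3 : ℝ) • (m y u v - (1 / (Module.finrank ℝ E : ℝ)) • g y u v • metricTrace (g y) (m y))

/-- The Wilczynski equation `∇²_{ij} V = T̂_{ij}^k ∂_k V + (1/n) g_{ij} Δ V` at the point `y`. -/
def WilczynskiAt (g : E → E →L[ℝ] E →L[ℝ] ℝ) (m : E → E →L[ℝ] E →L[ℝ] E) (V : E → ℝ) (y : E) :
    Prop :=
  ∀ u v : E, hessian g V y u v = fderiv ℝ V y (structureTensor g m y u v)
    + (1 / (Module.finrank ℝ E : ℝ)) * g y u v * laplacian g V y

/-- The bilinear form `A_{ij} = (K^a_{i,j} + K^b_i T̂_{bj}^a) ∂_a V`, with `u = ∂_i` and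
`v = ∂_j`. -/
def bertrandDarbouxForm (g : E → E →L[ℝ] E →L[ℝ] ℝ) (m : E → E →L[ℝ] E →L[ℝ] E)
    (K : E → E →L[ℝ] E →L[ℝ] ℝ) (V : E → ℝ) (y u v : E) : ℝ :=
  covDerivForm g K y v u (gradient g V y)
    + fderiv ℝ V y (structureTensor g m y ((g y).inverse (K y u)) v)

/-- The number `(1/n) (Δ V - 3 t(V))`, where `t^k = g^{ab} C_{ab}^k`: the coefficient of `g` in
the Wilczynski equation, once the latter is written as `∇²V(u,v) = 3 dV(u ⋆ v) + φ g(u,v)`. -/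
def traceCoefficient (g : E → E →L[ℝ] E →L[ℝ] ℝ) (m : E → E →L[ℝ] E →L[ℝ] E) (V : E → ℝ)
    (y : E) : ℝ :=
  (1 / (Module.finrank ℝ E : ℝ)) *
    (laplacian g V y - 3 * fderiv ℝ V y (metricTrace (g y) (m y)))

/-- The Poisson bracket `∑ⱼ (∂F/∂xⱼ ∂G/∂pⱼ - ∂G/∂xⱼ ∂F/∂pⱼ)` of functions of `(x,p)`, in the linear
coordinates of `E` given by a basis and the dual coordinates of `E*`. -/
def poissonBracket (F G : E × (E →L[ℝ] ℝ) → ℝ) (z : E × (E →L[ℝ] ℝ)) : ℝ :=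
  ∑ j, (fderiv ℝ F z (Module.finBasis ℝ E j, 0)
        * fderiv ℝ G z (0, LinearMap.toContinuousLinearMap ((Module.finBasis ℝ E).coord j))
      - fderiv ℝ G z (Module.finBasis ℝ E j, 0)
        * fderiv ℝ F z (0, LinearMap.toContinuousLinearMap ((Module.finBasis ℝ E).coord j)))

end Coordinates

/-! ### Tensor fields on a manifold and their coordinate expressions -/

section Manifold

variable {E : Type*} [NormedAddCommGroup E] [NormedSpace ℝ E] {H : Type*} [TopologicalSpace H]
  (I : ModelWithCorners ℝ E H) {M : Type*} [TopologicalSpace M] [ChartedSpace H M]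

variable (M) in
/-- Covariant 2-tensor fields. -/
abbrev FormField : Type _ :=
  ∀ x : M, TangentSpace I x →L[ℝ] TangentSpace I x →L[ℝ] ℝ

variable (M) in
/-- Pointwise bilinear products of vector fields. -/
abbrev ProductField : Type _ :=
  ∀ x : M, TangentSpace I x →L[ℝ] TangentSpace I x →L[ℝ] TangentSpace I x

variable (M) in
/-- Functions `F(x,p)` on the cotangent bundle. -/
abbrev PhaseFunction : Type _ :=
  ∀ x : M, (TangentSpace I x →L[ℝ] ℝ) → ℝ

/-- The tangent map at `y` of the inverse of a chart. -/
def coordFrame (e : OpenPartialHomeomorph M H) (y : E) :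
    E →L[ℝ] TangentSpace I ((e.extend I).symm y) :=
  mfderiv 𝓘(ℝ, E) I (e.extend I).symm y

/-- The tangent map of a chart at the point with coordinates `y`. -/
def coordCoframe (e : OpenPartialHomeomorph M H) (y : E) :
    TangentSpace I ((e.extend I).symm y) →L[ℝ] E :=
  mfderiv I 𝓘(ℝ, E) (e.extend I) ((e.extend I).symm y)

variable {I}

/-- The expression of a covariant 2-tensor field in a chart. -/
def FormField.coord (K : FormField I M) (e : OpenPartialHomeomorph M H) (y : E) :
    E →L[ℝ] E →L[ℝ] ℝ :=
  (ContinuousLinearMap.precomp ℝ (coordFrame I e y)).comp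
    ((K ((e.extend I).symm y)).comp (coordFrame I e y))

theorem FormField.coord_apply (K : FormField I M) (e : OpenPartialHomeomorph M H) (y u v : E) :
    K.coord e y u v = K ((e.extend I).symm y) (coordFrame I e y u) (coordFrame I e y v) := rfl

/-- The expression of a product of vector fields in a chart. -/
def ProductField.coord (m : ProductField I M) (e : OpenPartialHomeomorph M H) (y : E) :
    E →L[ℝ] E →L[ℝ] E :=
  (ContinuousLinearMap.postcomp E (coordCoframe I e y)).comp
    ((ContinuousLinearMap.precomp (TangentSpace I ((e.extend I).symm y)) (coordFrame I e y)).comp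
      ((m ((e.extend I).symm y)).comp (coordFrame I e y)))

theorem ProductField.coord_apply (m : ProductField I M) (e : OpenPartialHomeomorph M H)
    (y u v : E) :
    m.coord e y u v = coordCoframe I e y
      (m ((e.extend I).symm y) (coordFrame I e y u) (coordFrame I e y v)) := rfl

/-- The expression of a function in a chart. -/
def coordFun (I : ModelWithCorners ℝ E H) (V : M → ℝ) (e : OpenPartialHomeomorph M H) (y : E) : ℝ :=
  V ((e.extend I).symm y)

/-- The expression of a function on the cotangent bundle in the canonical (Darboux) coordinates
`(x,p)` induced by a chart: the covector with momenta `p` is the pullback of `p` by the chart. -/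
def PhaseFunction.coord (F : PhaseFunction I M) (e : OpenPartialHomeomorph M H)
    (z : E × (E →L[ℝ] ℝ)) : ℝ :=
  F ((e.extend I).symm z.1) (z.2.comp (coordCoframe I e z.1))

/-- A smooth symmetric covariant 2-tensor field. -/
structure FormField.IsSymmSmooth (K : FormField I M) : Prop where
  symm : ∀ x u v, K x u v = K x v u
  smooth : ∀ e ∈ IsManifold.maximalAtlas I ∞ M, ContDiffOn ℝ ∞ (K.coord e) (e.extend I).target

/-- A flat pseudo-Riemannian metric: a smooth field of nondegenerate symmetric bilinear forms, such
that around every point there are coordinates in which its coefficients are constant. -/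
structure FormField.IsFlatMetric (g : FormField I M) : Prop extends g.IsSymmSmooth where
  nondegenerate : ∀ x u, (∀ v, g x u v = 0) → u = 0
  flat : ∀ x, ∃ e ∈ IsManifold.maximalAtlas I ∞ M, x ∈ e.source ∧
    ∃ η : E →L[ℝ] E →L[ℝ] ℝ, ∀ y ∈ (e.extend I).target, g.coord e y = η

/-- `(g, m)` is a Hesse-Frobenius structure: `g` is a flat pseudo-Riemannian metric and `m`, written
`⋆`, is a smooth commutative and associative product of vector fields with
`g(X ⋆ Y, Z) = g(X, Y ⋆ Z)` and `(∇_Z ⋆)(X,Y) = X ⋆ Y ⋆ Z` for the Levi-Civita connection `∇` of `g`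
(the last identity is stated in all charts). -/
structure IsHesseFrobenius (g : FormField I M) (m : ProductField I M) : Prop where
  flatMetric : g.IsFlatMetric
  smooth : ∀ e ∈ IsManifold.maximalAtlas I ∞ M, ContDiffOn ℝ ∞ (m.coord e) (e.extend I).target
  comm : ∀ x u v, m x u v = m x v u
  assoc : ∀ x u v w, m x (m x u v) w = m x u (m x v w)
  frobenius : ∀ x u v w, g x (m x u v) w = g x u (m x v w)
  covDeriv_mul : ∀ e ∈ IsManifold.maximalAtlas I ∞ M, ∀ y ∈ (e.extend I).target, ∀ w u v : E,
    covDerivMul (g.coord e) (m.coord e) y w u v = m.coord e y (m.coord e y u v) w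

section Potentials

variable [FiniteDimensional ℝ E]

/-- Smooth solutions on `M` of the Wilczynski equation. -/
def IsWilczynskiPotential (g : FormField I M) (m : ProductField I M) (V : M → ℝ) : Prop :=
  ContMDiff I 𝓘(ℝ, ℝ) ∞ V ∧
    ∀ e ∈ IsManifold.maximalAtlas I ∞ M, ∀ y ∈ (e.extend I).target,
      WilczynskiAt (g.coord e) (m.coord e) (coordFun I V e) y

/-- Killing tensors `K` of `g` (smooth, symmetric, `∇_{(i} K_{jk)} = 0`) that satisfy
`(K^a_{i,j} + K^b_i T̂_{bj}^a) ∂_a V = (K^a_{j,i} + K^b_j T̂_{bi}^a) ∂_a V`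
for all potentials `V` that solve the Wilczynski equation. -/
structure IsCompatibleKilling (g : FormField I M) (m : ProductField I M) (K : FormField I M) :
    Prop extends K.IsSymmSmooth where
  killing : ∀ e ∈ IsManifold.maximalAtlas I ∞ M, ∀ y ∈ (e.extend I).target, ∀ u v w : E,
    covDerivForm (g.coord e) (K.coord e) y u v w + covDerivForm (g.coord e) (K.coord e) y v w u
      + covDerivForm (g.coord e) (K.coord e) y w u v = 0
  bertrandDarboux : ∀ V : M → ℝ, IsWilczynskiPotential g m V →
    ∀ e ∈ IsManifold.maximalAtlas I ∞ M, ∀ y ∈ (e.extend I).target, ∀ u v : E,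
      bertrandDarbouxForm (g.coord e) (m.coord e) (K.coord e) (coordFun I V e) y u v =
        bertrandDarbouxForm (g.coord e) (m.coord e) (K.coord e) (coordFun I V e) y v u

/-- The value at `x` of `traceCoefficient`, computed in a chart at `x`. -/
def traceCoefficientOn (g : FormField I M) (m : ProductField I M) (V : M → ℝ) (x : M) : ℝ :=
  traceCoefficient (g.coord (chartAt H x)) (m.coord (chartAt H x)) (coordFun I V (chartAt H x))
    (extChartAt I x x)

end Potentials

/-! ### Superintegrable systems -/

/-- The function `K^{ij}(x) p_i p_j + W(x)` on the cotangent bundle, where the indices of `K` are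
raised with `g`. For `K = g` this is the natural Hamiltonian with potential `W`. -/
def quadraticFunction (g K : FormField I M) (W : M → ℝ) : PhaseFunction I M :=
  fun x p => K x ((g x).inverse p) ((g x).inverse p) + W x

/-- `F` is an integral of the motion for `G`: `{F, G} = 0` on the whole cotangent bundle. -/
def IsIntegralOf [FiniteDimensional ℝ E] (F G : PhaseFunction I M) : Prop :=
  ∀ e ∈ IsManifold.maximalAtlas I ∞ M, ∀ y ∈ (e.extend I).target, ∀ p : E →L[ℝ] ℝ,
    poissonBracket (F.coord e) (G.coord e) (y, p) = 0

/-- Functional independence of functions on the cotangent bundle: their differentials are linearly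
independent at the points of a dense subset. -/
def FunctionallyIndependent {ι : Type*} (F : ι → PhaseFunction I M) : Prop :=
  ∀ e ∈ IsManifold.maximalAtlas I ∞ M,
    (e.extend I).target ×ˢ (univ : Set (E →L[ℝ] ℝ)) ⊆
      closure {z | z ∈ (e.extend I).target ×ˢ (univ : Set (E →L[ℝ] ℝ)) ∧
        LinearIndependent ℝ fun a => fderiv ℝ ((F a).coord e) z}

/-- The Hamiltonian `H = g^{ij} p_i p_j + V` has `2n - 2` integrals of the motion of the form
`K^{ij} p_i p_j + W`, with smooth `W` and with tensors `K` taken from the set `𝒦`, that are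
functionally independent together with `H`. -/
def IsSuperintegrableThrough [FiniteDimensional ℝ E] (g : FormField I M) (V : M → ℝ)
    (𝒦 : Set (FormField I M)) : Prop :=
  ∃ (K : Fin (2 * Module.finrank ℝ E - 2) → FormField I M)
    (W : Fin (2 * Module.finrank ℝ E - 2) → M → ℝ),
    (∀ a, K a ∈ 𝒦 ∧ ContMDiff I 𝓘(ℝ, ℝ) ∞ (W a) ∧
      IsIntegralOf (quadraticFunction g (K a) (W a)) (quadraticFunction g g V)) ∧
    FunctionallyIndependent fun a : Option (Fin (2 * Module.finrank ℝ E - 2)) =>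
      a.elim (quadraticFunction g g V) fun i => quadraticFunction g (K i) (W i)

/-- The natural Hamiltonian `H = g^{ij} p_i p_j + V` defines a second-order maximally
superintegrable system. -/
def IsSecondOrderMaximallySuperintegrable [FiniteDimensional ℝ E] (g : FormField I M)
    (V : M → ℝ) : Prop :=
  IsSuperintegrableThrough g V {K | K.IsSymmSmooth}

end Manifold

/-! ### Products -/

section Product

variable {E : Type*} [NormedAddCommGroup E] [NormedSpace ℝ E] {H : Type*} [TopologicalSpace H]
  {I : ModelWithCorners ℝ E H} {M : Type*} [TopologicalSpace M] [ChartedSpace H M]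
  {E' : Type*} [NormedAddCommGroup E'] [NormedSpace ℝ E'] {H' : Type*} [TopologicalSpace H']
  {J : ModelWithCorners ℝ E' H'} {N : Type*} [TopologicalSpace N] [ChartedSpace H' N]

/-- The projection `T_{(x,y)}(M × N) → T_x M`. -/
def tangentFst (I : ModelWithCorners ℝ E H) (J : ModelWithCorners ℝ E' H') (z : M × N) :
    TangentSpace (I.prod J) z →L[ℝ] TangentSpace I z.1 :=
  ContinuousLinearMap.fst ℝ (TangentSpace I z.1) (TangentSpace J z.2)

/-- The projection `T_{(x,y)}(M × N) → T_y N`. -/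
def tangentSnd (I : ModelWithCorners ℝ E H) (J : ModelWithCorners ℝ E' H') (z : M × N) :
    TangentSpace (I.prod J) z →L[ℝ] TangentSpace J z.2 :=
  ContinuousLinearMap.snd ℝ (TangentSpace I z.1) (TangentSpace J z.2)

/-- The inclusion `T_x M → T_{(x,y)}(M × N)`. -/
def tangentInl (I : ModelWithCorners ℝ E H) (J : ModelWithCorners ℝ E' H') (z : M × N) :
    TangentSpace I z.1 →L[ℝ] TangentSpace (I.prod J) z :=
  ContinuousLinearMap.inl ℝ (TangentSpace I z.1) (TangentSpace J z.2)

/-- The inclusion `T_y N → T_{(x,y)}(M × N)`. -/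
def tangentInr (I : ModelWithCorners ℝ E H) (J : ModelWithCorners ℝ E' H') (z : M × N) :
    TangentSpace J z.2 →L[ℝ] TangentSpace (I.prod J) z :=
  ContinuousLinearMap.inr ℝ (TangentSpace I z.1) (TangentSpace J z.2)

/-- The product metric `G = g + h`. -/
def prodMetric (g : FormField I M) (h : FormField J N) : FormField (I.prod J) (M × N) := fun z =>
  (ContinuousLinearMap.precomp ℝ (tangentFst I J z)).comp ((g z.1).comp (tangentFst I J z))
    + (ContinuousLinearMap.precomp ℝ (tangentSnd I J z)).comp ((h z.2).comp (tangentSnd I J z))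

theorem prodMetric_apply (g : FormField I M) (h : FormField J N) (z : M × N)
    (u v : TangentSpace (I.prod J) z) :
    prodMetric g h z u v = g z.1 (tangentFst I J z u) (tangentFst I J z v)
      + h z.2 (tangentSnd I J z u) (tangentSnd I J z v) := rfl

/-- The product `⋆ + ∗` on `M × N`: both products are extended trivially, so that all cross products
vanish. -/
def prodMul (m : ProductField I M) (m' : ProductField J N) : ProductField (I.prod J) (M × N) :=
  fun z =>
    (ContinuousLinearMap.postcomp (TangentSpace (I.prod J) z) (tangentInl I J z)).comp
      ((ContinuousLinearMap.precomp (TangentSpace I z.1) (tangentFst I J z)).comp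
        ((m z.1).comp (tangentFst I J z)))
    + (ContinuousLinearMap.postcomp (TangentSpace (I.prod J) z) (tangentInr I J z)).comp
      ((ContinuousLinearMap.precomp (TangentSpace J z.2) (tangentSnd I J z)).comp
        ((m' z.2).comp (tangentSnd I J z)))

theorem prodMul_apply (m : ProductField I M) (m' : ProductField J N) (z : M × N)
    (u v : TangentSpace (I.prod J) z) :
    prodMul m m' z u v =
      tangentInl I J z (m z.1 (tangentFst I J z u) (tangentFst I J z v))
        + tangentInr I J z (m' z.2 (tangentSnd I J z u) (tangentSnd I J z v)) := rfl

end Product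

end HesseFrobenius

end

set_option linter.unusedSectionVars false

noncomputable section

namespace HesseFrobenius

/-! ### Coordinate tensor calculus relative to a local diffeomorphism to a flat model -/

section Calculus

variable {E : Type*} [NormedAddCommGroup E] [NormedSpace ℝ E]
  {F : Type*} [NormedAddCommGroup F] [NormedSpace ℝ F]
  {F₁ : Type*} [NormedAddCommGroup F₁] [NormedSpace ℝ F₁]
  {X : Type*} [NormedAddCommGroup X] [NormedSpace ℝ X]

/-! Reduction to a vector space. A simply connected flat manifold has a developing map `D`, a local
isometry to `E` with a constant scalar product `η`; it arises by continuing an affine function from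
one flat chart to the next (`exists_isDeveloping`). In the parallel frame of `D` covariant
derivatives are ordinary derivatives, and a Hesse-Frobenius structure is a field `A` of commutative,
associative Frobenius algebras on `E` with ∂_w(a ⋆ b) = a ⋆ b ⋆ w.

The algebras. The field is determined by its value `c` at one point x₀. Put z = D x - D x₀ and let N
be the operator 1 - z⋆ formed with `c`. Then N is invertible at every point of M and `A x a b` =
N⁻¹(c a b). Both facts express uniqueness for linear differential systems (`isUnit_oneSub`,
`mul_oneSub`), which follows from Grönwall's inequality and connectedness
(`eq_zero_of_flatDeriv_le`).

Potentials. For the gradient f of V the Wilczynski equation reads df = 3 f⋆ + φ id, and φ is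
constant in dimension at least 2 because second derivatives of f are symmetric
(`coefficient_const`). So (V, f, φ) at x₀ determines V, which gives at most n + 2 parameters. All
values occur: with s = z - ½ z ⋆ z and P = N⁻¹ a solution is k + η(a, P²s) + (φ/2) η(s, P²s). For
the one-dimensional unital algebra and x = 1 - z these functions span 1, x⁻² and x², the
Smorodinsky-Winternitz potential.

Killing tensors. Compatibility with potentials of arbitrary gradient, together with the Killing
equation, determines all first derivatives of the tensor (`isFlatKilling_iff`). A solution is thus
fixed by a symmetric form B at x₀, and again every B occurs, through B(N·, N·) + 2 B(s, · ⋆ ·). The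
equation dF = K(dV) for the potential part of the integral has the primitive `generalIntegral`.

Functional independence. The choice B = η reproduces the metric, so H belongs to the same family as
its integrals. At x₀ and momentum P the differential of an integral depends exactly on the covectors
B(P, ·) and B(r, ·), where r = 2 P ⋆ P + f. If P and r are independent, these pairs fill a space of
dimension 2n - 1 (`exists_forms_linearIndependent`). Everything is analytic in the coordinates given
by `D`, so independence at one point spreads to a dense set. For constant V the vector r may be
dependent on P for every P; then `c` is replaced by an auxiliary rank-one product, which still
yields Killing tensors, though not necessarily compatible ones.

Products. The map D × D' develops the product, and the algebras add up. A solution V agrees with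
V(x, y₀) + V(x₀, y) - V(x₀, y₀) because both have the same data at (x₀, y₀) and the same φ;
conversely a sum is a solution exactly when the coefficients φ of the summands agree. -/

theorem contDiffAt_clm [FiniteDimensional ℝ F] {n : WithTop ℕ∞} {C : E → F →L[ℝ] X} {y : E}
    (h : ∀ u, ContDiffAt ℝ n (fun z => C z u) y) : ContDiffAt ℝ n C y := by
  let d := Module.finrank ℝ F
  have hd : d = Module.finrank ℝ (Fin d → ℝ) := by simp [d]
  let e₁ := ContinuousLinearEquiv.ofFinrankEq hd
  let e₂ := (e₁.arrowCongr (1 : X ≃L[ℝ] X)).trans (ContinuousLinearEquiv.piRing (Fin d))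
  rw [← Function.id_comp C, ← e₂.symm_comp_self]
  exact e₂.symm.contDiff.contDiffAt.comp y (contDiffAt_pi.mpr fun i => h _)

theorem contDiffAt_clm₂ [FiniteDimensional ℝ F] [FiniteDimensional ℝ F₁] {n : WithTop ℕ∞}
    {C : E → F →L[ℝ] F₁ →L[ℝ] X} {y : E}
    (h : ∀ u v, ContDiffAt ℝ n (fun z => C z u v) y) : ContDiffAt ℝ n C y :=
  contDiffAt_clm fun u => contDiffAt_clm fun v => h u v

theorem fderiv_apply₂ {C : E → F →L[ℝ] F₁ →L[ℝ] X} {y : E} (h : DifferentiableAt ℝ C y) (w : E)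
    (u : F) (v : F₁) : fderiv ℝ C y w u v = fderiv ℝ (fun z => C z u v) y w := by
  have h1 := ((h.hasFDerivAt.clm_apply (hasFDerivAt_const u y)).clm_apply
    (hasFDerivAt_const v y)).fderiv
  rw [h1]; simp

/-- The derivative of `z ↦ B z (a z) (b z)`. -/
theorem hasFDerivAt_bilin {B : E → F →L[ℝ] F₁ →L[ℝ] X} {a : E → F} {b : E → F₁} {y : E}
    {B' : E →L[ℝ] F →L[ℝ] F₁ →L[ℝ] X} {a' : E →L[ℝ] F} {b' : E →L[ℝ] F₁}
    (hB : HasFDerivAt B B' y) (ha : HasFDerivAt a a' y) (hb : HasFDerivAt b b' y) :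
    HasFDerivAt (fun z => B z (a z) (b z))
      ((B'.flip (a y)).flip (b y) + ((B y).flip (b y)).comp a' + (B y (a y)).comp b') y := by
  refine ((hB.clm_apply ha).clm_apply hb).congr_fderiv ?_
  ext w; simp; abel

theorem IsInvertible.of_injective [FiniteDimensional ℝ E] {A : E →L[ℝ] F}
    (hd : Module.finrank ℝ E = Module.finrank ℝ F) (hA : ∀ u, A u = 0 → u = 0) [FiniteDimensional ℝ F] :
    A.IsInvertible := by
  have hi : Function.Injective (A : E →ₗ[ℝ] F) := (injective_iff_map_eq_zero _).2 hA
  refine ⟨(LinearEquiv.ofInjectiveOfFinrankEq (A : E →ₗ[ℝ] F) hi hd).toContinuousLinearEquiv, ?_⟩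
  ext u; rfl

theorem isInvertible_of_nondegenerate [FiniteDimensional ℝ E] {η : E →L[ℝ] E →L[ℝ] ℝ}
    (hη : ∀ u, (∀ v, η u v = 0) → u = 0) : η.IsInvertible := by
  refine IsInvertible.of_injective ?_ fun u hu => hη u fun v => by simp [hu]
  rw [← LinearEquiv.finrank_eq (LinearMap.toContinuousLinearMap (𝕜 := ℝ) (E := E) (F' := ℝ))]
  exact (Subspace.dual_finrank_eq (K := ℝ) (V := E)).symm

variable {g K : E → E →L[ℝ] E →L[ℝ] ℝ} {m : E → E →L[ℝ] E →L[ℝ] E} {η : E →L[ℝ] E →L[ℝ] ℝ}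
  {ψ : E → E} {y : E} [FiniteDimensional ℝ E]

theorem hasFDerivAt_fderiv_apply (hψ : ContDiffAt ℝ 2 ψ y) (u : E) :
    HasFDerivAt (fun z => fderiv ℝ ψ z u) ((fderiv ℝ (fderiv ℝ ψ) y).flip u) y := by
  have h : DifferentiableAt ℝ (fderiv ℝ ψ) y :=
    (hψ.fderiv_right (m := 1) (by norm_num)).differentiableAt (by norm_num)
  refine (h.hasFDerivAt.clm_apply (hasFDerivAt_const u y)).congr_fderiv ?_
  ext w; simp

/-- The derivative of a bilinear field pulled back by a local diffeomorphism. -/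
theorem fderiv_pullback {B C : E → E →L[ℝ] E →L[ℝ] X} (hψ : ContDiffAt ℝ 2 ψ y)
    (hB : ContDiffAt ℝ 1 B y)
    (hC : ∀ᶠ z in 𝓝 y, ∀ u v, C z u v = B z (fderiv ℝ ψ z u) (fderiv ℝ ψ z v)) (w u v : E) :
    fderiv ℝ C y w u v = fderiv ℝ B y w (fderiv ℝ ψ y u) (fderiv ℝ ψ y v)
      + B y (fderiv ℝ (fderiv ℝ ψ) y w u) (fderiv ℝ ψ y v)
      + B y (fderiv ℝ ψ y u) (fderiv ℝ (fderiv ℝ ψ) y w v) := by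
  have hψ1 : ContDiffAt ℝ 1 (fderiv ℝ ψ) y := hψ.fderiv_right (m := 1) (by norm_num)
  have hCd : ContDiffAt ℝ 1 C y := by
    refine contDiffAt_clm₂ fun u v => ?_
    have : (fun z => C z u v) =ᶠ[𝓝 y] fun z => B z (fderiv ℝ ψ z u) (fderiv ℝ ψ z v) :=
      hC.mono fun z hz => hz u v
    refine ContDiffAt.congr_of_eventuallyEq ?_ this
    exact (hB.clm_apply (hψ1.clm_apply contDiffAt_const)).clm_apply (hψ1.clm_apply contDiffAt_const)
  rw [fderiv_apply₂ (hCd.differentiableAt (by norm_num))]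
  have : (fun z => C z u v) =ᶠ[𝓝 y] fun z => B z (fderiv ℝ ψ z u) (fderiv ℝ ψ z v) :=
    hC.mono fun z hz => hz u v
  rw [this.fderiv_eq, (hasFDerivAt_bilin (hB.differentiableAt (by norm_num)).hasFDerivAt
    (hasFDerivAt_fderiv_apply hψ u) (hasFDerivAt_fderiv_apply hψ v)).fderiv]
  simp

theorem fderiv_fderiv_symm (hψ : ContDiffAt ℝ 2 ψ y) (u v : E) :
    fderiv ℝ (fderiv ℝ ψ) y u v = fderiv ℝ (fderiv ℝ ψ) y v u :=
  (hψ.isSymmSndFDerivAt (by simp)).eq u v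

/-- Data of a chart in which a flat metric is the pullback of a constant form. -/
structure IsFlatPullback (η : E →L[ℝ] E →L[ℝ] ℝ) (g : E → E →L[ℝ] E →L[ℝ] ℝ) (ψ : E → E)
    (y : E) : Prop where
  smooth : ContDiffAt ℝ ∞ ψ y
  symm : ∀ u v, η u v = η v u
  metric : ∀ᶠ z in 𝓝 y, ∀ u v, g z u v = η (fderiv ℝ ψ z u) (fderiv ℝ ψ z v)
  nondeg : ∀ u, (∀ v, η u v = 0) → u = 0
  inj : ∀ u, fderiv ℝ ψ y u = 0 → u = 0

namespace IsFlatPullback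

variable (H : IsFlatPullback η g ψ y)
include H

theorem smooth_two : ContDiffAt ℝ 2 ψ y := H.smooth.of_le (WithTop.coe_le_coe.2 (le_top (a := (2 : ℕ∞))))

theorem fderiv_invertible : (fderiv ℝ ψ y).IsInvertible := IsInvertible.of_injective rfl H.inj

theorem surj (v : E) : ∃ u, fderiv ℝ ψ y u = v := H.fderiv_invertible.surjective v

theorem metric_at (u v : E) : g y u v = η (fderiv ℝ ψ y u) (fderiv ℝ ψ y v) :=
  H.metric.self_of_nhds u v

theorem g_invertible : (g y).IsInvertible := by
  refine isInvertible_of_nondegenerate fun u hu => H.inj _ (H.nondeg _ fun v => ?_)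
  obtain ⟨v, rfl⟩ := H.surj v
  rw [← H.metric_at, hu]

/-- In the Koszul formula for g = η(dψ, dψ) the symmetry of ψ'' cancels four of the six terms; the
other two are equal and give η(ψ''(u,v), dψ w). Nondegeneracy of η then removes the pairing. In
other words, ψ is an affine map for the two connections. -/
theorem fderiv_christoffel (u v : E) :
    fderiv ℝ ψ y (christoffel g y u v) = fderiv ℝ (fderiv ℝ ψ) y u v := by
  have h1 : g y (christoffel g y u v) = christoffelFirst g y u v := by
    simp [christoffel, H.g_invertible.self_apply_inverse]
  have hg := fun w u v => fderiv_pullback H.smooth_two (B := fun _ => η) contDiffAt_const H.metric w u v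
  rw [← sub_eq_zero]
  refine H.nondeg _ fun w => ?_
  obtain ⟨w, rfl⟩ := H.surj w
  have h2 : g y (christoffel g y u v) w = christoffelFirst g y u v w := by rw [h1]
  rw [H.metric_at, christoffelFirst_apply, hg, hg, hg] at h2
  have hs := fderiv_fderiv_symm H.smooth_two
  rw [map_sub, sub_apply, h2, hs w u, hs w v, hs v u,
    H.symm (fderiv ℝ ψ y v) (fderiv ℝ (fderiv ℝ ψ) y u w)]
  simp
  rw [H.symm (fderiv ℝ ψ y u)  (fderiv ℝ (fderiv ℝ ψ) y v w), H.symm (fderiv ℝ (fderiv ℝ ψ) y v w)]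
  ring

/-- The two ψ'' terms from differentiating a pullback are exactly the Christoffel corrections, so
only the plain derivative of the components survives. -/
theorem covDerivForm_eq {B : E → E →L[ℝ] E →L[ℝ] ℝ} (hB : ContDiffAt ℝ 1 B y)
    (hK : ∀ᶠ z in 𝓝 y, ∀ u v, K z u v = B z (fderiv ℝ ψ z u) (fderiv ℝ ψ z v)) (w u v : E) :
    covDerivForm g K y w u v = fderiv ℝ B y w (fderiv ℝ ψ y u) (fderiv ℝ ψ y v) := by
  rw [covDerivForm, fderiv_pullback H.smooth_two hB hK, hK.self_of_nhds, hK.self_of_nhds,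
    H.fderiv_christoffel, H.fderiv_christoffel]
  ring

theorem covDerivMul_eq {B : E → E →L[ℝ] E →L[ℝ] E} (hB : ContDiffAt ℝ 1 B y)
    (hmd : DifferentiableAt ℝ m y)
    (hm : ∀ᶠ z in 𝓝 y, ∀ u v, fderiv ℝ ψ z (m z u v) = B z (fderiv ℝ ψ z u) (fderiv ℝ ψ z v))
    (w u v : E) :
    fderiv ℝ ψ y (covDerivMul g m y w u v) =
      fderiv ℝ B y w (fderiv ℝ ψ y u) (fderiv ℝ ψ y v) := by
  have hd : DifferentiableAt ℝ (fderiv ℝ ψ) y :=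
    (H.smooth_two.fderiv_right (m := 1) (by norm_num)).differentiableAt (by norm_num)
  -- The product itself is not a pullback, since its value is a vector, but its image under dψ is
  -- one. Differentiating this image once as a pullback and once by the product rule gives the
  -- claim.
  let C : E → E →L[ℝ] E →L[ℝ] E := fun z =>
    (ContinuousLinearMap.compL ℝ E E E (fderiv ℝ ψ z)).comp (m z)
  have hC := fderiv_pullback (C := C) H.smooth_two hB hm w u v
  have hCd : DifferentiableAt ℝ C y :=
    ((ContinuousLinearMap.compL ℝ E E E).differentiableAt.comp y hd).clm_comp hmd
  rw [fderiv_apply₂ hCd] at hC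
  have h3 : HasFDerivAt (fun z => C z u v) _ y :=
    hd.hasFDerivAt.clm_apply ((hmd.hasFDerivAt.clm_apply (hasFDerivAt_const u y)).clm_apply
      (hasFDerivAt_const v y))
  rw [h3.fderiv] at hC
  simp at hC
  simp only [covDerivMul, map_sub, map_add, H.fderiv_christoffel, hm.self_of_nhds]
  rw [hC]; abel

/-- Here f is the gradient in the parallel frame. The product rule for η(f, dψ) yields a term η(f,
ψ''), which the Christoffel term of the Hessian cancels. -/
theorem hessian_eq {V : E → ℝ} {f : E → E} (hf : DifferentiableAt ℝ f y)
    (hV : ∀ᶠ z in 𝓝 y, ∀ u, fderiv ℝ V z u = η (f z) (fderiv ℝ ψ z u)) (u v : E) :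
    hessian g V y u v = η (fderiv ℝ f y u) (fderiv ℝ ψ y v) := by
  have hd : DifferentiableAt ℝ (fderiv ℝ ψ) y :=
    (H.smooth_two.fderiv_right (m := 1) (by norm_num)).differentiableAt (by norm_num)
  have h1 : fderiv ℝ V =ᶠ[𝓝 y] fun z => (η (f z)).comp (fderiv ℝ ψ z) := by
    filter_upwards [hV] with z hz; ext u; simp [hz]
  have h2 : HasFDerivAt (fun z => (η (f z)).comp (fderiv ℝ ψ z)) _ y :=
    ((η.hasFDerivAt (x := f y)).comp y hf.hasFDerivAt).clm_comp hd.hasFDerivAt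
  have h4 := hV.self_of_nhds (christoffel g y u v)
  rw [H.fderiv_christoffel] at h4
  simp [hessian, h1.fderiv_eq, h2.fderiv, h4]

theorem gradient_eq {V : E → ℝ} {f : E} (hV : ∀ u, fderiv ℝ V y u = η f (fderiv ℝ ψ y u)) :
    fderiv ℝ ψ y (gradient g V y) = f := by
  rw [← sub_eq_zero]
  refine H.nondeg _ fun v => ?_
  obtain ⟨v, rfl⟩ := H.surj v
  rw [map_sub, sub_apply, ← H.metric_at, gradient,
    H.g_invertible.self_apply_inverse, hV, sub_self]

end IsFlatPullback

/-- The metric trace of the metric is the dimension. -/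
theorem metricTrace_self {γ : E →L[ℝ] E →L[ℝ] ℝ} (hs : ∀ u v, γ u v = γ v u)
    (hγ : γ.IsInvertible) : metricTrace γ γ = Module.finrank ℝ E := by
  have : ∀ i, γ (Module.finBasis ℝ E i)
      (γ.inverse (LinearMap.toContinuousLinearMap ((Module.finBasis ℝ E).coord i))) = 1 := by
    intro i
    rw [hs, hγ.self_apply_inverse]; simp
  simp [metricTrace, this]

/-- The Wilczynski equation, with the coefficient of the metric as an unknown. -/
theorem wilczynskiAt_iff [Nontrivial E] {V : E → ℝ} (hs : ∀ u v, g y u v = g y v u)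
    (hγ : (g y).IsInvertible) :
    WilczynskiAt g m V y ↔ ∃ φ : ℝ, ∀ u v,
      hessian g V y u v = 3 * fderiv ℝ V y (m y u v) + φ * g y u v := by
  constructor
  · intro h
    refine ⟨traceCoefficient g m V y, fun u v => ?_⟩
    rw [h u v]; simp [structureTensor, traceCoefficient]; ring
  · rintro ⟨φ, h⟩ u v
    have hn : (Module.finrank ℝ E : ℝ) ≠ 0 := by exact_mod_cast Module.finrank_pos.ne'
    -- The g-trace of the hypothesis, with tr g = n; it identifies φ with the trace coefficient.
    have ht : laplacian g V y = 3 * fderiv ℝ V y (metricTrace (g y) (m y))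
        + φ * Module.finrank ℝ E := by
      rw [← metricTrace_self hs hγ]
      simp [laplacian, metricTrace, h, Finset.sum_add_distrib, Finset.mul_sum]
    rw [h, ht]; simp [structureTensor]; field_simp; ring

theorem traceCoefficient_eq [Nontrivial E] {V : E → ℝ} (hs : ∀ u v, g y u v = g y v u)
    (hγ : (g y).IsInvertible) {φ : ℝ}
    (h : ∀ u v, hessian g V y u v = 3 * fderiv ℝ V y (m y u v) + φ * g y u v) :
    traceCoefficient g m V y = φ := by
  have hn : (Module.finrank ℝ E : ℝ) ≠ 0 := by exact_mod_cast Module.finrank_pos.ne'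
  have ht : laplacian g V y = 3 * fderiv ℝ V y (metricTrace (g y) (m y))
      + φ * Module.finrank ℝ E := by
    rw [← metricTrace_self hs hγ]
    simp [laplacian, metricTrace, h, Finset.sum_add_distrib, Finset.mul_sum]
  rw [traceCoefficient, ht]; field_simp; ring

end Calculus

/-! ### Differentiation with respect to a local homeomorphism to a vector space -/

section FlatDerivative

variable {E : Type*} [NormedAddCommGroup E] [NormedSpace ℝ E]
  {M : Type*} [TopologicalSpace M] {D : M → E}
  {X : Type*} [NormedAddCommGroup X] [NormedSpace ℝ X]
  {Y : Type*} [NormedAddCommGroup Y] [NormedSpace ℝ Y]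
  {Z : Type*} [NormedAddCommGroup Z] [NormedSpace ℝ Z]

/-- `F'` is the derivative of `F` at `x`, in the local coordinates given by `D`. -/
def HasFlatDerivAt (D : M → E) (F : M → X) (F' : E →L[ℝ] X) (x : M) : Prop :=
  ∃ G : E → X, HasFDerivAt G F' (D x) ∧ F =ᶠ[𝓝 x] G ∘ D

/-- `F` is of class `C^n` at `x`, in the local coordinates given by `D`. -/
def FlatContDiffAt (n : WithTop ℕ∞) (D : M → E) (F : M → X) (x : M) : Prop :=
  ∃ G : E → X, ContDiffAt ℝ n G (D x) ∧ F =ᶠ[𝓝 x] G ∘ D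

theorem _root_.HasFDerivAt.flat {G : E → X} {G' : E →L[ℝ] X} {x : M}
    (h : HasFDerivAt G G' (D x)) : HasFlatDerivAt D (fun x => G (D x)) G' x := ⟨G, h, .rfl⟩

theorem _root_.ContDiffAt.flat {n : WithTop ℕ∞} {G : E → X} {x : M}
    (h : ContDiffAt ℝ n G (D x)) : FlatContDiffAt n D (fun x => G (D x)) x := ⟨G, h, .rfl⟩

variable {x : M} {n : WithTop ℕ∞}

theorem hasFlatDerivAt_const (c : X) : HasFlatDerivAt D (fun _ => c) 0 x :=
  (hasFDerivAt_const c (D x)).flat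

theorem flatContDiffAt_const (c : X) : FlatContDiffAt n D (fun _ => c) x :=
  contDiffAt_const.flat

namespace HasFlatDerivAt

variable {F F₁ : M → X} {F' F₁' : E →L[ℝ] X} {F₂ : M → Y} {F₂' : E →L[ℝ] Y}

theorem congr_deriv (h : HasFlatDerivAt D F F' x) (h' : ∀ w, F' w = F₁' w) :
    HasFlatDerivAt D F F₁' x := by
  rwa [← ContinuousLinearMap.ext h']

theorem congr (h : HasFlatDerivAt D F F' x) (h' : ∀ x, F₁ x = F x) :
    HasFlatDerivAt D F₁ F' x := by
  rwa [funext h']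

theorem comp {Φ : X → Y} {Φ' : X →L[ℝ] Y} (h : HasFlatDerivAt D F F' x)
    (hΦ : HasFDerivAt Φ Φ' (F x)) : HasFlatDerivAt D (fun x => Φ (F x)) (Φ'.comp F') x := by
  obtain ⟨G, hG, hF⟩ := h
  have h0 := hF.self_of_nhds
  refine ⟨fun z => Φ (G z), HasFDerivAt.comp (D x) (by simpa [h0] using hΦ) hG, ?_⟩
  filter_upwards [hF] with z hz
  simp [hz]

theorem prodMk (h₁ : HasFlatDerivAt D F F' x) (h₂ : HasFlatDerivAt D F₂ F₂' x) :
    HasFlatDerivAt D (fun x => (F x, F₂ x)) (F'.prod F₂') x := by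
  obtain ⟨G, hG, hF⟩ := h₁
  obtain ⟨G₂, hG₂, hF₂⟩ := h₂
  refine ⟨fun z => (G z, G₂ z), hG.prodMk hG₂, ?_⟩
  filter_upwards [hF, hF₂] with z hz hz₂
  simp [hz, hz₂]

theorem clm (L : X →L[ℝ] Y) (h : HasFlatDerivAt D F F' x) :
    HasFlatDerivAt D (fun x => L (F x)) (L.comp F') x := h.comp L.hasFDerivAt

theorem add (h : HasFlatDerivAt D F F' x) (h₁ : HasFlatDerivAt D F₁ F₁' x) :
    HasFlatDerivAt D (fun x => F x + F₁ x) (F' + F₁') x :=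
  (h.prodMk h₁).comp (hasFDerivAt_fst.add hasFDerivAt_snd)

theorem sub (h : HasFlatDerivAt D F F' x) (h₁ : HasFlatDerivAt D F₁ F₁' x) :
    HasFlatDerivAt D (fun x => F x - F₁ x) (F' - F₁') x :=
  (h.prodMk h₁).comp (hasFDerivAt_fst.sub hasFDerivAt_snd)

theorem const_smul (h : HasFlatDerivAt D F F' x) (r : ℝ) :
    HasFlatDerivAt D (fun x => r • F x) (r • F') x :=
  h.comp ((hasFDerivAt_id _).const_smul r)

theorem clm_apply {B : M → X →L[ℝ] Y} {B' : E →L[ℝ] X →L[ℝ] Y}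
    (hB : HasFlatDerivAt D B B' x) (h : HasFlatDerivAt D F F' x) :
    HasFlatDerivAt D (fun x => B x (F x)) (B'.flip (F x) + (B x).comp F') x := by
  refine ((hB.prodMk h).comp (Φ := fun q => q.1 q.2)
    (hasFDerivAt_fst.clm_apply hasFDerivAt_snd)).congr_deriv fun w => ?_
  simp [add_comm]

/-- A local homeomorphism carries the neighbourhood filter of x onto that of D x, so two local
representatives that agree after composition with `D` agree near D x. -/
theorem unique (hD : IsLocalHomeomorph D) (h : HasFlatDerivAt D F F' x)
    (h₁ : HasFlatDerivAt D F F₁' x) : F' = F₁' := by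
  obtain ⟨G, hG, hF⟩ := h
  obtain ⟨G₁, hG₁, hF₁⟩ := h₁
  refine hG.unique (hG₁.congr_of_eventuallyEq ?_)
  have : (fun z => G (D z) = G₁ (D z)) =ᶠ[𝓝 x] fun _ => True := by
    filter_upwards [hF, hF₁] with z h1 h2
    simp only [Function.comp_apply] at h1 h2
    simp [← h1, ← h2]
  rw [Filter.EventuallyEq, ← hD.map_nhds_eq x, Filter.eventually_map]
  filter_upwards [this] with z hz using by simpa using hz

end HasFlatDerivAt

namespace FlatContDiffAt

variable {F F₁ : M → X} {F₂ : M → Y}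

theorem comp {Φ : X → Y} (h : FlatContDiffAt n D F x) (hΦ : ContDiffAt ℝ n Φ (F x)) :
    FlatContDiffAt n D (fun x => Φ (F x)) x := by
  obtain ⟨G, hG, hF⟩ := h
  have h0 := hF.self_of_nhds
  refine ⟨fun z => Φ (G z), ContDiffAt.comp (D x) (by simpa [h0] using hΦ) hG, ?_⟩
  filter_upwards [hF] with z hz
  simp [hz]

theorem prodMk (h₁ : FlatContDiffAt n D F x) (h₂ : FlatContDiffAt n D F₂ x) :
    FlatContDiffAt n D (fun x => (F x, F₂ x)) x := by
  obtain ⟨G, hG, hF⟩ := h₁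
  obtain ⟨G₂, hG₂, hF₂⟩ := h₂
  refine ⟨fun z => (G z, G₂ z), hG.prodMk hG₂, ?_⟩
  filter_upwards [hF, hF₂] with z hz hz₂
  simp [hz, hz₂]

theorem clm_apply {B : M → X →L[ℝ] Y} (hB : FlatContDiffAt n D B x) (h : FlatContDiffAt n D F x) :
    FlatContDiffAt n D (fun x => B x (F x)) x :=
  (hB.prodMk h).comp (Φ := fun q => q.1 q.2) (contDiffAt_fst.clm_apply contDiffAt_snd)

theorem congr (h : FlatContDiffAt n D F x) (h' : ∀ x, F₁ x = F x) :
    FlatContDiffAt n D F₁ x := by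
  rwa [funext h']

theorem exists_deriv (h : FlatContDiffAt n D F x) (hn : n ≠ 0) :
    ∃ F', HasFlatDerivAt D F F' x := by
  obtain ⟨G, hG, hF⟩ := h
  exact ⟨_, G, (hG.differentiableAt hn).hasFDerivAt, hF⟩

theorem continuousAt (hD : ContinuousAt D x) (h : FlatContDiffAt n D F x) : ContinuousAt F x := by
  obtain ⟨G, hG, hF⟩ := h
  exact (ContinuousAt.comp hG.continuousAt hD).congr hF.symm

end FlatContDiffAt

/-- The representatives given by the hypothesis depend on u; composing with a local inverse of `D`
provides one representative for all u. -/
theorem flatContDiffAt_clm [FiniteDimensional ℝ X] (hD : IsLocalHomeomorph D)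
    {B : M → X →L[ℝ] Y} (h : ∀ u, FlatContDiffAt n D (fun x => B x u) x) :
    FlatContDiffAt n D B x := by
  obtain ⟨d, hx, rfl⟩ := hD x
  refine ⟨B ∘ d.symm, contDiffAt_clm fun u => ?_, ?_⟩
  · obtain ⟨G, hG, hF⟩ := h u
    refine hG.congr_of_eventuallyEq ?_
    have h1 : Filter.Tendsto d.symm (𝓝 (d x)) (𝓝 x) := by
      simpa [hx] using (d.continuousAt_symm (d.map_source hx)).tendsto
    filter_upwards [h1.eventually hF, d.open_target.mem_nhds (d.map_source hx)] with z hz hz'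
    simpa [hz'] using hz
  · filter_upwards [d.open_source.mem_nhds hx] with z hz
    simp [hz]

/-- A function that is differentiable along all of `M` has a derivative near `D x`. -/
theorem exists_local_representative (hD : IsLocalHomeomorph D) (F : M → X) (F' : M → E →L[ℝ] X)
    (h : ∀ x, HasFlatDerivAt D F (F' x) x) (x : M) :
    ∃ G : E → X, ∃ σ : E → M, σ (D x) = x ∧ ContinuousAt σ (D x) ∧ (∀ᶠ z in 𝓝 (D x), D (σ z) = z) ∧
      (∀ z, G z = F (σ z)) ∧ ∀ᶠ z in 𝓝 (D x), HasFDerivAt G (F' (σ z)) z := by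
  obtain ⟨d, hx, rfl⟩ := hD x
  refine ⟨F ∘ d.symm, d.symm, d.left_inv hx, d.continuousAt_symm (d.map_source hx), ?_,
    fun _ => rfl, ?_⟩
  · filter_upwards [d.open_target.mem_nhds (d.map_source hx)] with z hz using d.right_inv hz
  · filter_upwards [d.open_target.mem_nhds (d.map_source hx)] with z hz
    obtain ⟨G, hG, hF⟩ := h (d.symm z)
    rw [d.right_inv hz] at hG
    refine hG.congr_of_eventuallyEq ?_
    have h1 : Filter.Tendsto d.symm (𝓝 z) (𝓝 (d.symm z)) := (d.continuousAt_symm hz).tendsto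
    filter_upwards [h1.eventually hF, d.open_target.mem_nhds hz] with t ht ht'
    simpa [ht'] using ht

/-- Grönwall's inequality along the segment from z₁ to z. The starting point is an arbitrary point
of the ball, not its centre, so that zeros propagate both out of and into the centre. -/
theorem eqOn_zero_of_gronwall {r C : ℝ} {G : E → X} {G' : E → E →L[ℝ] X} {z₀ : E}
    (hG : ∀ z ∈ Metric.ball z₀ r, HasFDerivAt G (G' z) z)
    (hC : ∀ z ∈ Metric.ball z₀ r, ‖G' z‖ ≤ C * ‖G z‖) {z₁ z : E} (h₁ : z₁ ∈ Metric.ball z₀ r)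
    (hz : z ∈ Metric.ball z₀ r) (h0 : G z₁ = 0) : G z = 0 := by
  let γ : ℝ → E := fun t => z₁ + t • (z - z₁)
  have hγ : ∀ t ∈ Icc (0 : ℝ) 1, γ t ∈ Metric.ball z₀ r := fun t ht =>
    (convex_ball z₀ r).add_smul_sub_mem h₁ hz ht
  have hγ' : ∀ t, HasDerivAt γ (z - z₁) t := fun t => by
    simpa [γ] using ((hasDerivAt_id t).smul_const (z - z₁)).const_add z₁
  have hd : ∀ t ∈ Icc (0 : ℝ) 1, HasDerivAt (fun t => G (γ t)) (G' (γ t) (z - z₁)) t := fun t ht =>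
    (hG _ (hγ t ht)).comp_hasDerivAt t (hγ' t)
  have := norm_le_gronwallBound_of_norm_deriv_right_le (f := fun t => G (γ t))
    (f' := fun t => G' (γ t) (z - z₁)) (δ := 0) (K := C * ‖z - z₁‖) (ε := 0) (a := 0) (b := 1)
    (fun t ht => (hd t ht).continuousAt.continuousWithinAt)
    (fun t ht => (hd t (Ico_subset_Icc_self ht)).hasDerivWithinAt) (by simp [γ, h0])
    (fun t ht => by
      refine ((G' (γ t)).le_opNorm _).trans ?_
      have := mul_le_mul_of_nonneg_right (hC _ (hγ t (Ico_subset_Icc_self ht)))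
        (norm_nonneg (z - z₁))
      linarith) 1 (by simp)
  rw [gronwallBound_ε0_δ0] at this
  simpa [γ] using this

/-- A solution of a linear differential system that vanishes at a point is zero. -/
theorem eq_zero_of_flatDeriv_le [PreconnectedSpace M] (hD : IsLocalHomeomorph D) {F : M → X}
    {F' : M → E →L[ℝ] X} {C : M → ℝ} (hF : ∀ x, HasFlatDerivAt D F (F' x) x) (hC : Continuous C)
    (hle : ∀ x, ‖F' x‖ ≤ C x * ‖F x‖) {x₀ : M} (h0 : F x₀ = 0) (x : M) : F x = 0 := by
  -- Zeros propagate between any two points near x. With y = x the zero set is open, and with z = x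
  -- so is its complement.
  have key : ∀ x : M, ∀ᶠ y in 𝓝 x, ∀ᶠ z in 𝓝 x, F y = 0 → F z = 0 := by
    intro x
    obtain ⟨G, σ, hσx, hσ, hDσ, hGF, hG⟩ := exists_local_representative hD F F' hF x
    have hb : ∀ᶠ z in 𝓝 (D x), C (σ z) < C x + 1 := by
      refine (hC.continuousAt.comp hσ).eventually_lt continuousAt_const ?_
      simp [hσx]
    obtain ⟨r, hr, hball⟩ := Metric.eventually_nhds_iff_ball.1 (hG.and (hDσ.and hb))
    -- Both y and σ (D y) lie in an open set on which `D` is injective, and they have the same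
    -- image.
    have hrep : ∀ᶠ y in 𝓝 x, σ (D y) = y ∧ D y ∈ Metric.ball (D x) r := by
      obtain ⟨d, hx, hd⟩ := hD x
      have h1 : ∀ᶠ y in 𝓝 x, D y ∈ Metric.ball (D x) r :=
        hD.continuous.continuousAt.eventually (Metric.ball_mem_nhds _ hr)
      have h2 : Filter.Tendsto (fun y => σ (D y)) (𝓝 x) (𝓝 x) := by
        have := hσ.tendsto.comp (hD.continuous.continuousAt (x := x)).tendsto
        rwa [hσx] at this
      filter_upwards [h1, h2.eventually (d.open_source.mem_nhds hx), d.open_source.mem_nhds hx]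
        with y hy1 hy2 hy3
      refine ⟨d.injOn hy2 hy3 ?_, hy1⟩
      rw [← hd]; exact (hball _ hy1).2.1
    filter_upwards [hrep] with y hy
    filter_upwards [hrep] with z hz h
    rw [← hz.1, ← hGF]
    refine eqOn_zero_of_gronwall (C := C x + 1) (fun t ht => (hball t ht).1) (fun t ht => ?_)
      hy.2 hz.2 (by rw [hGF, hy.1, h])
    rw [hGF]
    exact (hle _).trans (mul_le_mul_of_nonneg_right (hball t ht).2.2.le (norm_nonneg _))
  have hopen : IsOpen {x | F x = 0} := by
    rw [isOpen_iff_mem_nhds]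
    intro x hx
    filter_upwards [(key x).self_of_nhds] with z hz using hz hx
  have hclosed : IsOpen {x | F x = 0}ᶜ := by
    rw [isOpen_iff_mem_nhds]
    intro x hx
    filter_upwards [key x] with y hy h
    exact hx (hy.self_of_nhds h)
  have := IsClopen.eq_univ (s := {x | F x = 0}) ⟨⟨hclosed⟩, hopen⟩ ⟨x₀, h0⟩
  exact (this ▸ mem_univ x : x ∈ {x | F x = 0})

theorem eq_of_flatDeriv_zero [PreconnectedSpace M] (hD : IsLocalHomeomorph D) {F : M → X}
    (hF : ∀ x, HasFlatDerivAt D F 0 x) (x y : M) : F x = F y := by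
  have := eq_zero_of_flatDeriv_le hD (F := fun x => F x - F y) (F' := fun _ => 0) (C := fun _ => 0)
    (fun x => ((hF x).sub (hasFlatDerivAt_const (F y))).congr_deriv (by simp)) continuous_const
    (by simp) (x₀ := y) (by simp) x
  exact sub_eq_zero.1 this

/-- The identity theorem. -/
theorem not_eventually_eq_zero_of_analytic [PreconnectedSpace M] (hD : IsLocalHomeomorph D)
    {F : M → X} (hF : ∀ x, FlatContDiffAt ω D F x) [CompleteSpace X] {x₀ : M} (h0 : F x₀ ≠ 0)
    (x : M) : ∃ᶠ y in 𝓝 x, F y ≠ 0 := by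
  by_contra hx
  simp only [Filter.not_frequently, not_not] at hx
  have hopen : IsOpen {x | ∀ᶠ y in 𝓝 x, F y = 0} := isOpen_setOfPred_eventually_nhds
  have hclosed : IsOpen {x | ∀ᶠ y in 𝓝 x, F y = 0}ᶜ := by
    rw [isOpen_iff_mem_nhds]
    intro x hx
    obtain ⟨G, hG, hFG⟩ := hF x
    obtain ⟨r, hr, hball⟩ := Metric.eventually_nhds_iff_ball.1
      (hG.analyticAt.eventually_analyticAt)
    have h1 : ∀ᶠ y in 𝓝 x, D y ∈ Metric.ball (D x) r :=
      hD.continuous.continuousAt.eventually (Metric.ball_mem_nhds _ hr)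
    filter_upwards [h1, hFG.eventually_nhds] with y hy hy2 hzero
    refine hx ?_
    have hG0 : G =ᶠ[𝓝 (D y)] 0 := by
      rw [Filter.EventuallyEq, ← hD.map_nhds_eq y, Filter.eventually_map]
      filter_upwards [hy2, hzero] with t ht ht'
      simpa [ht] using ht'
    -- If some y close to x has a neighbourhood of zeros, the representative vanishes on the whole
    -- ball, hence near D x: the complement of the set of such points is open.
    have := AnalyticOnNhd.eqOn_zero_of_preconnected_of_eventuallyEq_zero (f := G)
      (U := Metric.ball (D x) r) (fun z hz => hball z hz) (convex_ball _ _).isPreconnected hy hG0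
    filter_upwards [hFG, h1] with t ht ht'
    simpa [ht] using this ht'
  have := IsClopen.eq_univ (s := {x | ∀ᶠ y in 𝓝 x, F y = 0}) ⟨⟨hclosed⟩, hopen⟩ ⟨x, hx⟩
  exact h0 ((this ▸ mem_univ x₀ : x₀ ∈ {x | ∀ᶠ y in 𝓝 x, F y = 0}).self_of_nhds)

end FlatDerivative

/-! ### Charts and developing maps -/

section Charts

variable {E : Type*} [NormedAddCommGroup E] [NormedSpace ℝ E]
  {H : Type*} [TopologicalSpace H] {I : ModelWithCorners ℝ E H} [I.Boundaryless]
  {M : Type*} [TopologicalSpace M] [ChartedSpace H M]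
  {X : Type*} [NormedAddCommGroup X] [NormedSpace ℝ X]
  {e : OpenPartialHomeomorph M H} {y : E}

theorem contMDiffAt_extend_symm (he : e ∈ IsManifold.maximalAtlas I ∞ M)
    (hy : y ∈ (e.extend I).target) : ContMDiffAt 𝓘(ℝ, E) I ∞ (e.extend I).symm y := by
  have := contMDiffOn_extend_symm he
  rw [← OpenPartialHomeomorph.extend_target'] at this
  exact this.contMDiffAt (e.isOpen_extend_target.mem_nhds hy)

theorem contMDiffAt_extend_of_mem [IsManifold I ∞ M] (he : e ∈ IsManifold.maximalAtlas I ∞ M)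
    {x : M} (hx : x ∈ e.source) : ContMDiffAt I 𝓘(ℝ, E) ∞ (e.extend I) x :=
  e.contMDiffAt_extend he hx

theorem extend_symm_mem (hy : y ∈ (e.extend I).target) : (e.extend I).symm y ∈ e.source := by
  simpa using (e.extend I).map_target hy

theorem coordFrame_coordCoframe [IsManifold I ∞ M] (he : e ∈ IsManifold.maximalAtlas I ∞ M)
    (hy : y ∈ (e.extend I).target) (u : TangentSpace I ((e.extend I).symm y)) :
    coordFrame I e y (coordCoframe I e y u) = u := by
  have h1 := (contMDiffAt_extend_symm he hy).mdifferentiableAt (by simp)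
  have hx := extend_symm_mem hy
  have h2 := (contMDiffAt_extend_of_mem he hx).mdifferentiableAt (by simp)
  have hyy := (e.extend I).right_inv hy
  rw [← hyy] at h1
  have h3 := h1.hasMFDerivAt.comp _ h2.hasMFDerivAt
  have h4 : (e.extend I).symm ∘ (e.extend I) =ᶠ[𝓝 ((e.extend I).symm y)] id := by
    filter_upwards [e.open_source.mem_nhds hx] with z hz
    exact e.extend_left_inv hz
  have h5 := hasMFDerivAt_unique h3 ((hasMFDerivAt_id (I := I) _).congr_of_eventuallyEq h4)
  have h6 := congrArg (fun L => L u) h5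
  change mfderiv 𝓘(ℝ, E) I (e.extend I).symm (e.extend I ((e.extend I).symm y))
    (coordCoframe I e y u) = u at h6
  -- The chain rule produces the frame based at e (e⁻¹ y), which equals y only propositionally.
  -- Reading all tangent spaces as E allows the base point to be replaced.
  have key : ∀ (t : E), t = y → ∀ v : E,
      (mfderiv 𝓘(ℝ, E) I (e.extend I).symm t v : E) = (mfderiv 𝓘(ℝ, E) I (e.extend I).symm y v : E) := by
    rintro t rfl v; rfl
  exact (key _ hyy _).symm.trans h6

theorem coordCoframe_coordFrame [IsManifold I ∞ M] (he : e ∈ IsManifold.maximalAtlas I ∞ M)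
    (hy : y ∈ (e.extend I).target) (u : E) :
    coordCoframe I e y (coordFrame I e y u) = u := by
  have h1 := (contMDiffAt_extend_symm he hy).mdifferentiableAt (by simp)
  have hx := extend_symm_mem hy
  have h2 := (contMDiffAt_extend_of_mem he hx).mdifferentiableAt (by simp)
  have h3 := h2.hasMFDerivAt.comp _ h1.hasMFDerivAt
  have h4 : (e.extend I) ∘ (e.extend I).symm =ᶠ[𝓝 y] id := by
    filter_upwards [e.isOpen_extend_target.mem_nhds hy] with z hz
    exact (e.extend I).right_inv hz
  have h5 := hasMFDerivAt_unique h3 ((hasMFDerivAt_id (I := 𝓘(ℝ, E)) _).congr_of_eventuallyEq h4)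
  exact congrArg (fun L => L u) h5

theorem tendsto_extend_symm (hy : y ∈ (e.extend I).target) :
    Filter.Tendsto (e.extend I).symm (𝓝 y) (𝓝 ((e.extend I).symm y)) :=
  e.continuousAt_extend_symm' hy

theorem contMDiff_iff_coordFun [IsManifold I ∞ M] {V : M → X} :
    ContMDiff I 𝓘(ℝ, X) ∞ V ↔ ∀ e ∈ IsManifold.maximalAtlas I ∞ M, ∀ y ∈ (e.extend I).target,
      ContDiffAt ℝ ∞ (fun z => V ((e.extend I).symm z)) y := by
  constructor
  · intro h e he y hy
    exact ((h _).comp y (contMDiffAt_extend_symm he hy)).contDiffAt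
  · intro h x
    have he := IsManifold.chart_mem_maximalAtlas (I := I) (n := ∞) x
    have hx := mem_chart_source H x
    have hy : (chartAt H x).extend I x ∈ ((chartAt H x).extend I).target := by
      apply PartialEquiv.map_source; simp
    have h1 : ContMDiffAt 𝓘(ℝ, E) 𝓘(ℝ, X) ∞ _ _ := (h _ he _ hy).contMDiffAt
    refine (h1.comp x (contMDiffAt_extend_of_mem he hx)).congr_of_eventuallyEq ?_
    filter_upwards [(chartAt H x).open_source.mem_nhds hx] with z hz
    exact congrArg V ((chartAt H x).extend_left_inv hz).symm

/-- The expression of `D` in the chart `e`. -/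
abbrev coordMap (I : ModelWithCorners ℝ E H) (D : M → X) (e : OpenPartialHomeomorph M H) : E → X :=
  fun z => D ((e.extend I).symm z)

/-- The differential of a map to a vector space. -/
def devCoframe (I : ModelWithCorners ℝ E H) (D : M → X) (x : M) : TangentSpace I x →L[ℝ] X :=
  mfderiv I 𝓘(ℝ, X) D x

theorem fderiv_coordMap [IsManifold I ∞ M] {D : M → X} (hD : ContMDiff I 𝓘(ℝ, X) ∞ D)
    (he : e ∈ IsManifold.maximalAtlas I ∞ M) (hy : y ∈ (e.extend I).target) (u : E) :
    fderiv ℝ (coordMap I D e) y u =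
      devCoframe I D ((e.extend I).symm y) (coordFrame I e y u) := by
  have h1 := ((contMDiffAt_extend_symm he hy).mdifferentiableAt (by simp)).hasMFDerivAt
  have h2 := ((hD ((e.extend I).symm y)).mdifferentiableAt (by simp)).hasMFDerivAt
  have h3 : HasFDerivAt (coordMap I D e)
      ((devCoframe I D ((e.extend I).symm y)).comp (coordFrame I e y)) y :=
    hasMFDerivAt_iff_hasFDerivAt.1 (h2.comp y h1)
  rw [h3.fderiv]; rfl

end Charts

section Developing

variable {E : Type*} [NormedAddCommGroup E] [NormedSpace ℝ E] [FiniteDimensional ℝ E]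
  {H : Type*} [TopologicalSpace H] {I : ModelWithCorners ℝ E H} [I.Boundaryless]
  {M : Type*} [TopologicalSpace M] [ChartedSpace H M] [IsManifold I ∞ M]
  {X : Type*} [NormedAddCommGroup X] [NormedSpace ℝ X]
  {e : OpenPartialHomeomorph M H} {y : E}

/-- The inverse of `devCoframe`. -/
def devFrame (I : ModelWithCorners ℝ E H) (D : M → E) (x : M) : E →L[ℝ] TangentSpace I x :=
  (devCoframe I D x).inverse

/-- `D` is a local isometry from `(M, g)` to `E` with the scalar product `η`. -/
structure IsDeveloping (g : FormField I M) (η : E →L[ℝ] E →L[ℝ] ℝ) (D : M → E) : Prop where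
  smooth : ContMDiff I 𝓘(ℝ, E) ∞ D
  symm : ∀ u v, η u v = η v u
  nondeg : ∀ u, (∀ v, η u v = 0) → u = 0
  metric : ∀ x u v, g x u v = η (devCoframe I D x u) (devCoframe I D x v)
  inj : ∀ x u, devCoframe I D x u = 0 → u = 0

/-- The components of a tensor field in the parallel frame. -/
def pushForm (D : M → E) (K : FormField I M) (x : M) : E →L[ℝ] E →L[ℝ] ℝ :=
  (ContinuousLinearMap.precomp ℝ (devFrame I D x)).comp ((K x).comp (devFrame I D x))

/-- The components of a product of vector fields in the parallel frame. -/
def pushMul (D : M → E) (m : ProductField I M) (x : M) : E →L[ℝ] E →L[ℝ] E :=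
  (ContinuousLinearMap.postcomp E (devCoframe I D x)).comp
    ((ContinuousLinearMap.precomp (TangentSpace I x) (devFrame I D x)).comp
      ((m x).comp (devFrame I D x)))

/-- The tensor field with given components in the parallel frame. -/
def pullForm (I : ModelWithCorners ℝ E H) (D : M → E) (B : M → E →L[ℝ] E →L[ℝ] ℝ) :
    FormField I M := fun x =>
  (ContinuousLinearMap.precomp ℝ (devCoframe I D x)).comp ((B x).comp (devCoframe I D x))

theorem pullForm_apply (D : M → E) (B : M → E →L[ℝ] E →L[ℝ] ℝ) (x : M) (u v : TangentSpace I x) :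
    pullForm I D B x u v = B x (devCoframe I D x u) (devCoframe I D x v) := rfl

theorem pushForm_apply (D : M → E) (K : FormField I M) (x : M) (a b : E) :
    pushForm D K x a b = K x (devFrame I D x a) (devFrame I D x b) := rfl

theorem pushMul_apply (D : M → E) (m : ProductField I M) (x : M) (a b : E) :
    pushMul D m x a b = devCoframe I D x (m x (devFrame I D x a) (devFrame I D x b)) := rfl

namespace IsDeveloping

variable {g : FormField I M} {η : E →L[ℝ] E →L[ℝ] ℝ} {D : M → E} (h : IsDeveloping g η D)
include h

theorem surj (x : M) (v : E) : ∃ u, devCoframe I D x u = v := by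
  have : FiniteDimensional ℝ (TangentSpace I x) := inferInstanceAs (FiniteDimensional ℝ E)
  have hi : Function.Injective (devCoframe I D x : TangentSpace I x →ₗ[ℝ] E) :=
    (injective_iff_map_eq_zero _).2 (h.inj x)
  have hd : Module.finrank ℝ (TangentSpace I x) = Module.finrank ℝ E := rfl
  exact (LinearMap.injective_iff_surjective_of_finrank_eq_finrank hd).1 hi v

theorem devCoframe_invertible (x : M) : (devCoframe I D x).IsInvertible := by
  have hb : Function.Bijective (devCoframe I D x : TangentSpace I x →ₗ[ℝ] E) :=
    ⟨(injective_iff_map_eq_zero _).2 (h.inj x), h.surj x⟩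
  have : FiniteDimensional ℝ (TangentSpace I x) := inferInstanceAs (FiniteDimensional ℝ E)
  have : T2Space (TangentSpace I x) := inferInstanceAs (T2Space E)
  exact ⟨(LinearEquiv.ofBijective _ hb).toContinuousLinearEquiv, by ext; rfl⟩

theorem devCoframe_devFrame (x : M) (a : E) : devCoframe I D x (devFrame I D x a) = a :=
  (h.devCoframe_invertible x).self_apply_inverse a

theorem devFrame_devCoframe (x : M) (u : TangentSpace I x) :
    devFrame I D x (devCoframe I D x u) = u :=
  (h.devCoframe_invertible x).inverse_apply_self u

theorem fderiv_coordMap_apply (he : e ∈ IsManifold.maximalAtlas I ∞ M)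
    (hy : y ∈ (e.extend I).target) (u : E) :
    fderiv ℝ (coordMap I D e) y u = devCoframe I D _ (coordFrame I e y u) :=
  fderiv_coordMap h.smooth he hy u

theorem contDiffAt_coordMap (he : e ∈ IsManifold.maximalAtlas I ∞ M)
    (hy : y ∈ (e.extend I).target) : ContDiffAt ℝ ∞ (coordMap I D e) y :=
  contMDiff_iff_coordFun.1 h.smooth e he y hy

theorem fderiv_coordMap_inj (he : e ∈ IsManifold.maximalAtlas I ∞ M)
    (hy : y ∈ (e.extend I).target) (u : E) (hu : fderiv ℝ (coordMap I D e) y u = 0) : u = 0 := by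
  rw [h.fderiv_coordMap_apply he hy] at hu
  rw [← coordCoframe_coordFrame he hy u, h.inj _ _ hu, map_zero]

theorem fderiv_coordMap_invertible (he : e ∈ IsManifold.maximalAtlas I ∞ M)
    (hy : y ∈ (e.extend I).target) : (fderiv ℝ (coordMap I D e) y).IsInvertible :=
  IsInvertible.of_injective rfl (h.fderiv_coordMap_inj he hy)

theorem isFlatPullback (he : e ∈ IsManifold.maximalAtlas I ∞ M)
    (hy : y ∈ (e.extend I).target) : IsFlatPullback η (g.coord e) (coordMap I D e) y where
  smooth := h.contDiffAt_coordMap he hy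
  symm := h.symm
  nondeg := h.nondeg
  inj := h.fderiv_coordMap_inj he hy
  metric := by
    filter_upwards [e.isOpen_extend_target.mem_nhds hy] with z hz u v
    rw [FormField.coord_apply, h.metric, h.fderiv_coordMap_apply he hz,
      h.fderiv_coordMap_apply he hz]

theorem coord_eq (K : FormField I M) (he : e ∈ IsManifold.maximalAtlas I ∞ M)
    (hy : y ∈ (e.extend I).target) (u v : E) :
    K.coord e y u v = pushForm D K ((e.extend I).symm y) (fderiv ℝ (coordMap I D e) y u)
      (fderiv ℝ (coordMap I D e) y v) := by
  rw [FormField.coord_apply, pushForm_apply, h.fderiv_coordMap_apply he hy,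
    h.fderiv_coordMap_apply he hy, h.devFrame_devCoframe, h.devFrame_devCoframe]

theorem mulCoord_eq (m : ProductField I M) (he : e ∈ IsManifold.maximalAtlas I ∞ M)
    (hy : y ∈ (e.extend I).target) (u v : E) :
    fderiv ℝ (coordMap I D e) y (m.coord e y u v) =
      pushMul D m ((e.extend I).symm y) (fderiv ℝ (coordMap I D e) y u)
      (fderiv ℝ (coordMap I D e) y v) := by
  rw [ProductField.coord_apply, pushMul_apply, h.fderiv_coordMap_apply he hy,
    h.fderiv_coordMap_apply he hy, h.fderiv_coordMap_apply he hy, h.devFrame_devCoframe,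
    h.devFrame_devCoframe, coordFrame_coordCoframe he hy]

/-- In a chart, a developing map is a local diffeomorphism. -/
theorem exists_local_inverse (he : e ∈ IsManifold.maximalAtlas I ∞ M)
    (hy : y ∈ (e.extend I).target) :
    ∃ P : OpenPartialHomeomorph E E, y ∈ P.source ∧ P.source ⊆ (e.extend I).target ∧
      (∀ z, P z = coordMap I D e z) ∧ ContDiffAt ℝ ∞ P.symm (coordMap I D e y) := by
  obtain ⟨A, hA⟩ := h.fderiv_coordMap_invertible he hy
  have hs := h.contDiffAt_coordMap he hy
  have hd : HasFDerivAt (coordMap I D e) (A : E →L[ℝ] E) y := by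
    rw [hA]; exact (hs.differentiableAt (by simp)).hasFDerivAt
  refine ⟨(hs.toOpenPartialHomeomorph _ hd (by simp)).restrOpen _ e.isOpen_extend_target,
    ⟨hs.mem_toOpenPartialHomeomorph_source hd (by simp), hy⟩, fun z hz => hz.2, fun z => ?_, ?_⟩
  · simp [hs.toOpenPartialHomeomorph_coe hd (by simp)]
  · exact hs.to_localInverse hd (by simp)

theorem isLocalHomeomorph : IsLocalHomeomorph D := by
  refine IsLocalHomeomorph.mk D fun x => ?_
  have he := IsManifold.chart_mem_maximalAtlas (I := I) (n := ∞) x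
  set e := chartAt H x
  have hx : x ∈ e.source := mem_chart_source H x
  have hy : e.extend I x ∈ (e.extend I).target := by
    apply PartialEquiv.map_source; simpa using hx
  obtain ⟨P, hyP, hP, hPD, -⟩ := h.exists_local_inverse he hy
  let c : OpenPartialHomeomorph M E :=
    { toPartialEquiv := e.extend I
      open_source := e.isOpen_extend_source
      open_target := e.isOpen_extend_target
      continuousOn_toFun := e.continuousOn_extend
      continuousOn_invFun := e.continuousOn_extend_symm }
  refine ⟨c.trans P, ?_, fun z hz => ?_⟩
  · rw [OpenPartialHomeomorph.trans_source]
    refine ⟨?_, hyP⟩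
    change x ∈ (e.extend I).source
    simpa using hx
  · rw [OpenPartialHomeomorph.trans_source] at hz
    have hz1 : z ∈ e.source := by
      have : z ∈ (e.extend I).source := hz.1
      simpa using this
    change D z = P (e.extend I z)
    rw [hPD]
    exact congrArg D (e.extend_left_inv hz1).symm

theorem coordMap_hasFDerivAt (he : e ∈ IsManifold.maximalAtlas I ∞ M)
    (hy : y ∈ (e.extend I).target) {F : M → X} {F' : E →L[ℝ] X}
    (hF : HasFlatDerivAt D F F' ((e.extend I).symm y)) :
    HasFDerivAt (coordMap I F e) (F'.comp (fderiv ℝ (coordMap I D e) y)) y := by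
  obtain ⟨G, hG, hF⟩ := hF
  have h1 := HasFDerivAt.comp y (f := coordMap I D e) hG
    ((h.contDiffAt_coordMap he hy).differentiableAt (by simp)).hasFDerivAt
  exact h1.congr_of_eventuallyEq ((tendsto_extend_symm hy).eventually hF)

theorem coordMap_contDiffAt (he : e ∈ IsManifold.maximalAtlas I ∞ M)
    (hy : y ∈ (e.extend I).target) {F : M → X}
    (hF : FlatContDiffAt ∞ D F ((e.extend I).symm y)) :
    ContDiffAt ℝ ∞ (coordMap I F e) y := by
  obtain ⟨G, hG, hF⟩ := hF
  have h1 := ContDiffAt.comp y (f := coordMap I D e) hG (h.contDiffAt_coordMap he hy)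
  exact h1.congr_of_eventuallyEq ((tendsto_extend_symm hy).eventually hF)

theorem flatContDiffAt_of_coordMap (he : e ∈ IsManifold.maximalAtlas I ∞ M)
    (hy : y ∈ (e.extend I).target) {F : M → X} (hF : ContDiffAt ℝ ∞ (coordMap I F e) y) :
    FlatContDiffAt ∞ D F ((e.extend I).symm y) := by
  obtain ⟨P, hyP, hP, hPD, hPs⟩ := h.exists_local_inverse he hy
  have hPy : P.symm (coordMap I D e y) = y := by rw [← hPD, P.left_inv hyP]
  refine ⟨coordMap I F e ∘ P.symm, ContDiffAt.comp (coordMap I D e y) (by rwa [hPy]) hPs, ?_⟩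
  have hx := extend_symm_mem hy
  have h1 : ∀ᶠ x in 𝓝 ((e.extend I).symm y), e.extend I x ∈ P.source := by
    refine (e.continuousAt_extend (I := I) hx).eventually (P.open_source.mem_nhds ?_)
    rwa [(e.extend I).right_inv hy]
  filter_upwards [h1, e.open_source.mem_nhds hx] with z hz hz1
  have h2 : D z = P (e.extend I z) := by
    rw [hPD]; exact congrArg D (e.extend_left_inv hz1).symm
  simp only [Function.comp_apply, h2, P.left_inv hz]
  exact congrArg F (e.extend_left_inv hz1).symm

theorem contMDiff_iff {F : M → X} : ContMDiff I 𝓘(ℝ, X) ∞ F ↔ ∀ x, FlatContDiffAt ∞ D F x := by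
  rw [contMDiff_iff_coordFun]
  constructor
  · intro hF x
    have he := IsManifold.chart_mem_maximalAtlas (I := I) (n := ∞) x
    have hx := mem_chart_source H x
    have hy : (chartAt H x).extend I x ∈ ((chartAt H x).extend I).target := by
      apply PartialEquiv.map_source; simp
    have := h.flatContDiffAt_of_coordMap he hy (hF _ he _ hy)
    rwa [(chartAt H x).extend_left_inv hx] at this
  · intro hF e he y hy
    exact h.coordMap_contDiffAt he hy (hF _)

theorem contDiffAt_fderiv_coordMap (he : e ∈ IsManifold.maximalAtlas I ∞ M)
    (hy : y ∈ (e.extend I).target) : ContDiffAt ℝ ∞ (fderiv ℝ (coordMap I D e)) y :=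
  (h.contDiffAt_coordMap he hy).fderiv_right (by simp)

theorem contDiffAt_inverse_fderiv (he : e ∈ IsManifold.maximalAtlas I ∞ M)
    (hy : y ∈ (e.extend I).target) :
    ContDiffAt ℝ ∞ (fun z => (fderiv ℝ (coordMap I D e) z).inverse) y :=
  (h.fderiv_coordMap_invertible he hy).contDiffAt_map_inverse.comp y
    (h.contDiffAt_fderiv_coordMap he hy)

/-- Chart components and parallel components differ by the Jacobian of `D` in the chart, which is
smooth with smooth inverse. -/
theorem form_smooth_iff {K : FormField I M} :
    (∀ e ∈ IsManifold.maximalAtlas I ∞ M, ContDiffOn ℝ ∞ (K.coord e) (e.extend I).target) ↔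
      ∀ x, FlatContDiffAt ∞ D (pushForm D K) x := by
  rw [← h.contMDiff_iff, contMDiff_iff_coordFun]
  refine forall₂_congr fun e he => ?_
  have ho : IsOpen (e.extend I).target := e.isOpen_extend_target
  constructor
  · intro hK y hy
    have hi := h.contDiffAt_inverse_fderiv he hy
    refine contDiffAt_clm₂ fun a b => ?_
    have h1 : ContDiffAt ℝ ∞ (fun z => K.coord e z ((fderiv ℝ (coordMap I D e) z).inverse a)
        ((fderiv ℝ (coordMap I D e) z).inverse b)) y :=
      ((hK.contDiffAt (ho.mem_nhds hy)).clm_apply (hi.clm_apply contDiffAt_const)).clm_apply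
        (hi.clm_apply contDiffAt_const)
    refine h1.congr_of_eventuallyEq ?_
    filter_upwards [ho.mem_nhds hy] with z hz
    have hinv := h.fderiv_coordMap_invertible he hz
    rw [h.coord_eq K he hz, hinv.self_apply_inverse, hinv.self_apply_inverse]
  · intro hK y hy
    refine ContDiffAt.contDiffWithinAt (contDiffAt_clm₂ fun u v => ?_)
    have hf := h.contDiffAt_fderiv_coordMap he hy
    refine (((hK y hy).clm_apply (hf.clm_apply (contDiffAt_const (c := u)))).clm_apply
      (hf.clm_apply (contDiffAt_const (c := v)))).congr_of_eventuallyEq ?_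
    filter_upwards [ho.mem_nhds hy] with z hz
    exact h.coord_eq K he hz u v

theorem mul_smooth_iff {m : ProductField I M} :
    (∀ e ∈ IsManifold.maximalAtlas I ∞ M, ContDiffOn ℝ ∞ (m.coord e) (e.extend I).target) ↔
      ∀ x, FlatContDiffAt ∞ D (pushMul D m) x := by
  rw [← h.contMDiff_iff, contMDiff_iff_coordFun]
  refine forall₂_congr fun e he => ?_
  have ho : IsOpen (e.extend I).target := e.isOpen_extend_target
  constructor
  · intro hm y hy
    have hi := h.contDiffAt_inverse_fderiv he hy
    have hf := h.contDiffAt_fderiv_coordMap he hy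
    refine contDiffAt_clm₂ fun a b => ?_
    have h1 : ContDiffAt ℝ ∞ (fun z => fderiv ℝ (coordMap I D e) z
        (m.coord e z ((fderiv ℝ (coordMap I D e) z).inverse a)
        ((fderiv ℝ (coordMap I D e) z).inverse b))) y :=
      hf.clm_apply (((hm.contDiffAt (ho.mem_nhds hy)).clm_apply
        (hi.clm_apply contDiffAt_const)).clm_apply (hi.clm_apply contDiffAt_const))
    refine h1.congr_of_eventuallyEq ?_
    filter_upwards [ho.mem_nhds hy] with z hz
    have hinv := h.fderiv_coordMap_invertible he hz
    rw [h.mulCoord_eq m he hz, hinv.self_apply_inverse, hinv.self_apply_inverse]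
  · intro hm y hy
    refine ContDiffAt.contDiffWithinAt (contDiffAt_clm₂ fun u v => ?_)
    have hf := h.contDiffAt_fderiv_coordMap he hy
    have hi := h.contDiffAt_inverse_fderiv he hy
    refine (hi.clm_apply (((hm y hy).clm_apply (hf.clm_apply (contDiffAt_const (c := u)))).clm_apply
      (hf.clm_apply (contDiffAt_const (c := v))))).congr_of_eventuallyEq ?_
    filter_upwards [ho.mem_nhds hy] with z hz
    have hinv := h.fderiv_coordMap_invertible he hz
    change _ = (fderiv ℝ (coordMap I D e) z).inverse (pushMul D m _ _ _)
    rw [← h.mulCoord_eq m he hz, hinv.inverse_apply_self]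

end IsDeveloping

end Developing

/-! ### Hesse-Frobenius structures in parallel frames -/

section FlatStructures

variable {E : Type*} [NormedAddCommGroup E] [NormedSpace ℝ E]
  {M : Type*} [TopologicalSpace M] {D : M → E}
  {X : Type*} [NormedAddCommGroup X] [NormedSpace ℝ X]
  {Y : Type*} [NormedAddCommGroup Y] [NormedSpace ℝ Y]
  {Z : Type*} [NormedAddCommGroup Z] [NormedSpace ℝ Z]

theorem HasFlatDerivAt.eval {B : M → X →L[ℝ] Y} {B' : E →L[ℝ] X →L[ℝ] Y} {x : M}
    (h : HasFlatDerivAt D B B' x) (a : X) : HasFlatDerivAt D (fun x => B x a) (B'.flip a) x :=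
  (h.clm_apply (hasFlatDerivAt_const a)).congr_deriv (by simp)

theorem HasFlatDerivAt.eval₂ {B : M → X →L[ℝ] Y →L[ℝ] Z} {B' : E →L[ℝ] X →L[ℝ] Y →L[ℝ] Z} {x : M}
    (h : HasFlatDerivAt D B B' x) (a : X) (b : Y) :
    HasFlatDerivAt D (fun x => B x a b) ((B'.flip a).flip b) x :=
  (h.eval a).eval b

/-- A smooth function has a smooth derivative. -/
theorem exists_smooth_flatDeriv (hD : IsLocalHomeomorph D) {V : M → X}
    (hV : ∀ x, FlatContDiffAt ∞ D V x) :
    ∃ V' : M → E →L[ℝ] X, (∀ x, HasFlatDerivAt D V (V' x) x) ∧ ∀ x, FlatContDiffAt ∞ D V' x := by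
  choose V' hV' using fun x => (hV x).exists_deriv (by simp)
  refine ⟨V', hV', fun x => ?_⟩
  obtain ⟨G, hG, hVG⟩ := hV x
  refine ⟨fderiv ℝ G, hG.fderiv_right (by simp), ?_⟩
  have h1 : ∀ᶠ y in 𝓝 x, ContDiffAt ℝ 1 G (D y) :=
    hD.continuous.continuousAt.eventually
      ((hG.of_le (WithTop.coe_le_coe.2 (le_top (a := (1 : ℕ∞))))).eventually (by simp))
  filter_upwards [h1, hVG.eventually_nhds] with y hy hy2
  exact (hV' y).unique hD ⟨G, (hy.differentiableAt (by simp)).hasFDerivAt, hy2⟩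

/-- A Hesse-Frobenius structure, in a parallel frame. -/
structure IsFlatHF (D : M → E) (η : E →L[ℝ] E →L[ℝ] ℝ) (A : M → E →L[ℝ] E →L[ℝ] E) : Prop where
  symm : ∀ u v, η u v = η v u
  nondeg : ∀ u, (∀ v, η u v = 0) → u = 0
  smooth : ∀ x, FlatContDiffAt ∞ D A x
  comm : ∀ x a b, A x a b = A x b a
  assoc : ∀ x a b c, A x (A x a b) c = A x a (A x b c)
  frob : ∀ x a b c, η (A x a b) c = η a (A x b c)
  deriv : ∀ x a b, HasFlatDerivAt D (fun x => A x a b) (A x (A x a b)) x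

/-- A solution `V` of the Wilczynski equation with gradient `f` and trace coefficient `φ`, in a
parallel frame. -/
structure IsFlatPotential (D : M → E) (η : E →L[ℝ] E →L[ℝ] ℝ) (A : M → E →L[ℝ] E →L[ℝ] E)
    (V : M → ℝ) (f : M → E) (φ : M → ℝ) : Prop where
  smooth : ∀ x, FlatContDiffAt ∞ D V x
  smooth_grad : ∀ x, FlatContDiffAt ∞ D f x
  deriv : ∀ x, HasFlatDerivAt D V (η (f x)) x
  deriv_grad : ∀ x, HasFlatDerivAt D f ((3 : ℝ) • A x (f x) + φ x • ContinuousLinearMap.id ℝ E) x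

end FlatStructures

/-! ### Dictionary between chart expressions and components in the parallel frame -/

section Translation

variable {E : Type*} [NormedAddCommGroup E] [NormedSpace ℝ E] [FiniteDimensional ℝ E]
  {H : Type*} [TopologicalSpace H] {I : ModelWithCorners ℝ E H} [I.Boundaryless]
  {M : Type*} [TopologicalSpace M] [ChartedSpace H M] [IsManifold I ∞ M]
  {e : OpenPartialHomeomorph M H} {y : E}
  {g : FormField I M} {η : E →L[ℝ] E →L[ℝ] ℝ} {D : M → E} {m : ProductField I M}

theorem mem_extend_target_of_chartAt (x : M) :
    (chartAt H x).extend I x ∈ ((chartAt H x).extend I).target := by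
  have hx := mem_chart_source H x
  apply PartialEquiv.map_source; simp

theorem exists_chart (I : ModelWithCorners ℝ E H) [I.Boundaryless] [IsManifold I ∞ M] (x : M) :
    ∃ e ∈ IsManifold.maximalAtlas I ∞ M,
    ∃ y ∈ (e.extend I).target, (e.extend I).symm y = x :=
  ⟨chartAt H x, IsManifold.chart_mem_maximalAtlas x, _, mem_extend_target_of_chartAt x,
    (chartAt H x).extend_left_inv (mem_chart_source H x)⟩

namespace IsDeveloping

variable (h : IsDeveloping g η D)
include h

theorem pushMul_dev (x : M) (u v : TangentSpace I x) :
    pushMul D m x (devCoframe I D x u) (devCoframe I D x v) = devCoframe I D x (m x u v) := by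
  rw [pushMul_apply, h.devFrame_devCoframe, h.devFrame_devCoframe]

theorem pushForm_dev (K : FormField I M) (x : M) (u v : TangentSpace I x) :
    pushForm D K x (devCoframe I D x u) (devCoframe I D x v) = K x u v := by
  rw [pushForm_apply, h.devFrame_devCoframe, h.devFrame_devCoframe]

theorem pushForm_pullForm (B : M → E →L[ℝ] E →L[ℝ] ℝ) (x : M) :
    pushForm D (pullForm I D B) x = B x := by
  ext a b
  rw [pushForm_apply, pullForm_apply, h.devCoframe_devFrame, h.devCoframe_devFrame]

theorem pullForm_pushForm (K : FormField I M) : pullForm I D (pushForm D K) = K := by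
  funext x
  ext u v
  rw [pullForm_apply, h.pushForm_dev]

theorem covDerivMul_coord (hA : ∀ x, FlatContDiffAt ∞ D (pushMul D m) x)
    (he : e ∈ IsManifold.maximalAtlas I ∞ M) (hy : y ∈ (e.extend I).target)
    {A' : E →L[ℝ] E →L[ℝ] E →L[ℝ] E}
    (hA' : HasFlatDerivAt D (pushMul D m) A' ((e.extend I).symm y)) (w u v : E) :
    fderiv ℝ (coordMap I D e) y (covDerivMul (g.coord e) (m.coord e) y w u v) =
      A' (fderiv ℝ (coordMap I D e) y w) (fderiv ℝ (coordMap I D e) y u)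
        (fderiv ℝ (coordMap I D e) y v) := by
  have hs := h.mul_smooth_iff.2 hA e he
  have ho : IsOpen (e.extend I).target := e.isOpen_extend_target
  rw [(h.isFlatPullback he hy).covDerivMul_eq (B := coordMap I (pushMul D m) e)
    ((h.coordMap_contDiffAt he hy (hA _)).of_le (WithTop.coe_le_coe.2 (le_top (a := (1 : ℕ∞)))))
    ((hs.contDiffAt (ho.mem_nhds hy)).differentiableAt (by simp))
    (by filter_upwards [ho.mem_nhds hy] with z hz u v using h.mulCoord_eq m he hz u v),
    (h.coordMap_hasFDerivAt he hy hA').fderiv]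
  rfl

theorem covDerivForm_coord {K : FormField I M} (hK : ∀ x, FlatContDiffAt ∞ D (pushForm D K) x)
    (he : e ∈ IsManifold.maximalAtlas I ∞ M) (hy : y ∈ (e.extend I).target)
    {K' : E →L[ℝ] E →L[ℝ] E →L[ℝ] ℝ}
    (hK' : HasFlatDerivAt D (pushForm D K) K' ((e.extend I).symm y)) (w u v : E) :
    covDerivForm (g.coord e) (K.coord e) y w u v =
      K' (fderiv ℝ (coordMap I D e) y w) (fderiv ℝ (coordMap I D e) y u)
        (fderiv ℝ (coordMap I D e) y v) := by
  have ho : IsOpen (e.extend I).target := e.isOpen_extend_target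
  rw [(h.isFlatPullback he hy).covDerivForm_eq (B := coordMap I (pushForm D K) e)
    ((h.coordMap_contDiffAt he hy (hK _)).of_le (WithTop.coe_le_coe.2 (le_top (a := (1 : ℕ∞)))))
    (by filter_upwards [ho.mem_nhds hy] with z hz u v using h.coord_eq K he hz u v),
    (h.coordMap_hasFDerivAt he hy hK').fderiv]
  rfl

theorem isFlatHF (hm : IsHesseFrobenius g m) : IsFlatHF D η (pushMul D m) where
  symm := h.symm
  nondeg := h.nondeg
  smooth := h.mul_smooth_iff.1 hm.smooth
  comm x a b := by rw [pushMul_apply, hm.comm, pushMul_apply]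
  assoc x a b c := by
    obtain ⟨a, rfl⟩ := h.surj x a
    obtain ⟨b, rfl⟩ := h.surj x b
    obtain ⟨c, rfl⟩ := h.surj x c
    simp only [h.pushMul_dev, hm.assoc]
  frob x a b c := by
    obtain ⟨a, rfl⟩ := h.surj x a
    obtain ⟨b, rfl⟩ := h.surj x b
    obtain ⟨c, rfl⟩ := h.surj x c
    simp only [h.pushMul_dev, ← h.metric, hm.frobenius]
  deriv x a b := by
    have hs := h.mul_smooth_iff.1 hm.smooth
    obtain ⟨A', hA'⟩ := (hs x).exists_deriv (by simp)
    refine (hA'.eval₂ a b).congr_deriv fun w => ?_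
    obtain ⟨e, he, y, hy, rfl⟩ := exists_chart I x
    have hP := h.isFlatPullback he hy
    obtain ⟨a, rfl⟩ := hP.surj a
    obtain ⟨b, rfl⟩ := hP.surj b
    obtain ⟨w, rfl⟩ := hP.surj w
    simp only [ContinuousLinearMap.flip_apply]
    rw [← h.covDerivMul_coord hs he hy hA', hm.covDeriv_mul e he y hy, h.mulCoord_eq m he hy,
      h.mulCoord_eq m he hy]

theorem isHesseFrobenius (hg : g.IsFlatMetric) (hA : IsFlatHF D η (pushMul D m)) :
    IsHesseFrobenius g m where
  flatMetric := hg
  smooth := h.mul_smooth_iff.2 hA.smooth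
  comm x u v := by
    have := hA.comm x (devCoframe I D x u) (devCoframe I D x v)
    rw [h.pushMul_dev, h.pushMul_dev, ← sub_eq_zero, ← map_sub] at this
    exact sub_eq_zero.1 (h.inj _ _ this)
  assoc x u v w := by
    have := hA.assoc x (devCoframe I D x u) (devCoframe I D x v) (devCoframe I D x w)
    simp only [h.pushMul_dev] at this
    rw [← sub_eq_zero, ← map_sub] at this
    exact sub_eq_zero.1 (h.inj _ _ this)
  frobenius x u v w := by
    rw [h.metric, h.metric, ← h.pushMul_dev, ← h.pushMul_dev, hA.frob]
  covDeriv_mul e he y hy w u v := by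
    have hP := h.isFlatPullback he hy
    obtain ⟨A', hA'⟩ := (hA.smooth ((e.extend I).symm y)).exists_deriv (by simp)
    rw [← sub_eq_zero]
    apply hP.inj
    rw [map_sub, sub_eq_zero, h.covDerivMul_coord hA.smooth he hy hA', h.mulCoord_eq m he hy,
      h.mulCoord_eq m he hy]
    have := (hA'.eval₂ (fderiv ℝ (coordMap I D e) y u) (fderiv ℝ (coordMap I D e) y v)).unique
      h.isLocalHomeomorph (hA.deriv _ _ _)
    exact DFunLike.congr_fun this (fderiv ℝ (coordMap I D e) y w)

section

variable (hA : IsFlatHF D η (pushMul D m))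
include hA

theorem hessian_coord {V : M → ℝ} {f : M → E} (hf : ∀ x, FlatContDiffAt ∞ D f x)
    (hV : ∀ x, HasFlatDerivAt D V (η (f x)) x)
    (he : e ∈ IsManifold.maximalAtlas I ∞ M) (hy : y ∈ (e.extend I).target)
    {f' : E →L[ℝ] E} (hf' : HasFlatDerivAt D f f' ((e.extend I).symm y)) (u v : E) :
    hessian (g.coord e) (coordFun I V e) y u v =
      η (f' (fderiv ℝ (coordMap I D e) y u)) (fderiv ℝ (coordMap I D e) y v) := by
  have ho : IsOpen (e.extend I).target := e.isOpen_extend_target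
  rw [(h.isFlatPullback he hy).hessian_eq (V := coordFun I V e) (f := coordMap I f e)
    ((h.coordMap_contDiffAt he hy (hf _)).differentiableAt (by simp)) ?_,
    (h.coordMap_hasFDerivAt he hy hf').fderiv]
  · rfl
  · filter_upwards [ho.mem_nhds hy] with z hz u
    exact DFunLike.congr_fun (h.coordMap_hasFDerivAt he hz (hV _)).fderiv u

theorem fderiv_coord {V : M → ℝ} {f : M → E} (hV : ∀ x, HasFlatDerivAt D V (η (f x)) x)
    (he : e ∈ IsManifold.maximalAtlas I ∞ M) (hy : y ∈ (e.extend I).target) (u : E) :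
    fderiv ℝ (coordFun I V e) y u =
      η (f ((e.extend I).symm y)) (fderiv ℝ (coordMap I D e) y u) :=
  DFunLike.congr_fun (h.coordMap_hasFDerivAt he hy (hV _)).fderiv u

theorem frob_right (x : M) (f a b : E) :
    η f (pushMul D m x a b) = η (pushMul D m x f a) b := (hA.frob x f a b).symm

theorem coord_symm (he : e ∈ IsManifold.maximalAtlas I ∞ M) (hy : y ∈ (e.extend I).target)
    (u v : E) : g.coord e y u v = g.coord e y v u := by
  rw [(h.isFlatPullback he hy).metric_at, (h.isFlatPullback he hy).metric_at, h.symm]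

theorem hessian_potential {V : M → ℝ} {f : M → E} {φ : M → ℝ}
    (hV : IsFlatPotential D η (pushMul D m) V f φ) (he : e ∈ IsManifold.maximalAtlas I ∞ M)
    (hy : y ∈ (e.extend I).target) (u v : E) :
    hessian (g.coord e) (coordFun I V e) y u v =
      3 * fderiv ℝ (coordFun I V e) y (m.coord e y u v)
        + φ ((e.extend I).symm y) * g.coord e y u v := by
  rw [h.hessian_coord hA hV.smooth_grad hV.deriv he hy (hV.deriv_grad _),
    h.fderiv_coord hA hV.deriv he hy, h.mulCoord_eq m he hy, h.frob_right hA,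
    (h.isFlatPullback he hy).metric_at]
  simp

/-- The Frobenius property turns dV(u ⋆ v) into η(f ⋆ u, v), so the equation for the Hessian
η(df(u), v) becomes df = 3 f⋆ + φ id. The coefficient φ is at first only a pointwise unknown,
without any regularity. -/
theorem isWilczynskiPotential_iff [Nontrivial E] {V : M → ℝ} :
    IsWilczynskiPotential g m V ↔ ∃ f φ, IsFlatPotential D η (pushMul D m) V f φ := by
  constructor
  · rintro ⟨hV, hW⟩
    have hVs := h.contMDiff_iff.1 hV
    have hη := isInvertible_of_nondegenerate h.nondeg
    obtain ⟨V', hV', hV's⟩ := exists_smooth_flatDeriv h.isLocalHomeomorph hVs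
    let f : M → E := fun x => η.inverse (V' x)
    have hf : ∀ x, FlatContDiffAt ∞ D f x := fun x =>
      (hV's x).comp (ContinuousLinearMap.contDiff _).contDiffAt
    have hVf : ∀ x, HasFlatDerivAt D V (η (f x)) x := fun x => by
      simpa only [f, hη.self_apply_inverse] using hV' x
    have key : ∀ x, ∃ φ : ℝ, HasFlatDerivAt D f
        ((3 : ℝ) • pushMul D m x (f x) + φ • ContinuousLinearMap.id ℝ E) x := by
      intro x
      obtain ⟨f', hf'⟩ := (hf x).exists_deriv (by simp)
      obtain ⟨e, he, y, hy, rfl⟩ := exists_chart I x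
      have hP := h.isFlatPullback he hy
      obtain ⟨φ, hφ⟩ := (wilczynskiAt_iff (h.coord_symm hA he hy) hP.g_invertible).1 (hW e he y hy)
      refine ⟨φ, hf'.congr_deriv fun u => ?_⟩
      rw [← sub_eq_zero]
      refine h.nondeg _ fun v => ?_
      obtain ⟨u, rfl⟩ := hP.surj u
      obtain ⟨v, rfl⟩ := hP.surj v
      have := hφ u v
      rw [h.hessian_coord hA hf hVf he hy hf', h.fderiv_coord hA hVf he hy, h.mulCoord_eq m he hy,
        h.frob_right hA, hP.metric_at] at this
      simp [this]
    choose φ hφ using key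
    exact ⟨f, φ, hVs, hf, hVf, hφ⟩
  · rintro ⟨f, φ, hV⟩
    refine ⟨h.contMDiff_iff.2 hV.smooth, fun e he y hy => ?_⟩
    exact (wilczynskiAt_iff (h.coord_symm hA he hy) (h.isFlatPullback he hy).g_invertible).2
      ⟨_, h.hessian_potential hA hV he hy⟩

theorem traceCoefficientOn_eq [Nontrivial E] {V : M → ℝ} {f : M → E} {φ : M → ℝ}
    (hV : IsFlatPotential D η (pushMul D m) V f φ) (x : M) :
    traceCoefficientOn g m V x = φ x := by
  have he := IsManifold.chart_mem_maximalAtlas (I := I) (n := ∞) x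
  have hy := mem_extend_target_of_chartAt (I := I) x
  have := traceCoefficient_eq (h.coord_symm hA he hy) (h.isFlatPullback he hy).g_invertible
    (h.hessian_potential hA hV he hy)
  rw [(chartAt H x).extend_left_inv (mem_chart_source H x)] at this
  exact this

/-- The trace part of T̂ contributes a multiple of K. Since K is symmetric, this part disappears
from the compatibility condition, and the scalar r need not be known. -/
theorem bertrandDarboux_coord {V : M → ℝ} {f : M → E} {φ : M → ℝ}
    (hV : IsFlatPotential D η (pushMul D m) V f φ) {K : FormField I M}
    (hK : ∀ x, FlatContDiffAt ∞ D (pushForm D K) x)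
    (he : e ∈ IsManifold.maximalAtlas I ∞ M) (hy : y ∈ (e.extend I).target)
    {K' : E →L[ℝ] E →L[ℝ] E →L[ℝ] ℝ}
    (hK' : HasFlatDerivAt D (pushForm D K) K' ((e.extend I).symm y)) :
    ∃ r : ℝ, ∀ u v : E, bertrandDarbouxForm (g.coord e) (m.coord e) (K.coord e)
      (coordFun I V e) y u v =
      K' (fderiv ℝ (coordMap I D e) y v) (fderiv ℝ (coordMap I D e) y u) (f ((e.extend I).symm y))
      + 3 * pushForm D K ((e.extend I).symm y) (fderiv ℝ (coordMap I D e) y u)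
        (pushMul D m ((e.extend I).symm y) (f ((e.extend I).symm y))
          (fderiv ℝ (coordMap I D e) y v))
      - r * K.coord e y u v := by
  have hP := h.isFlatPullback he hy
  refine ⟨3 * (1 / (Module.finrank ℝ E : ℝ)) * fderiv ℝ (coordFun I V e) y
    (metricTrace (g.coord e y) (m.coord e y)), fun u v => ?_⟩
  have hk : ∀ z, η (fderiv ℝ (coordMap I D e) y ((g.coord e y).inverse (K.coord e y u)))
      (fderiv ℝ (coordMap I D e) y z) = K.coord e y u z := fun z => by
    rw [← hP.metric_at, hP.g_invertible.self_apply_inverse]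
  rw [bertrandDarbouxForm, h.covDerivForm_coord hK he hy hK',
    hP.gradient_eq (h.fderiv_coord hA hV.deriv he hy), structureTensor, map_smul, map_sub, map_smul,
    map_smul, h.fderiv_coord hA hV.deriv he hy (m.coord e y _ v), h.mulCoord_eq m he hy,
    hA.comm, h.frob_right hA, h.symm (pushMul D m _ _ _)]
  obtain ⟨z, hz⟩ := hP.surj (pushMul D m ((e.extend I).symm y) (f ((e.extend I).symm y))
          (fderiv ℝ (coordMap I D e) y v))
  rw [← hz, hk, h.coord_eq K he hy u z, hP.metric_at, hk]
  simp only [smul_eq_mul]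
  ring

/-- Compatible Killing tensors, in a parallel frame. -/
theorem isCompatibleKilling_iff [Nontrivial E] {K : FormField I M} :
    IsCompatibleKilling g m K ↔ (∀ x, FlatContDiffAt ∞ D (pushForm D K) x) ∧
      (∀ x a b, pushForm D K x a b = pushForm D K x b a) ∧
      ∀ x (K' : E →L[ℝ] E →L[ℝ] E →L[ℝ] ℝ), HasFlatDerivAt D (pushForm D K) K' x →
        (∀ a b c, K' a b c + K' b c a + K' c a b = 0) ∧
        ∀ V f φ, IsFlatPotential D η (pushMul D m) V f φ → ∀ a b,
          K' b a (f x) + 3 * pushForm D K x a (pushMul D m x (f x) b) =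
            K' a b (f x) + 3 * pushForm D K x b (pushMul D m x (f x) a) := by
  constructor
  · intro hK
    have hs := h.form_smooth_iff.1 hK.smooth
    have hsym : ∀ x a b, pushForm D K x a b = pushForm D K x b a := fun x a b => by
      rw [pushForm_apply, hK.symm, pushForm_apply]
    refine ⟨hs, hsym, fun x K' hK' => ?_⟩
    obtain ⟨e, he, y, hy, rfl⟩ := exists_chart I x
    have hP := h.isFlatPullback he hy
    constructor
    · intro a b c
      obtain ⟨a, rfl⟩ := hP.surj a
      obtain ⟨b, rfl⟩ := hP.surj b
      obtain ⟨c, rfl⟩ := hP.surj c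
      have := hK.killing e he y hy a b c
      simpa only [h.covDerivForm_coord hs he hy hK'] using this
    · intro V f φ hV a b
      obtain ⟨a, rfl⟩ := hP.surj a
      obtain ⟨b, rfl⟩ := hP.surj b
      obtain ⟨r, hr⟩ := h.bertrandDarboux_coord hA hV hs he hy hK'
      have := hK.bertrandDarboux V ((h.isWilczynskiPotential_iff hA).2 ⟨f, φ, hV⟩) e he y hy a b
      rw [hr, hr, h.coord_eq K he hy a b, h.coord_eq K he hy b a, hsym _ (fderiv ℝ (coordMap I D e) y b)
        (fderiv ℝ (coordMap I D e) y a)] at this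
      linarith
  · rintro ⟨hs, hsym, hK⟩
    refine ⟨⟨fun x u v => ?_, h.form_smooth_iff.2 hs⟩, ?_, ?_⟩
    · rw [← h.pushForm_dev, hsym, h.pushForm_dev]
    · intro e he y hy u v w
      obtain ⟨K', hK'⟩ := (hs ((e.extend I).symm y)).exists_deriv (by simp)
      simp only [h.covDerivForm_coord hs he hy hK']
      exact (hK _ K' hK').1 _ _ _
    · intro V hV e he y hy u v
      obtain ⟨f, φ, hV⟩ := (h.isWilczynskiPotential_iff hA).1 hV
      obtain ⟨K', hK'⟩ := (hs ((e.extend I).symm y)).exists_deriv (by simp)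
      obtain ⟨r, hr⟩ := h.bertrandDarboux_coord hA hV hs he hy hK'
      rw [hr, hr, h.coord_eq K he hy u v, h.coord_eq K he hy v u, (hK _ K' hK').2 V f φ hV,
        hsym _ (fderiv ℝ (coordMap I D e) y u) (fderiv ℝ (coordMap I D e) y v)]

end

end IsDeveloping

end Translation

/-! ### Explicit solutions -/

section Algebra

variable {E : Type*} [NormedAddCommGroup E] [NormedSpace ℝ E]

/-- The operator `v ↦ v - z ⋆ v`. -/
def oneSub (c : E →L[ℝ] E →L[ℝ] E) (z : E) : E →L[ℝ] E := 1 - c z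

/-- The inverse of `oneSub`. -/
def invOneSub (c : E →L[ℝ] E →L[ℝ] E) (z : E) : E →L[ℝ] E := Ring.inverse (oneSub c z)

/-- The vector `z - ½ z ⋆ z`. -/
def subHalfSq (c : E →L[ℝ] E →L[ℝ] E) (z : E) : E := z - (1 / 2 : ℝ) • c z z

/-- The general solution of the Wilczynski equation. -/
def generalPotential (c : E →L[ℝ] E →L[ℝ] E) (η : E →L[ℝ] E →L[ℝ] ℝ) (k : ℝ) (a : E) (φ : ℝ)
    (z : E) : ℝ :=
  k + η a (invOneSub c z (invOneSub c z (subHalfSq c z)))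
    + φ / 2 * η (subHalfSq c z) (invOneSub c z (invOneSub c z (subHalfSq c z)))

/-- The gradient of `generalPotential`. -/
def generalGradient (c : E →L[ℝ] E →L[ℝ] E) (a : E) (φ : ℝ) (z : E) : E :=
  invOneSub c z (invOneSub c z (invOneSub c z a)) + (φ / 2) • (invOneSub c z (subHalfSq c z)
    + invOneSub c z (invOneSub c z (invOneSub c z (subHalfSq c z))))

/-- The general compatible Killing tensor. -/
def generalKilling (c : E →L[ℝ] E →L[ℝ] E) (B : E →L[ℝ] E →L[ℝ] ℝ) (z : E) :
    E →L[ℝ] E →L[ℝ] ℝ :=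
  (ContinuousLinearMap.precomp ℝ (oneSub c z)).comp (B.comp (oneSub c z))
    + (2 : ℝ) • (ContinuousLinearMap.compL ℝ E E ℝ (B (subHalfSq c z))).comp c

/-- The potential part of the integral of the motion given by `generalKilling`. -/
def generalIntegral (c : E →L[ℝ] E →L[ℝ] E) (B : E →L[ℝ] E →L[ℝ] ℝ) (a : E) (φ : ℝ) (z : E) : ℝ :=
  B (subHalfSq c z) (invOneSub c z (invOneSub c z a))
    + φ / 2 * B (subHalfSq c z) (invOneSub c z (invOneSub c z (subHalfSq c z)))

variable {c : E →L[ℝ] E →L[ℝ] E} {z : E}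

theorem oneSub_apply (v : E) : oneSub c z v = v - c z v := rfl

theorem generalKilling_apply (B : E →L[ℝ] E →L[ℝ] ℝ) (u v : E) :
    generalKilling c B z u v = B (oneSub c z u) (oneSub c z v) + 2 * B (subHalfSq c z) (c u v) := by
  simp [generalKilling]

theorem oneSub_zero : oneSub c 0 = 1 := by simp [oneSub]

theorem invOneSub_zero : invOneSub c 0 = 1 := by simp [invOneSub, oneSub_zero]

theorem subHalfSq_zero : subHalfSq c 0 = 0 := by simp [subHalfSq]

theorem generalKilling_zero (B : E →L[ℝ] E →L[ℝ] ℝ) : generalKilling c B 0 = B := by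
  ext u v
  simp [generalKilling_apply, oneSub_zero, subHalfSq_zero]

theorem generalGradient_zero (a : E) (φ : ℝ) : generalGradient c a φ 0 = a := by
  simp [generalGradient, invOneSub_zero, subHalfSq_zero]

theorem generalPotential_zero (η : E →L[ℝ] E →L[ℝ] ℝ) (k : ℝ) (a : E) (φ : ℝ) :
    generalPotential c η k a φ 0 = k := by
  simp [generalPotential, subHalfSq_zero]

section

variable (hu : IsUnit (oneSub c z))
include hu

theorem oneSub_invOneSub (v : E) : oneSub c z (invOneSub c z v) = v := by
  have := Ring.mul_inverse_cancel _ hu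
  exact DFunLike.congr_fun this v

theorem invOneSub_oneSub (v : E) : invOneSub c z (oneSub c z v) = v := by
  have := Ring.inverse_mul_cancel _ hu
  exact DFunLike.congr_fun this v

theorem hasFDerivAt_invOneSub_apply [CompleteSpace E] {u : E → E} {u' : E →L[ℝ] E}
    (h : HasFDerivAt u u' z) :
    HasFDerivAt (fun z => invOneSub c z (u z))
      ((invOneSub c z).comp (c.flip (invOneSub c z (u z)) + u')) z := by
  obtain ⟨r, hr⟩ := hu
  have h1 : HasFDerivAt (oneSub c) (-c) z := by
    exact ((hasFDerivAt_const (1 : E →L[ℝ] E) z).sub (c.hasFDerivAt (x := z))).congr_fderiv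
      (zero_sub c)
  have h2 : HasFDerivAt (Ring.inverse (M₀ := E →L[ℝ] E)) _ (oneSub c z) :=
    hr ▸ hasFDerivAt_ringInverse (𝕜 := ℝ) r
  have h3 := (h2.comp z h1).clm_apply h
  refine h3.congr_fderiv ?_
  ext w
  have h4 : (↑r⁻¹ : E →L[ℝ] E) = invOneSub c z := by
    rw [invOneSub, ← hr, Ring.inverse_unit]
  have h5 : Ring.inverse (oneSub c z) = invOneSub c z := rfl
  simp [h4, h5, add_comm]

theorem contDiffAt_invOneSub [CompleteSpace E] {n : WithTop ℕ∞} :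
    ContDiffAt ℝ n (invOneSub c) z := by
  obtain ⟨r, hr⟩ := hu
  have h1 : ContDiff ℝ n (oneSub c) := contDiff_const.sub c.contDiff
  have h2 : ContDiffAt ℝ n (Ring.inverse (M₀ := E →L[ℝ] E)) (oneSub c z) :=
    hr ▸ contDiffAt_ringInverse ℝ r
  exact h2.comp z h1.contDiffAt

end

theorem contDiff_subHalfSq {n : WithTop ℕ∞} : ContDiff ℝ n (subHalfSq c) :=
  contDiff_id.sub ((c.contDiff.clm_apply contDiff_id).const_smul _)

theorem contDiff_oneSub {n : WithTop ℕ∞} : ContDiff ℝ n (oneSub c) :=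
  contDiff_const.sub c.contDiff

theorem contDiff_generalKilling [FiniteDimensional ℝ E] {n : WithTop ℕ∞}
    (B : E →L[ℝ] E →L[ℝ] ℝ) : ContDiff ℝ n (generalKilling c B) := by
  refine contDiff_iff_contDiffAt.2 fun z => contDiffAt_clm₂ fun u v => ?_
  have : (fun z => generalKilling c B z u v) = fun z =>
      B (oneSub c z u) (oneSub c z v) + 2 * B (subHalfSq c z) (c u v) := by
    funext z; exact generalKilling_apply B u v
  rw [this]
  have h1 : ∀ u, ContDiff ℝ n fun z => oneSub c z u := fun u =>
    contDiff_oneSub.clm_apply contDiff_const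
  exact (((B.contDiff.comp (h1 u)).clm_apply (h1 v)).add
    (contDiff_const.mul ((B.contDiff.comp contDiff_subHalfSq).clm_apply contDiff_const))).contDiffAt

theorem contDiffAt_generalGradient [CompleteSpace E] {n : WithTop ℕ∞}
    (hu : IsUnit (oneSub c z)) (a : E) (φ : ℝ) : ContDiffAt ℝ n (generalGradient c a φ) z := by
  have hP := contDiffAt_invOneSub (n := n) hu
  have hs := (contDiff_subHalfSq (c := c) (n := n)).contDiffAt (x := z)
  unfold generalGradient
  exact (hP.clm_apply (hP.clm_apply (hP.clm_apply contDiffAt_const))).add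
    (((hP.clm_apply hs).add (hP.clm_apply (hP.clm_apply (hP.clm_apply hs)))).const_smul _)

theorem contDiffAt_generalPotential [CompleteSpace E] {n : WithTop ℕ∞}
    (hu : IsUnit (oneSub c z)) (η : E →L[ℝ] E →L[ℝ] ℝ) (k : ℝ) (a : E) (φ : ℝ) :
    ContDiffAt ℝ n (generalPotential c η k a φ) z := by
  have hP := contDiffAt_invOneSub (n := n) hu
  have hs := (contDiff_subHalfSq (c := c) (n := n)).contDiffAt (x := z)
  have hQ := hP.clm_apply (hP.clm_apply hs)
  unfold generalPotential
  exact (contDiffAt_const.add (contDiffAt_const.clm_apply hQ)).add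
    (contDiffAt_const.mul ((η.contDiff.contDiffAt.comp z hs).clm_apply hQ))

theorem contDiffAt_generalIntegral [CompleteSpace E] {n : WithTop ℕ∞}
    (hu : IsUnit (oneSub c z)) (B : E →L[ℝ] E →L[ℝ] ℝ) (a : E) (φ : ℝ) :
    ContDiffAt ℝ n (generalIntegral c B a φ) z := by
  have hP := contDiffAt_invOneSub (n := n) hu
  have hs := (contDiff_subHalfSq (c := c) (n := n)).contDiffAt (x := z)
  have hQ := hP.clm_apply (hP.clm_apply hs)
  have hB := B.contDiff.contDiffAt.comp z hs
  unfold generalIntegral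
  exact (hB.clm_apply (hP.clm_apply (hP.clm_apply contDiffAt_const))).add
    (contDiffAt_const.mul (hB.clm_apply hQ))

variable (hcomm : ∀ a b, c a b = c b a) (hassoc : ∀ a b d, c (c a b) d = c a (c b d))
include hcomm hassoc

theorem mul_left_comm (a b d : E) : c a (c b d) = c b (c a d) := by
  rw [← hassoc, hcomm a b, hassoc]

theorem oneSub_mul (a b : E) : oneSub c z (c a b) = c a (oneSub c z b) := by
  rw [oneSub_apply, oneSub_apply, map_sub, mul_left_comm hcomm hassoc]

theorem invOneSub_mul (hu : IsUnit (oneSub c z)) (a b : E) :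
    invOneSub c z (c a b) = c a (invOneSub c z b) := by
  have h := oneSub_mul (z := z) hcomm hassoc a (invOneSub c z b)
  rw [oneSub_invOneSub hu] at h
  rw [← h, invOneSub_oneSub hu]

/-- By commutativity the two terms of the derivative of z ⋆ z coincide, and the factor ½ leaves ds =
1 - z⋆ = N. -/
theorem hasFDerivAt_subHalfSq : HasFDerivAt (subHalfSq c) (oneSub c z) z := by
  refine ((hasFDerivAt_id z).sub
    (((c.hasFDerivAt (x := z)).clm_apply (hasFDerivAt_id z)).const_smul (1 / 2 : ℝ))).congr_fderiv ?_
  ext w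
  simp [oneSub_apply, hcomm w z]
  module

/-- In an algebra with unit, s = ½(1 - N²). This is that identity multiplied by w, which makes sense
without a unit and is the rule behind the derivatives below. -/
theorem mul_subHalfSq (w : E) :
    c w (subHalfSq c z) = (1 / 2 : ℝ) • (w - oneSub c z (oneSub c z w)) := by
  rw [hcomm]
  simp [subHalfSq, oneSub_apply, hassoc]
  module

/-- Formally P²s = ½(P² - 1) with P = N⁻¹ and dP = P², which suggests the derivative P³. -/
theorem hasFDerivAt_invSq_subHalfSq [CompleteSpace E] (hu : IsUnit (oneSub c z)) :
    HasFDerivAt (fun z => invOneSub c z (invOneSub c z (subHalfSq c z)))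
      ((invOneSub c z).comp ((invOneSub c z).comp (invOneSub c z))) z := by
  refine (hasFDerivAt_invOneSub_apply hu (hasFDerivAt_invOneSub_apply hu
    (hasFDerivAt_subHalfSq hcomm hassoc))).congr_fderiv ?_
  ext w
  simp only [ContinuousLinearMap.comp_apply, add_apply, ContinuousLinearMap.flip_apply,
    ← invOneSub_mul hcomm hassoc hu, mul_subHalfSq hcomm hassoc, invOneSub_oneSub hu, map_sub,
    map_smul, map_add]
  module

/-- Formally P³ has derivative 3P·P³ and so solves the homogeneous equation, while h = Ps + P³s =
½(P³ - N) satisfies dh = 3Ph + 2. The 2 is the reason for the coefficient φ/2. -/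
theorem hasFDerivAt_generalGradient [CompleteSpace E] (hu : IsUnit (oneSub c z)) (a : E) (φ : ℝ) :
    HasFDerivAt (generalGradient c a φ) ((3 : ℝ) • (invOneSub c z).comp (c (generalGradient c a φ z))
      + φ • ContinuousLinearMap.id ℝ E) z := by
  have hs := hasFDerivAt_subHalfSq (z := z) hcomm hassoc
  have h1 := hasFDerivAt_invOneSub_apply hu (hasFDerivAt_invOneSub_apply hu
    (hasFDerivAt_invOneSub_apply hu (hasFDerivAt_const a z)))
  have h2 := hasFDerivAt_invOneSub_apply hu hs
  have h3 := hasFDerivAt_invOneSub_apply hu (hasFDerivAt_invSq_subHalfSq hcomm hassoc hu)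
  refine (h1.add ((h2.add h3).const_smul (φ / 2))).congr_fderiv ?_
  ext w
  simp only [ContinuousLinearMap.comp_apply, add_apply, ContinuousLinearMap.flip_apply,
    smul_apply, ContinuousLinearMap.id_apply, hcomm _ w,
    generalGradient,
    ← invOneSub_mul hcomm hassoc hu, mul_subHalfSq hcomm hassoc, invOneSub_oneSub hu, map_sub,
    map_smul, map_add, add_zero]
  module

theorem hasFDerivAt_generalPotential [CompleteSpace E] (hu : IsUnit (oneSub c z))
    {η : E →L[ℝ] E →L[ℝ] ℝ} (hs : ∀ u v, η u v = η v u) (hf : ∀ a b d, η (c a b) d = η a (c b d))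
    (k : ℝ) (a : E) (φ : ℝ) :
    HasFDerivAt (generalPotential c η k a φ) (η (generalGradient c a φ z)) z := by
  -- By the Frobenius property multiplications are self-adjoint for η, hence so are N and its
  -- inverse.
  have hN : ∀ u v, η (oneSub c z u) v = η u (oneSub c z v) := fun u v => by
    rw [oneSub_apply, oneSub_apply, map_sub, map_sub, sub_apply, hcomm, hf]
  have hP : ∀ u v, η (invOneSub c z u) v = η u (invOneSub c z v) := fun u v => by
    have := hN (invOneSub c z u) (invOneSub c z v)
    rw [oneSub_invOneSub hu, oneSub_invOneSub hu] at this
    exact this.symm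
  have h0 := hasFDerivAt_subHalfSq (z := z) hcomm hassoc
  have hQ := hasFDerivAt_invSq_subHalfSq hcomm hassoc hu
  refine (((hasFDerivAt_const k z).add ((hasFDerivAt_const (η a) z).clm_apply hQ)).add
    (((η.hasFDerivAt.comp z h0).clm_apply hQ).const_mul (φ / 2))).congr_fderiv ?_
  ext w
  simp only [ContinuousLinearMap.comp_apply, add_apply, ContinuousLinearMap.flip_apply,
    smul_apply, zero_apply, generalGradient, map_add, map_smul, smul_eq_mul,
    zero_add, add_zero, hP, Function.comp_apply]
  rw [hs (oneSub c z w), hP, hP, invOneSub_oneSub hu]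
  ring

theorem hasFDerivAt_generalKilling {B : E →L[ℝ] E →L[ℝ] ℝ} (u v : E) :
    HasFDerivAt (fun z => generalKilling c B z u v)
      (-(B.flip (oneSub c z v)).comp (c.flip u) - (B (oneSub c z u)).comp (c.flip v)
        + (2 : ℝ) • (B.flip (c u v)).comp (oneSub c z)) z := by
  have h0 := hasFDerivAt_subHalfSq (z := z) hcomm hassoc
  have hN : ∀ u, HasFDerivAt (fun z => oneSub c z u) (-c.flip u) z := fun u => by
    exact ((hasFDerivAt_const u z).sub (c.flip u).hasFDerivAt).congr_fderiv (zero_sub _)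
  have : (fun z => generalKilling c B z u v) = fun z =>
      B (oneSub c z u) (oneSub c z v) + 2 * B (subHalfSq c z) (c u v) := by
    funext z; exact generalKilling_apply B u v
  rw [this]
  refine (((B.hasFDerivAt.comp z (hN u)).clm_apply (hN v)).add
    (((B.hasFDerivAt.comp z h0).clm_apply (hasFDerivAt_const (c u v) z)).const_mul 2)).congr_fderiv
    ?_
  ext w
  simp
  ring

/-- The derivative is expressed through the tensor at z and the product N⁻¹(u ⋆ v) belonging to z,
so that the system closes up. The terms with s that this introduces occur with coefficients 4, -2,
-2 and the same triple product, and cancel. -/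
theorem hasFDerivAt_generalKilling' (hu : IsUnit (oneSub c z)) {B : E →L[ℝ] E →L[ℝ] ℝ}
    (hB : ∀ u v, B u v = B v u) (u v : E) :
    HasFDerivAt (fun z => generalKilling c B z u v)
      ((2 : ℝ) • (generalKilling c B z).flip (invOneSub c z (c u v))
        - (generalKilling c B z u).comp ((invOneSub c z).comp (c v))
        - (generalKilling c B z v).comp ((invOneSub c z).comp (c u))) z := by
  refine (hasFDerivAt_generalKilling hcomm hassoc u v).congr_fderiv ?_
  ext w
  simp only [ContinuousLinearMap.comp_apply, add_apply, sub_apply, neg_apply,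
    ContinuousLinearMap.flip_apply, smul_apply, generalKilling_apply, oneSub_invOneSub hu,
    smul_eq_mul, hB (c w u), ← invOneSub_mul hcomm hassoc hu]
  rw [mul_left_comm hcomm hassoc w u v, hcomm w v, hcomm w u, mul_left_comm hcomm hassoc v u w]
  ring

/-- For φ = 0 both sides are B(Nw, P²a) + 2 B(s, P³(w ⋆ a)): the first term comes from ds = N, the
second from the derivative of P². The rest is the same computation with
`hasFDerivAt_invSq_subHalfSq`. -/
theorem hasFDerivAt_generalIntegral [CompleteSpace E] (hu : IsUnit (oneSub c z))
    {B : E →L[ℝ] E →L[ℝ] ℝ} (hB : ∀ u v, B u v = B v u) (a : E) (φ : ℝ) :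
    HasFDerivAt (generalIntegral c B a φ)
      ((generalKilling c B z).flip (generalGradient c a φ z)) z := by
  have h0 := hasFDerivAt_subHalfSq (z := z) hcomm hassoc
  have hQ := hasFDerivAt_invSq_subHalfSq hcomm hassoc hu
  have h1 := hasFDerivAt_invOneSub_apply hu (hasFDerivAt_invOneSub_apply hu (hasFDerivAt_const a z))
  have hBs := B.hasFDerivAt.comp z h0
  refine ((hBs.clm_apply h1).add ((hBs.clm_apply hQ).const_mul (φ / 2))).congr_fderiv ?_
  ext w
  simp only [ContinuousLinearMap.comp_apply, add_apply, ContinuousLinearMap.flip_apply,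
    smul_apply, generalGradient, generalKilling_apply, map_add,
    map_smul, smul_eq_mul, add_zero, Function.comp_apply, oneSub_invOneSub hu,
    ← invOneSub_mul hcomm hassoc hu, mul_subHalfSq hcomm hassoc, invOneSub_oneSub hu, map_sub]
  rw [hB (oneSub c z w) (subHalfSq c z)]
  ring

end Algebra

/-! ### Potentials and Killing tensors in a parallel frame -/

section FlatTheory

variable {E : Type*} [NormedAddCommGroup E] [NormedSpace ℝ E]
  {M : Type*} [TopologicalSpace M] {D : M → E}
  {X : Type*} [NormedAddCommGroup X] [NormedSpace ℝ X]
  {η : E →L[ℝ] E →L[ℝ] ℝ} {A : M → E →L[ℝ] E →L[ℝ] E}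

theorem _root_.HasFDerivAt.flat_sub {G : E → X} {G' : E →L[ℝ] X} {x x₀ : M}
    (h : HasFDerivAt G G' (D x - D x₀)) : HasFlatDerivAt D (fun x => G (D x - D x₀)) G' x :=
  HasFDerivAt.flat (G := fun z => G (z - D x₀)) (by
    exact (HasFDerivAt.comp (D x) h ((hasFDerivAt_id (D x)).sub_const (D x₀))).congr_fderiv
      G'.comp_id)

theorem _root_.ContDiffAt.flat_sub {n : WithTop ℕ∞} {G : E → X} {x x₀ : M}
    (h : ContDiffAt ℝ n G (D x - D x₀)) : FlatContDiffAt n D (fun x => G (D x - D x₀)) x :=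
  ContDiffAt.flat (G := fun z => G (z - D x₀))
    (ContDiffAt.comp (D x) h (contDiffAt_id.sub contDiffAt_const))

theorem flatDeriv_symm (hD : IsLocalHomeomorph D) {F : M → X} {F' : M → E →L[ℝ] X}
    {F'' : E →L[ℝ] E →L[ℝ] X} {x : M} (h : ∀ x, HasFlatDerivAt D F (F' x) x)
    (h' : HasFlatDerivAt D F' F'' x) (v w : E) : F'' v w = F'' w v := by
  obtain ⟨G, σ, hσx, hσ, hDσ, -, hG⟩ := exists_local_representative hD F F' h x
  obtain ⟨G', hG', hFG'⟩ := h'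
  rw [ContinuousAt, hσx] at hσ
  have h2 : (fun z => F' (σ z)) =ᶠ[𝓝 (D x)] G' := by
    filter_upwards [hσ.eventually hFG', hDσ] with z hz hz'
    simpa [hz'] using hz
  exact second_derivative_symmetric_of_eventually hG (hG'.congr_of_eventuallyEq h2) v w

variable [FiniteDimensional ℝ E]

theorem isUnit_of_injective {L : E →L[ℝ] E} (h : ∀ u, L u = 0 → u = 0) : IsUnit L := by
  obtain ⟨T, rfl⟩ := IsInvertible.of_injective rfl h
  exact T.toUnit.isUnit

namespace IsFlatHF

section

variable (hA : IsFlatHF D η A)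
include hA

theorem mul_right_comm (x : M) (a b d : E) : A x (A x a b) d = A x (A x a d) b := by
  rw [hA.assoc, hA.comm x b, ← hA.assoc]

theorem exists_deriv (hD : IsLocalHomeomorph D) (x : M) :
    ∃ A' : E →L[ℝ] E →L[ℝ] E →L[ℝ] E, HasFlatDerivAt D A A' x ∧
      ∀ w a b, A' w a b = A x (A x a b) w := by
  obtain ⟨A', hA'⟩ := (hA.smooth x).exists_deriv (by simp)
  exact ⟨A', hA', fun w a b =>
    DFunLike.congr_fun ((hA'.eval₂ a b).unique hD (hA.deriv x a b)) w⟩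

theorem continuous_norm (hD : IsLocalHomeomorph D) : Continuous fun x => ‖A x‖ :=
  (continuous_iff_continuousAt.2 fun x =>
    (hA.smooth x).continuousAt hD.continuous.continuousAt).norm

end

variable [PreconnectedSpace M] (hD : IsLocalHomeomorph D) (hA : IsFlatHF D η A) (x₀ : M)
include hD hA

/-- The difference Φ = A x (N a) - A x₀ a vanishes at x₀. By the structure equation and
associativity its derivative in direction w is b ↦ A x (Φ w) b, which is linear in Φ, so Φ = 0. -/
theorem mul_oneSub (x : M) (a : E) : A x (oneSub (A x₀) (D x - D x₀) a) = A x₀ a := by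
  have hN : ∀ x, HasFlatDerivAt D (fun x => oneSub (A x₀) (D x - D x₀) a) (-(A x₀).flip a) x :=
    fun x => HasFDerivAt.flat_sub (G := fun z => oneSub (A x₀) z a)
      (((hasFDerivAt_const a _).sub ((A x₀).flip a).hasFDerivAt).congr_fderiv (zero_sub _))
  refine sub_eq_zero.1 (eq_zero_of_flatDeriv_le hD
    (F := fun x => A x (oneSub (A x₀) (D x - D x₀) a) - A x₀ a)
    (F' := fun x => (A x).comp (A x (oneSub (A x₀) (D x - D x₀) a) - A x₀ a))
    (C := fun x => ‖A x‖) (fun x => ?_) (hA.continuous_norm hD)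
    (fun x => ContinuousLinearMap.opNorm_comp_le _ _) (x₀ := x₀) ?_ x)
  · obtain ⟨A', hA', hA'e⟩ := hA.exists_deriv hD x
    refine ((hA'.clm_apply (hN x)).sub (hasFlatDerivAt_const _)).congr_deriv fun w => ?_
    ext b
    simp [hA'e, hA.comm x₀ w a, hA.mul_right_comm x _ b w]
    abel
  · simp [oneSub_zero]

/-- If N a = 0 at one point, then N a, whose derivative -(c a) equals -A(N a) by `mul_oneSub`,
vanishes everywhere. At x₀, where N = 1, this says a = 0. No assumption on the shape of the image of
`D` is needed. -/
theorem isUnit_oneSub (x : M) : IsUnit (oneSub (A x₀) (D x - D x₀)) := by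
  refine isUnit_of_injective fun a ha => ?_
  have := eq_zero_of_flatDeriv_le hD (F := fun x => oneSub (A x₀) (D x - D x₀) a)
    (F' := fun x => -(A x (oneSub (A x₀) (D x - D x₀) a))) (C := fun x => ‖A x‖) (fun x => ?_)
    (hA.continuous_norm hD) (fun x => by rw [norm_neg]; exact (A x).le_opNorm _) ha x₀
  · simpa [oneSub_zero] using this
  · refine (HasFDerivAt.flat_sub (G := fun z => oneSub (A x₀) z a)
      (((hasFDerivAt_const a _).sub ((A x₀).flip a).hasFDerivAt).congr_fderiv
        (zero_sub _))).congr_deriv fun w => ?_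
    simp [hA.mul_oneSub hD, hA.comm x₀ w a]

theorem mul_eq (x : M) (a b : E) : A x a b = invOneSub (A x₀) (D x - D x₀) (A x₀ a b) := by
  have hu := hA.isUnit_oneSub hD x₀ x
  conv_lhs => rw [← oneSub_invOneSub hu a]
  rw [hA.mul_oneSub hD, hA.comm x₀, hA.comm x₀ a b, invOneSub_mul (hA.comm x₀) (hA.assoc x₀) hu]

theorem mul_eq' (x : M) (a : E) :
    A x a = (invOneSub (A x₀) (D x - D x₀)).comp (A x₀ a) := by
  ext b; exact hA.mul_eq hD x₀ x a b

theorem isFlatPotential_general (k : ℝ) (a : E) (φ : ℝ) :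
    IsFlatPotential D η A (fun x => generalPotential (A x₀) η k a φ (D x - D x₀))
      (fun x => generalGradient (A x₀) a φ (D x - D x₀)) fun _ => φ where
  smooth x := (contDiffAt_generalPotential (hA.isUnit_oneSub hD x₀ x) η k a φ).flat_sub
  smooth_grad x := (contDiffAt_generalGradient (hA.isUnit_oneSub hD x₀ x) a φ).flat_sub
  deriv x := (hasFDerivAt_generalPotential (hA.comm x₀) (hA.assoc x₀) (hA.isUnit_oneSub hD x₀ x)
    hA.symm (hA.frob x₀) k a φ).flat_sub
  deriv_grad x := by
    have := hasFDerivAt_generalGradient (hA.comm x₀) (hA.assoc x₀) (hA.isUnit_oneSub hD x₀ x) a φ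
    rw [hA.mul_eq' hD x₀ x]
    exact this.flat_sub

/-- For equal φ the difference of the gradients solves a homogeneous linear system and vanishes at
x₀; then V - V₁ has derivative zero. -/
theorem potential_ext {V V₁ : M → ℝ} {f f₁ : M → E} {φ : M → ℝ}
    (h : IsFlatPotential D η A V f φ) (h₁ : IsFlatPotential D η A V₁ f₁ φ)
    (hV : V x₀ = V₁ x₀) (hf : f x₀ = f₁ x₀) : V = V₁ ∧ f = f₁ := by
  have hff : ∀ x, f x = f₁ x := fun x => by
    refine sub_eq_zero.1 (eq_zero_of_flatDeriv_le hD (F := fun x => f x - f₁ x)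
      (F' := fun x => (3 : ℝ) • A x (f x - f₁ x)) (C := fun x => 3 * ‖A x‖) (fun x => ?_)
      ((hA.continuous_norm hD).const_mul _) (fun x => ?_) (x₀ := x₀) (by simp [hf]) x)
    · refine ((h.deriv_grad x).sub (h₁.deriv_grad x)).congr_deriv fun w => ?_
      simp [smul_sub]
    · rw [norm_smul, mul_assoc]
      have := (A x).le_opNorm (f x - f₁ x)
      rw [Real.norm_ofNat]
      linarith
  refine ⟨funext fun x => ?_, funext hff⟩
  have := eq_of_flatDeriv_zero hD (F := fun x => V x - V₁ x) (fun x =>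
    ((h.deriv x).sub (h₁.deriv x)).congr_deriv (F₁' := 0) (by simp [hff])) x x₀
  simpa [hV, sub_eq_zero] using this

-- The coefficient is only given as a function, but φ e = df(e) - 3 f ⋆ e for a fixed e ≠ 0, and a
-- functional with value 1 at e expresses φ through differentiable quantities.
omit [PreconnectedSpace M] x₀ in
theorem exists_deriv_coefficient [Nontrivial E] {V : M → ℝ} {f : M → E} {φ : M → ℝ}
    (h : IsFlatPotential D η A V f φ) (x : M) :
    ∃ φ' : E →L[ℝ] ℝ, HasFlatDerivAt D φ φ' x := by
  obtain ⟨e, he⟩ := exists_ne (0 : E)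
  obtain ⟨ℓ, hℓ⟩ := SeparatingDual.exists_eq_one (R := ℝ) he
  obtain ⟨f', hf', hf's⟩ := exists_smooth_flatDeriv hD h.smooth_grad
  have h1 : φ = fun x => ℓ (f' x e - (3 : ℝ) • A x (f x) e) := by
    funext x
    rw [(hf' x).unique hD (h.deriv_grad x)]
    simp [hℓ]
  obtain ⟨f'', hf''⟩ := (hf's x).exists_deriv (by simp)
  obtain ⟨A', hA', -⟩ := hA.exists_deriv hD x
  rw [h1]
  exact ⟨_, ((hf''.eval e).sub (((hA'.clm_apply (h.deriv_grad x)).eval e).const_smul 3)).clm ℓ⟩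

/-- In the second derivative of f all terms except φ'(v) w are symmetric in v and w, by
commutativity and associativity. Hence φ'(v) w = φ'(w) v, and choosing w outside the line of v gives
φ'(v) = 0. In dimension one the statement fails, as the equation is then vacuous. -/
theorem coefficient_const (hn : 2 ≤ Module.finrank ℝ E) {V : M → ℝ} {f : M → E} {φ : M → ℝ}
    (h : IsFlatPotential D η A V f φ) (x : M) : φ x = φ x₀ := by
  have : Nontrivial E := Module.nontrivial_of_finrank_pos (R := ℝ) (by omega)
  refine eq_of_flatDeriv_zero hD (fun x => ?_) x x₀
  obtain ⟨φ', hφ'⟩ := hA.exists_deriv_coefficient hD h x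
  refine hφ'.congr_deriv fun v => ?_
  obtain ⟨A', hA', hA'e⟩ := hA.exists_deriv hD x
  have hid : HasFlatDerivAt D (fun x => φ x • ContinuousLinearMap.id ℝ E)
      (φ'.smulRight (ContinuousLinearMap.id ℝ E)) x :=
    hφ'.clm ((ContinuousLinearMap.id ℝ ℝ).smulRight (ContinuousLinearMap.id ℝ E))
  have h2 := ((hA'.clm_apply (h.deriv_grad x)).const_smul 3).add hid
  by_cases hv : v = 0
  · simp [hv]
  obtain ⟨w, hw⟩ : ∃ w, w ∉ Submodule.span ℝ {v} := by
    by_contra hcon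
    push Not at hcon
    have : Submodule.span ℝ {v} = ⊤ := by ext; simp [hcon]
    have h3 := finrank_span_singleton (K := ℝ) hv
    rw [this, finrank_top] at h3
    omega
  have h3 := flatDeriv_symm hD h.deriv_grad h2 v w
  simp [hA'e, hA.comm x v w] at h3
  rw [hA.mul_right_comm x (f x) v w] at h3
  have h4 : φ' v • w = φ' w • v := by
    have := sub_eq_zero.2 h3
    rw [← sub_eq_zero, ← this]
    abel_nf
  by_contra h5
  refine hw (Submodule.mem_span_singleton.2 ⟨(φ' v)⁻¹ * φ' w, ?_⟩)
  rw [mul_smul, ← h4, smul_smul, inv_mul_cancel₀ h5, one_smul]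

theorem potential_eq (hn : 2 ≤ Module.finrank ℝ E) {V : M → ℝ} {f : M → E} {φ : M → ℝ}
    (h : IsFlatPotential D η A V f φ) :
    (∀ x, V x = generalPotential (A x₀) η (V x₀) (f x₀) (φ x₀) (D x - D x₀)) ∧
    (∀ x, f x = generalGradient (A x₀) (f x₀) (φ x₀) (D x - D x₀)) := by
  have hφ : φ = fun _ => φ x₀ := funext (hA.coefficient_const hD x₀ hn h)
  have h0 := hA.isFlatPotential_general hD x₀ (V x₀) (f x₀) (φ x₀)
  rw [hφ] at h
  obtain ⟨h1, h2⟩ := hA.potential_ext hD x₀ h h0 (by simp [generalPotential_zero])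
    (by simp [generalGradient_zero])
  exact ⟨fun x => by rw [h1]; simp [generalPotential_zero],
    fun x => by rw [h2]; simp [generalGradient_zero]⟩

end IsFlatHF

/-- A compatible Killing tensor in a parallel frame, as the solution of a closed differential
system. -/
structure IsFlatKilling (D : M → E) (A : M → E →L[ℝ] E →L[ℝ] E) (B : M → E →L[ℝ] E →L[ℝ] ℝ) :
    Prop where
  smooth : ∀ x, FlatContDiffAt ∞ D B x
  symm : ∀ x a b, B x a b = B x b a
  deriv : ∀ x a b, HasFlatDerivAt D (fun x => B x a b)
    ((2 : ℝ) • (B x).flip (A x a b) - (B x a).comp (A x b) - (B x b).comp (A x a)) x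

namespace IsFlatHF

variable [PreconnectedSpace M] (hD : IsLocalHomeomorph D) (hA : IsFlatHF D η A) (x₀ : M)
include hD hA

-- With v = f(x) arbitrary, the compatibility condition controls the antisymmetric part of the
-- derivative of B, and the Killing equation controls its cyclic sum. Together they determine the
-- whole derivative. Conversely, the resulting formula satisfies both conditions identically,
-- whatever f is.
omit x₀ in
theorem isFlatKilling_iff {B : M → E →L[ℝ] E →L[ℝ] ℝ} :
    IsFlatKilling D A B ↔ (∀ x, FlatContDiffAt ∞ D B x) ∧ (∀ x a b, B x a b = B x b a) ∧
      ∀ x (K' : E →L[ℝ] E →L[ℝ] E →L[ℝ] ℝ), HasFlatDerivAt D B K' x →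
        (∀ a b c, K' a b c + K' b c a + K' c a b = 0) ∧
        ∀ V f φ, IsFlatPotential D η A V f φ → ∀ a b,
          K' b a (f x) + 3 * B x a (A x (f x) b) = K' a b (f x) + 3 * B x b (A x (f x) a) := by
  constructor
  · intro h
    refine ⟨h.smooth, h.symm, fun x K' hK' => ?_⟩
    have he : ∀ w a b, K' w a b = 2 * B x w (A x a b) - B x a (A x b w) - B x b (A x a w) :=
      fun w a b => by
        have := DFunLike.congr_fun ((hK'.eval₂ a b).unique hD (h.deriv x a b)) w
        simpa using this
    refine ⟨fun a b c => ?_, fun V f φ _ a b => ?_⟩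
    · rw [he, he, he, hA.comm x b a, hA.comm x c a, hA.comm x c b]
      ring
    · rw [he, he, hA.comm x (f x) b, hA.comm x (f x) a, hA.comm x b a]
      ring
  · rintro ⟨hs, hsym, h⟩
    refine ⟨hs, hsym, fun x a b => ?_⟩
    obtain ⟨K', hK'⟩ := (hs x).exists_deriv (by simp)
    obtain ⟨h1, h2⟩ := h x K' hK'
    refine (hK'.eval₂ a b).congr_deriv fun w => ?_
    have hK's : ∀ w a b, K' w a b = K' w b a := fun w a b =>
      DFunLike.congr_fun ((hK'.eval₂ a b).unique hD ((hK'.eval₂ b a).congr fun x => hsym x a b)) w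
    -- The general potential based at x, with φ = 0, has gradient v there; hence every v can be
    -- tested.
    have h3 : ∀ v a b, K' b a v + 3 * B x a (A x v b) = K' a b v + 3 * B x b (A x v a) := by
      intro v a b
      have := h2 _ _ _ (hA.isFlatPotential_general hD x 0 v 0) a b
      simpa [generalGradient_zero] using this
    have e1 := h3 b a w
    have e2 := h3 a b w
    have e3 := h1 w a b
    rw [hK's a w b] at e1
    rw [hK's w b a] at e2
    rw [hA.comm x b a] at e1
    simp
    linarith

theorem isFlatKilling_general {B : E →L[ℝ] E →L[ℝ] ℝ} (hB : ∀ a b, B a b = B b a) :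
    IsFlatKilling D A (fun x => generalKilling (A x₀) B (D x - D x₀)) where
  smooth x := (contDiff_generalKilling B).contDiffAt.flat_sub
  symm x a b := by rw [generalKilling_apply, generalKilling_apply, hB, hA.comm]
  deriv x a b := by
    have := hasFDerivAt_generalKilling' (hA.comm x₀) (hA.assoc x₀) (hA.isUnit_oneSub hD x₀ x) hB a b
    rw [hA.mul_eq hD x₀ x, hA.mul_eq' hD x₀ x, hA.mul_eq' hD x₀ x]
    exact HasFDerivAt.flat_sub (G := fun z => generalKilling (A x₀) B z a b) this

/-- The closed system is linear and homogeneous in B. Its right-hand side has coefficients 2, -1,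
-1, whence the bound 4‖A‖ for the Grönwall argument. -/
theorem killing_ext {B B₁ : M → E →L[ℝ] E →L[ℝ] ℝ} (h : IsFlatKilling D A B)
    (h₁ : IsFlatKilling D A B₁) (h0 : B x₀ = B₁ x₀) (x : M) : B x = B₁ x := by
  choose K' hK' using fun x => (h.smooth x).exists_deriv (by simp)
  choose K₁' hK₁' using fun x => (h₁.smooth x).exists_deriv (by simp)
  refine sub_eq_zero.1 (eq_zero_of_flatDeriv_le hD (F := fun x => B x - B₁ x)
    (F' := fun x => K' x - K₁' x) (C := fun x => 4 * ‖A x‖) (fun x => (hK' x).sub (hK₁' x))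
    ((hA.continuous_norm hD).const_mul _) (fun x => ?_) (x₀ := x₀) (by simp [h0]) x)
  set Δ := B x - B₁ x with hΔ
  have he : ∀ w a b, (K' x - K₁' x) w a b =
      2 * Δ w (A x a b) - Δ a (A x b w) - Δ b (A x a w) := fun w a b => by
    have e1 := DFunLike.congr_fun (((hK' x).eval₂ a b).unique hD (h.deriv x a b)) w
    have e2 := DFunLike.congr_fun (((hK₁' x).eval₂ a b).unique hD (h₁.deriv x a b)) w
    simp at e1 e2
    simp [e1, e2, hΔ]
    ring
  have hb : ∀ a b c, ‖Δ a (A x b c)‖ ≤ ‖A x‖ * ‖Δ‖ * ‖a‖ * ‖b‖ * ‖c‖ := fun a b c => by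
    calc ‖Δ a (A x b c)‖ ≤ ‖Δ‖ * ‖a‖ * ‖A x b c‖ := Δ.le_opNorm₂ _ _
      _ ≤ ‖Δ‖ * ‖a‖ * (‖A x‖ * ‖b‖ * ‖c‖) := by gcongr; exact (A x).le_opNorm₂ _ _
      _ = _ := by ring
  refine ContinuousLinearMap.opNorm_le_bound _ (by positivity) fun w => ?_
  refine ContinuousLinearMap.opNorm_le_bound₂ _ (by positivity) fun a b => ?_
  rw [he]
  have b1 := hb w a b
  have b2 := hb a b w
  have b3 := hb b a w
  rw [Real.norm_eq_abs] at *
  have := abs_le.1 b1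
  have := abs_le.1 b2
  have := abs_le.1 b3
  rw [abs_le]
  constructor <;> nlinarith

theorem killing_eq {B : M → E →L[ℝ] E →L[ℝ] ℝ} (h : IsFlatKilling D A B) (x : M) :
    B x = generalKilling (A x₀) (B x₀) (D x - D x₀) :=
  hA.killing_ext hD x₀ h (hA.isFlatKilling_general hD x₀ (h.symm x₀))
    (by simp [generalKilling_zero]) x

/-- The potential parts of the integrals of the motion. -/
theorem exists_integral (hn : 2 ≤ Module.finrank ℝ E) {V : M → ℝ} {f : M → E} {φ : M → ℝ}
    (hV : IsFlatPotential D η A V f φ) {B : M → E →L[ℝ] E →L[ℝ] ℝ} (hB : IsFlatKilling D A B) :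
    ∃ F : M → ℝ, (∀ x, FlatContDiffAt ∞ D F x) ∧ ∀ x, HasFlatDerivAt D F (B x (f x)) x := by
  obtain hM | ⟨⟨x₀⟩⟩ := isEmpty_or_nonempty M
  · exact ⟨fun _ => 0, fun x => hM.elim x, fun x => hM.elim x⟩
  refine ⟨fun x => generalIntegral (A x₀) (B x₀) (f x₀) (φ x₀) (D x - D x₀), fun x =>
    (contDiffAt_generalIntegral (hA.isUnit_oneSub hD x₀ x) _ _ _).flat_sub, fun x => ?_⟩
  have := hasFDerivAt_generalIntegral (hA.comm x₀) (hA.assoc x₀) (hA.isUnit_oneSub hD x₀ x)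
    (hB.symm x₀) (f x₀) (φ x₀)
  refine this.flat_sub.congr_deriv fun w => ?_
  rw [← (hA.potential_eq hD x₀ hn hV).2 x, ← hA.killing_eq hD x₀ hB, ContinuousLinearMap.flip_apply,
    hB.symm]

end IsFlatHF

end FlatTheory

/-! ### Quadratic functions on the cotangent bundle -/

section Phase

variable {E : Type*} [NormedAddCommGroup E] [NormedSpace ℝ E] [FiniteDimensional ℝ E]
  {H : Type*} [TopologicalSpace H] {I : ModelWithCorners ℝ E H} [I.Boundaryless]
  {M : Type*} [TopologicalSpace M] [ChartedSpace H M] [IsManifold I ∞ M]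
  {e : OpenPartialHomeomorph M H} {y : E}
  {g : FormField I M} {η : E →L[ℝ] E →L[ℝ] ℝ} {D : M → E} {m : ProductField I M}

/-- The components of a covector in the parallel frame, with the index raised by `η`. -/
def flatMomentum (η : E →L[ℝ] E →L[ℝ] ℝ) (ψ : E → E) (z : E × (E →L[ℝ] ℝ)) : E :=
  η.inverse (z.2.comp (fderiv ℝ ψ z.1).inverse)

/-- The differential at `(x, P)` of the function `B(P, P) + F` on the cotangent bundle, in parallel
coordinates, where `B'` and `F'` are the derivatives of `B` and `F` at `x`. -/
def phaseDifferential (B : E →L[ℝ] E →L[ℝ] ℝ) (B' : E →L[ℝ] E →L[ℝ] E →L[ℝ] ℝ) (F' : E →L[ℝ] ℝ)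
    (P : E) : E × E →L[ℝ] ℝ :=
  ((B'.flip P).flip P + F').comp (ContinuousLinearMap.fst ℝ E E)
    + ((2 : ℝ) • B P).comp (ContinuousLinearMap.snd ℝ E E)

theorem phaseDifferential_apply (B : E →L[ℝ] E →L[ℝ] ℝ) (B' : E →L[ℝ] E →L[ℝ] E →L[ℝ] ℝ)
    (F' : E →L[ℝ] ℝ) (P u δ : E) :
    phaseDifferential B B' F' P (u, δ) = B' u P P + F' u + 2 * B P δ := by
  simp [phaseDifferential]

namespace IsDeveloping

variable (h : IsDeveloping g η D)
include h

theorem pushForm_self (x : M) : pushForm D g x = η := by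
  ext a b
  rw [pushForm_apply, h.metric, h.devCoframe_devFrame, h.devCoframe_devFrame]

theorem eta_invertible : η.IsInvertible := isInvertible_of_nondegenerate h.nondeg

theorem eta_flatMomentum (he : e ∈ IsManifold.maximalAtlas I ∞ M) (hy : y ∈ (e.extend I).target)
    (p : E →L[ℝ] ℝ) (u : E) :
    η (flatMomentum η (coordMap I D e) (y, p)) (fderiv ℝ (coordMap I D e) y u) = p u := by
  rw [flatMomentum, h.eta_invertible.self_apply_inverse, ContinuousLinearMap.comp_apply,
    (h.fderiv_coordMap_invertible he hy).inverse_apply_self]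

theorem g_invertible (x : M) : (g x).IsInvertible := by
  have : FiniteDimensional ℝ (TangentSpace I x) := inferInstanceAs (FiniteDimensional ℝ E)
  have key : ∀ u : TangentSpace I x, (∀ v, g x u v = 0) → u = 0 := fun u hu =>
    h.inj x u (h.nondeg _ fun v => by
      obtain ⟨v, rfl⟩ := h.surj x v
      rw [← h.metric, hu])
  exact isInvertible_of_nondegenerate (E := E) (η := g x) key

theorem coord_quadraticFunction (K : FormField I M) (F : M → ℝ)
    (he : e ∈ IsManifold.maximalAtlas I ∞ M) (hy : y ∈ (e.extend I).target) (p : E →L[ℝ] ℝ) :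
    (quadraticFunction g K F).coord e (y, p) =
      coordMap I (pushForm D K) e y (flatMomentum η (coordMap I D e) (y, p))
        (flatMomentum η (coordMap I D e) (y, p)) + coordMap I F e y := by
  set x := (e.extend I).symm y with hx
  have key : devCoframe I D x ((g x).inverse (p.comp (coordCoframe I e y))) =
      flatMomentum η (coordMap I D e) (y, p) := by
    rw [← sub_eq_zero]
    refine h.nondeg _ fun v => ?_
    obtain ⟨v, rfl⟩ := (h.isFlatPullback he hy).surj v
    rw [map_sub, sub_apply, h.eta_flatMomentum he hy, h.fderiv_coordMap_apply he hy, ← h.metric,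
      (h.g_invertible x).self_apply_inverse, ContinuousLinearMap.comp_apply,
      coordCoframe_coordFrame he hy, sub_self]
  change K x _ _ + F x = pushForm D K x _ _ + F x
  rw [← key, h.pushForm_dev]

theorem contDiffAt_flatMomentum (he : e ∈ IsManifold.maximalAtlas I ∞ M)
    (hy : y ∈ (e.extend I).target) (p : E →L[ℝ] ℝ) :
    ContDiffAt ℝ ∞ (flatMomentum η (coordMap I D e)) (y, p) := by
  have h1 : ContDiffAt ℝ ∞ (fun z : E × (E →L[ℝ] ℝ) => (fderiv ℝ (coordMap I D e) z.1).inverse)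
      (y, p) := (h.contDiffAt_inverse_fderiv he hy).comp (y, p) contDiffAt_fst
  exact (ContinuousLinearMap.contDiff _).contDiffAt.comp _ (contDiffAt_snd.clm_comp h1)

/-- Obtained by differentiating η(P, dψ u) = p(u) in position and momentum. The ψ'' term appears
because fixed chart momenta are not fixed parallel momenta. -/
theorem eta_fderiv_flatMomentum (he : e ∈ IsManifold.maximalAtlas I ∞ M)
    (hy : y ∈ (e.extend I).target) (p π : E →L[ℝ] ℝ) (w u : E) :
    η (fderiv ℝ (flatMomentum η (coordMap I D e)) (y, p) (w, π)) (fderiv ℝ (coordMap I D e) y u) =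
      π u - η (flatMomentum η (coordMap I D e) (y, p))
        (fderiv ℝ (fderiv ℝ (coordMap I D e)) y w u) := by
  have h1 := ((h.contDiffAt_flatMomentum he hy p).differentiableAt (by simp)).hasFDerivAt
  have h2 := HasFDerivAt.comp (y, p) (f := fun z : E × (E →L[ℝ] ℝ) => z.1)
    (hasFDerivAt_fderiv_apply (h.isFlatPullback he hy).smooth_two u) hasFDerivAt_fst
  have h3 := (η.hasFDerivAt.comp (y, p) h1).clm_apply h2
  have h4 : HasFDerivAt (fun z : E × (E →L[ℝ] ℝ) => z.2 u)
      ((ContinuousLinearMap.apply ℝ ℝ u).comp (ContinuousLinearMap.snd ℝ E (E →L[ℝ] ℝ))) (y, p) :=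
    ((ContinuousLinearMap.apply ℝ ℝ u).comp
      (ContinuousLinearMap.snd ℝ E (E →L[ℝ] ℝ))).hasFDerivAt
  have h5 : (fun z : E × (E →L[ℝ] ℝ) => z.2 u) =ᶠ[𝓝 (y, p)] fun z =>
      (η ∘ flatMomentum η (coordMap I D e)) z
        (((fun z => fderiv ℝ (coordMap I D e) z u) ∘ fun z => z.1) z) := by
    have ho : IsOpen (e.extend I).target := e.isOpen_extend_target
    filter_upwards [continuous_fst.continuousAt.preimage_mem_nhds (ho.mem_nhds hy)] with z hz
    exact (h.eta_flatMomentum he hz z.2 u).symm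
  have h6 := DFunLike.congr_fun (h4.unique (h3.congr_of_eventuallyEq h5)) (w, π)
  simp at h6
  linarith

/-- The differential of a quadratic function on the cotangent bundle. -/
theorem fderiv_quadraticFunction {K : FormField I M} {F : M → ℝ}
    (hKs : ∀ x a b, pushForm D K x a b = pushForm D K x b a)
    (he : e ∈ IsManifold.maximalAtlas I ∞ M) (hy : y ∈ (e.extend I).target) (p : E →L[ℝ] ℝ)
    {K' : E →L[ℝ] E →L[ℝ] E →L[ℝ] ℝ} {F' : E →L[ℝ] ℝ}
    (hK' : HasFlatDerivAt D (pushForm D K) K' ((e.extend I).symm y))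
    (hF' : HasFlatDerivAt D F F' ((e.extend I).symm y)) (w : E) (π : E →L[ℝ] ℝ) :
    fderiv ℝ ((quadraticFunction g K F).coord e) (y, p) (w, π) =
      phaseDifferential (pushForm D K ((e.extend I).symm y)) K' F'
        (flatMomentum η (coordMap I D e) (y, p)) (fderiv ℝ (coordMap I D e) y w,
          fderiv ℝ (flatMomentum η (coordMap I D e)) (y, p) (w, π)) := by
  have h1 := ((h.contDiffAt_flatMomentum he hy p).differentiableAt (by simp)).hasFDerivAt
  have h2 := HasFDerivAt.comp (y, p) (f := fun z : E × (E →L[ℝ] ℝ) => z.1)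
    (h.coordMap_hasFDerivAt he hy hK') hasFDerivAt_fst
  have h3 := HasFDerivAt.comp (y, p) (f := fun z : E × (E →L[ℝ] ℝ) => z.1)
    (h.coordMap_hasFDerivAt he hy hF') hasFDerivAt_fst
  have h5 : (quadraticFunction g K F).coord e =ᶠ[𝓝 (y, p)] fun z =>
      (coordMap I (pushForm D K) e ∘ fun z => z.1) z (flatMomentum η (coordMap I D e) z)
        (flatMomentum η (coordMap I D e) z) + (coordMap I F e ∘ fun z => z.1) z := by
    have ho : IsOpen (e.extend I).target := e.isOpen_extend_target
    filter_upwards [continuous_fst.continuousAt.preimage_mem_nhds (ho.mem_nhds hy)] with z hz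
    exact h.coord_quadraticFunction K F he hz z.2
  rw [h5.fderiv_eq, HasFDerivAt.fderiv (f := fun z =>
      (coordMap I (pushForm D K) e ∘ fun z => z.1) z (flatMomentum η (coordMap I D e) z)
        (flatMomentum η (coordMap I D e) z) + (coordMap I F e ∘ fun z => z.1) z)
      ((hasFDerivAt_bilin h2 h1 h1).add h3), phaseDifferential_apply]
  simp [-PartialEquiv.coe_trans_symm]
  rw [hKs _ (fderiv ℝ (flatMomentum η (coordMap I D e)) (y, p) (w, π))]
  change _ = _ + 2 * pushForm D K ((e.extend I).symm y) _ _
  ring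

/-- When the fibre derivatives are evaluations at vectors a and b, the sum over the basis
reassembles into two directional derivatives. -/
theorem poissonBracket_eq {z : E × (E →L[ℝ] ℝ)} {F G : E × (E →L[ℝ] ℝ) → ℝ} {a b : E}
    (hF : ∀ π, fderiv ℝ F z (0, π) = π a) (hG : ∀ π, fderiv ℝ G z (0, π) = π b) :
    poissonBracket F G z = fderiv ℝ F z (b, 0) - fderiv ℝ G z (a, 0) := by
  have key : ∀ (L : E × (E →L[ℝ] ℝ) →L[ℝ] ℝ) (b : E),
      ∑ j, L (Module.finBasis ℝ E j, 0) * (Module.finBasis ℝ E).coord j b = L (b, 0) := by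
    intro L b
    have h1 : ∀ v : E, L (v, 0) = (L.comp (ContinuousLinearMap.inl ℝ E (E →L[ℝ] ℝ))) v :=
      fun v => rfl
    conv_rhs => rw [h1, ← (Module.finBasis ℝ E).sum_repr b, map_sum]
    refine Finset.sum_congr rfl fun j _ => ?_
    rw [map_smul, h1, smul_eq_mul, mul_comm]; rfl
  rw [poissonBracket, Finset.sum_sub_distrib, ← key, ← key]
  simp only [hF, hG]
  rfl

/-- A Killing tensor `K` and a function `F` with `dF = K(dV)` give an integral of the motion. -/
theorem isIntegralOf {K : FormField I M} {F V : M → ℝ} {f : M → E}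
    (hKs : ∀ x a b, pushForm D K x a b = pushForm D K x b a)
    {K' : M → E →L[ℝ] E →L[ℝ] E →L[ℝ] ℝ} (hK' : ∀ x, HasFlatDerivAt D (pushForm D K) (K' x) x)
    (hK0 : ∀ x a, K' x a a a = 0) (hV : ∀ x, HasFlatDerivAt D V (η (f x)) x)
    (hF : ∀ x, HasFlatDerivAt D F (pushForm D K x (f x)) x) :
    IsIntegralOf (quadraticFunction g K F) (quadraticFunction g g V) := by
  intro e he y hy p
  have hP := h.isFlatPullback he hy
  set x := (e.extend I).symm y with hx
  set P := flatMomentum η (coordMap I D e) (y, p) with hPdef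
  set ψ := coordMap I D e with hψ
  have hg' : HasFlatDerivAt D (pushForm D g) 0 x :=
    (hasFlatDerivAt_const η).congr fun x => h.pushForm_self x
  have hgs : ∀ x a b, pushForm D g x a b = pushForm D g x b a := fun x a b => by
    rw [h.pushForm_self, h.symm]
  have dK := h.fderiv_quadraticFunction hKs he hy p (hK' x) (hF x)
  have dH := h.fderiv_quadraticFunction hgs he hy p hg' (hV x)
  simp only [phaseDifferential_apply, ← hψ, ← hPdef, ← hx] at dK dH
  simp only [h.pushForm_self] at dH
  -- The vector a is K(P, ·) with its index raised. The fibre derivatives of the integral and of H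
  -- are evaluation at 2α and 2β, where α and β represent a and P in the chart.
  obtain ⟨a, ha⟩ := h.eta_invertible.surjective (pushForm D K x P)
  obtain ⟨α, hα⟩ := hP.surj a
  obtain ⟨β, hβ⟩ := hP.surj P
  have dm := h.eta_fderiv_flatMomentum he hy p
  simp only [← hψ, ← hPdef] at dm
  have e1 : ∀ w π, η (fderiv ℝ (flatMomentum η ψ) (y, p) (w, π)) a =
      π α - η P (fderiv ℝ (fderiv ℝ ψ) y w α) := fun w π => by rw [← hα, dm]
  have e2 : ∀ w π, η (fderiv ℝ (flatMomentum η ψ) (y, p) (w, π)) P =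
      π β - η P (fderiv ℝ (fderiv ℝ ψ) y w β) := fun w π => by
    conv_lhs => rw [← hβ]
    rw [dm]
  rw [h.poissonBracket_eq (a := (2 : ℝ) • α) (b := (2 : ℝ) • β)]
  -- The ψ'' terms cancel by symmetry, the cubic term K'(P, P, P) vanishes, and the two remaining
  -- terms are both K(f, P).
  · have s1 : ∀ v : E, ((2 : ℝ) • v, (0 : E →L[ℝ] ℝ)) = (2 : ℝ) • (v, 0) := fun v => by simp
    rw [s1, s1, map_smul, map_smul, dK, dH, ← ha, h.symm a, h.symm P (fderiv _ _ _ _), e1, e2, hα,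
      hβ, hK0, fderiv_fderiv_symm hP.smooth_two α β, hKs, ← ha, h.symm a]
    simp
  · intro π
    rw [dK, ← ha, h.symm a, e1]
    simp
  · intro π
    rw [dH, h.symm P, e2]
    simp

/-- Functional independence in terms of the differentials in parallel coordinates. -/
theorem functionallyIndependent {ι : Type*} {K : ι → FormField I M} {F : ι → M → ℝ}
    (hKs : ∀ i x a b, pushForm D (K i) x a b = pushForm D (K i) x b a)
    {K' : ι → M → E →L[ℝ] E →L[ℝ] E →L[ℝ] ℝ}
    (hK' : ∀ i x, HasFlatDerivAt D (pushForm D (K i)) (K' i x) x)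
    {F' : ι → M → E →L[ℝ] ℝ} (hF' : ∀ i x, HasFlatDerivAt D (F i) (F' i x) x)
    (hind : ∀ q : M × E, ∃ᶠ q' in 𝓝 q, LinearIndependent ℝ fun i =>
      phaseDifferential (pushForm D (K i) q'.1) (K' i q'.1) (F' i q'.1) q'.2) :
    FunctionallyIndependent fun i => quadraticFunction g (K i) (F i) := by
  intro e he z hz
  obtain ⟨y, p⟩ := z
  have hy : y ∈ (e.extend I).target := hz.1
  set ψ := coordMap I D e with hψ
  rw [mem_closure_iff_frequently]
  -- The passage from parallel momenta to the canonical coordinates of the chart. Its continuity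
  -- transports frequent independence to the given point.
  let Θ : M × E → E × (E →L[ℝ] ℝ) := fun q =>
    (e.extend I q.1, (η q.2).comp (fderiv ℝ ψ (e.extend I q.1)))
  have hx := extend_symm_mem hy
  set x := (e.extend I).symm y with hxdef
  have hxy : e.extend I x = y := (e.extend I).right_inv hy
  have hΘ : Filter.Tendsto Θ (𝓝 (x, flatMomentum η ψ (y, p))) (𝓝 (y, p)) := by
    have c1 : ContinuousAt (fun q : M × E => e.extend I q.1) (x, flatMomentum η ψ (y, p)) :=
      ContinuousAt.comp (f := fun q : M × E => q.1) (e.continuousAt_extend hx) continuousAt_fst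
    have c2 : ContinuousAt (fun q : M × E => fderiv ℝ ψ (e.extend I q.1))
        (x, flatMomentum η ψ (y, p)) := by
      refine ContinuousAt.comp (f := fun q : M × E => e.extend I q.1) ?_ c1
      simp only [hxy]
      exact (h.contDiffAt_fderiv_coordMap he hy).continuousAt
    have c3 : ContinuousAt Θ (x, flatMomentum η ψ (y, p)) :=
      c1.prodMk ((η.continuous.continuousAt.comp continuousAt_snd).clm_comp c2)
    have c4 : Θ (x, flatMomentum η ψ (y, p)) = (y, p) := by
      simp only [Θ, hxy]
      congr 1
      ext u
      exact h.eta_flatMomentum he hy p u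
    rw [ContinuousAt, c4] at c3
    exact c3
  refine hΘ.frequently (((hind (x, flatMomentum η ψ (y, p))).and_eventually
    (continuousAt_fst.preimage_mem_nhds (e.open_source.mem_nhds hx))).mono fun q hq => ?_)
  obtain ⟨hq, hqs⟩ := hq
  have hqt : e.extend I q.1 ∈ (e.extend I).target := by
    apply PartialEquiv.map_source; rw [e.extend_source]; exact hqs
  have hqx : (e.extend I).symm (e.extend I q.1) = q.1 := e.extend_left_inv hqs
  refine ⟨⟨hqt, mem_univ _⟩, ?_⟩
  have hP := h.isFlatPullback he hqt
  have hmom : flatMomentum η ψ (Θ q) = q.2 := by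
    rw [← sub_eq_zero]
    refine h.nondeg _ fun v => ?_
    obtain ⟨v, rfl⟩ := hP.surj v
    rw [map_sub, sub_apply, h.eta_flatMomentum he hqt, sub_eq_zero]
    rfl
  -- The differential of the change from chart phase coordinates to parallel ones. It is onto, so
  -- composing with it preserves linear independence of functionals.
  let L : E × (E →L[ℝ] ℝ) →L[ℝ] E × E :=
    ((fderiv ℝ ψ (Θ q).1).comp (ContinuousLinearMap.fst ℝ E (E →L[ℝ] ℝ))).prod
      (fderiv ℝ (flatMomentum η ψ) (Θ q))
  have hL : Function.Surjective L := by
    rintro ⟨u, δ⟩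
    obtain ⟨w, rfl⟩ := hP.surj u
    -- The momentum variation obtained by solving `eta_fderiv_flatMomentum` for π, with prescribed
    -- variation δ of P.
    refine ⟨(w, (η δ).comp (fderiv ℝ ψ (Θ q).1)
      + (η q.2).comp (fderiv ℝ (fderiv ℝ ψ) (Θ q).1 w)), Prod.ext rfl ?_⟩
    rw [← sub_eq_zero]
    refine h.nondeg _ fun v => ?_
    obtain ⟨v, rfl⟩ := hP.surj v
    rw [map_sub, sub_apply, sub_eq_zero]
    have := h.eta_fderiv_flatMomentum he hqt (Θ q).2 ((η δ).comp (fderiv ℝ ψ (Θ q).1)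
      + (η q.2).comp (fderiv ℝ (fderiv ℝ ψ) (Θ q).1 w)) w v
    refine this.trans ?_
    have hmom' : flatMomentum η (coordMap I D e) (e.extend I q.1, (Θ q).2) = q.2 := hmom
    rw [hmom']
    simp [Θ, ψ]
  have hmap := hq.map' ((ContinuousLinearMap.compL ℝ (E × (E →L[ℝ] ℝ)) (E × E) ℝ).flip L :
    (E × E →L[ℝ] ℝ) →ₗ[ℝ] (E × (E →L[ℝ] ℝ) →L[ℝ] ℝ)) (by
      rw [LinearMap.ker_eq_bot']
      intro θ hθ
      refine ContinuousLinearMap.ext fun v => ?_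
      obtain ⟨v, rfl⟩ := hL v
      exact DFunLike.congr_fun hθ v)
  have heq : (fun i => fderiv ℝ ((quadraticFunction g (K i) (F i)).coord e) (Θ q)) = fun i =>
      (phaseDifferential (pushForm D (K i) q.1) (K' i q.1) (F' i q.1) q.2).comp L := by
    funext i
    refine ContinuousLinearMap.ext fun v => ?_
    obtain ⟨w, π⟩ := v
    have := h.fderiv_quadraticFunction (hKs i) he hqt (Θ q).2
      (K' := K' i q.1) (F' := F' i q.1) (by rw [hqx]; exact hK' i _) (by rw [hqx]; exact hF' i _) w π
    rw [hqx] at this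
    refine this.trans ?_
    have hmom' : flatMomentum η (coordMap I D e) (e.extend I q.1, (Θ q).2) = q.2 := hmom
    rw [hmom']
    rfl
  change LinearIndependent ℝ _
  rw [heq]
  exact hmap

end IsDeveloping

end Phase

/-- On a simply connected space, a locally constant cocycle admits flat sections. -/
theorem exists_flat_section {B : Type*} [TopologicalSpace B] [SimplyConnectedSpace B]
    [LocallyPathConnectedSpace B] {ι F : Type*} (U : ι → Set B) (hU : ∀ i, IsOpen (U i))
    (idx : B → ι) (hidx : ∀ x, x ∈ U (idx x)) (τ : ι → ι → B → F → F)
    (hself : ∀ i, ∀ x ∈ U i, ∀ v, τ i i x v = v)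
    (hcomp : ∀ i j k, ∀ x ∈ U i ∩ U j ∩ U k, ∀ v, τ j k x (τ i j x v) = τ i k x v)
    (hconst : ∀ i j, ∀ x ∈ U i ∩ U j, ∀ v, ∀ᶠ y in 𝓝 x, τ i j y v = τ i j x v)
    (b : B) (v : F) :
    ∃ s : B → F, s b = v ∧ ∀ x, ∀ᶠ y in 𝓝 x, τ (idx y) (idx x) y (s y) = s x := by
  -- With the discrete topology on the fibre, the locally constant cocycle defines a fibre bundle
  -- that is a covering. Simple connectedness lifts the identity of the base, and this lift is the
  -- flat section.
  let _ : TopologicalSpace F := ⊥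
  have : DiscreteTopology F := ⟨rfl⟩
  let Z : FiberBundleCore ι B F :=
    { baseSet := U
      isOpen_baseSet := hU
      indexAt := idx
      mem_baseSet_at := hidx
      coordChange := τ
      coordChange_self := hself
      continuousOn_coordChange := by
        intro i j p hp
        refine ContinuousAt.continuousWithinAt ?_
        rw [ContinuousAt, nhds_discrete F, Filter.tendsto_pure]
        obtain ⟨x, w⟩ := p
        rw [nhds_prod_eq, nhds_discrete F, Filter.prod_pure, Filter.eventually_map]
        exact hconst i j x hp.1 w
      coordChange_comp := hcomp }
  have hcov : IsCoveringMap (Bundle.TotalSpace.proj : Z.TotalSpace → B) :=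
    FiberBundle.isCoveringMap (F := F)
  obtain ⟨σ, ⟨hσ0, hσ⟩, -⟩ := hcov.existsUnique_continuousMap_lifts (ContinuousMap.id B) b
    (⟨b, v⟩ : Z.TotalSpace) rfl
  have hσp : ∀ x, (σ x).proj = x := fun x => congrFun hσ x
  let s : B → F := fun x => (σ x).2
  have hs : ∀ x, σ x = ⟨x, s x⟩ := by
    intro x
    have := hσp x
    generalize hq : σ x = q at *
    obtain ⟨q1, q2⟩ := q
    subst this
    simp only [s]
    rw [hq]
  refine ⟨s, ?_, fun x => ?_⟩
  · simp only [s]; rw [hσ0]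
  · have h1 : ContinuousAt (fun y => (Z.localTriv (idx x) (σ y)).2) x := by
      refine continuous_snd.continuousAt.comp
        (ContinuousAt.comp (f := σ) (g := Z.localTriv (idx x)) ?_ σ.continuous.continuousAt)
      refine (Z.localTriv (idx x)).continuousOn.continuousAt
        ((Z.localTriv (idx x)).open_source.mem_nhds ?_)
      rw [Bundle.Trivialization.mem_source]
      change (σ x).proj ∈ U (idx x)
      rw [hσp]
      exact hidx x
    rw [ContinuousAt, nhds_discrete F, Filter.tendsto_pure] at h1
    filter_upwards [h1] with y hy
    simp only [hs] at hy
    refine Eq.trans hy ?_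
    exact hself _ x (hidx x) _

/-! ### Flat charts and the existence of a developing map -/

section FlatCharts

variable {E : Type*} [NormedAddCommGroup E] [NormedSpace ℝ E] [FiniteDimensional ℝ E]
  {H : Type*} [TopologicalSpace H] {I : ModelWithCorners ℝ E H} [I.Boundaryless]
  {M : Type*} [TopologicalSpace M] [ChartedSpace H M] [IsManifold I ∞ M]
  {X : Type*} [NormedAddCommGroup X] [NormedSpace ℝ X]
  {g : FormField I M} {e e' : OpenPartialHomeomorph M H} {η η' : E →L[ℝ] E →L[ℝ] ℝ}

theorem exists_coord_of_mem_source {x : M} (hx : x ∈ e.source) :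
    ∃ y ∈ (e.extend I).target, (e.extend I).symm y = x :=
  ⟨e.extend I x, (e.extend I).map_source (by rwa [e.extend_source]), e.extend_left_inv hx⟩

theorem hasFDerivAt_coordMap {D : M → X} {y : E} (he : e ∈ IsManifold.maximalAtlas I ∞ M)
    (hy : y ∈ (e.extend I).target)
    (hD : ContMDiffAt I 𝓘(ℝ, X) ∞ D ((e.extend I).symm y)) :
    HasFDerivAt (coordMap I D e)
      ((devCoframe I D ((e.extend I).symm y)).comp (coordFrame I e y)) y := by
  have h1 := ((contMDiffAt_extend_symm he hy).mdifferentiableAt (by simp)).hasMFDerivAt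
  have h2 := (hD.mdifferentiableAt (by simp)).hasMFDerivAt
  exact hasMFDerivAt_iff_hasFDerivAt.1 (h2.comp y h1)

theorem devCoframe_extend_injective (he : e ∈ IsManifold.maximalAtlas I ∞ M) {x : M}
    (hx : x ∈ e.source) (u : TangentSpace I x) (hu : devCoframe I (e.extend I) x u = 0) :
    u = 0 := by
  obtain ⟨y, hy, rfl⟩ := exists_coord_of_mem_source (I := I) hx
  rw [← coordFrame_coordCoframe he hy u]
  exact (congrArg (coordFrame I e y) hu).trans (map_zero _)

theorem devCoframe_extend_invertible (he : e ∈ IsManifold.maximalAtlas I ∞ M) {x : M}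
    (hx : x ∈ e.source) : (devCoframe I (e.extend I) x).IsInvertible := by
  have : FiniteDimensional ℝ (TangentSpace I x) := inferInstanceAs (FiniteDimensional ℝ E)
  have : T2Space (TangentSpace I x) := inferInstanceAs (T2Space E)
  have hi : Function.Injective (devCoframe I (e.extend I) x : TangentSpace I x →ₗ[ℝ] E) :=
    (injective_iff_map_eq_zero _).2 (devCoframe_extend_injective he hx)
  have hd : Module.finrank ℝ (TangentSpace I x) = Module.finrank ℝ E := rfl
  have hb : Function.Bijective (devCoframe I (e.extend I) x : TangentSpace I x →ₗ[ℝ] E) :=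
    ⟨hi, (LinearMap.injective_iff_surjective_of_finrank_eq_finrank hd).1 hi⟩
  exact ⟨(LinearEquiv.ofBijective _ hb).toContinuousLinearEquiv, by ext; rfl⟩

theorem metric_of_coord_eq (he : e ∈ IsManifold.maximalAtlas I ∞ M)
    (hg : ∀ y ∈ (e.extend I).target, g.coord e y = η) {x : M} (hx : x ∈ e.source)
    (u v : TangentSpace I x) :
    g x u v = η (devCoframe I (e.extend I) x u) (devCoframe I (e.extend I) x v) := by
  obtain ⟨y, hy, rfl⟩ := exists_coord_of_mem_source (I := I) hx
  rw [← hg y hy, FormField.coord_apply]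
  exact (congrArg₂ (fun a b => g _ a b) (coordFrame_coordCoframe he hy u)
    (coordFrame_coordCoframe he hy v)).symm

theorem eq_on_ball_of_hasFDerivAt_zero {F : E → X} {y : E} {r : ℝ} (hr : 0 < r)
    (hF : ∀ z ∈ Metric.ball y r, HasFDerivAt F (0 : E →L[ℝ] X) z) :
    ∀ z ∈ Metric.ball y r, F z = F y := by
  intro z hz
  refine (convex_ball y r).is_const_of_fderivWithin_eq_zero (𝕜 := ℝ)
    (fun w hw => (hF w hw).differentiableAt.differentiableWithinAt) (fun w hw => ?_) hz
    (Metric.mem_ball_self hr)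
  rw [fderivWithin_of_isOpen Metric.isOpen_ball hw, (hF w hw).fderiv]

/-- A map with vanishing second derivative is locally affine. -/
theorem eventually_affine_of_fderiv_fderiv {ψ : E → X} {y : E}
    (hψ : ContDiffAt ℝ ∞ ψ y) (h : ∀ᶠ z in 𝓝 y, fderiv ℝ (fderiv ℝ ψ) z = 0) :
    ∃ (T : E →L[ℝ] X) (b : X), ∀ᶠ z in 𝓝 y, fderiv ℝ ψ z = T ∧ ψ z = T z + b := by
  have h2 : ContDiffAt ℝ 2 ψ y := hψ.of_le (WithTop.coe_le_coe.2 (le_top (a := (2 : ℕ∞))))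
  have hev := h2.eventually (by simp)
  obtain ⟨r, hr, hball⟩ := Metric.eventually_nhds_iff_ball.1 (hev.and h)
  have hopen : IsOpen (Metric.ball y r) := Metric.isOpen_ball
  have hd1 : ∀ z ∈ Metric.ball y r, fderiv ℝ ψ z = fderiv ℝ ψ y := by
    refine eq_on_ball_of_hasFDerivAt_zero hr fun z hz => ?_
    have := ((((hball z hz).1.fderiv_right (m := 1) (by norm_num)).differentiableAt
      (by norm_num))).hasFDerivAt
    rwa [(hball z hz).2] at this
  have hd0 : ∀ z ∈ Metric.ball y r, ψ z - fderiv ℝ ψ y z = ψ y - fderiv ℝ ψ y y := by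
    refine eq_on_ball_of_hasFDerivAt_zero (F := fun z => ψ z - fderiv ℝ ψ y z) hr fun z hz => ?_
    refine (((hball z hz).1.differentiableAt (by norm_num)).hasFDerivAt.sub
      (fderiv ℝ ψ y).hasFDerivAt).congr_fderiv ?_
    rw [hd1 z hz, sub_self]
  refine ⟨fderiv ℝ ψ y, ψ y - fderiv ℝ ψ y y, ?_⟩
  filter_upwards [hopen.mem_nhds (Metric.mem_ball_self hr)] with z hz
  exact ⟨hd1 z hz, by rw [← hd0 z hz]; abel⟩

theorem christoffel_of_eventually_const {γ : E → E →L[ℝ] E →L[ℝ] ℝ} {y : E}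
    (h : ∀ᶠ z in 𝓝 y, γ z = η) : christoffel γ y = 0 := by
  have h1 : fderiv ℝ γ y = 0 := by
    rw [Filter.EventuallyEq.fderiv_eq (f := fun _ => η) h]; simp
  have h2 : christoffelFirst γ y = 0 := by
    ext u v w
    rw [christoffelFirst_apply, h1]; simp
  rw [christoffel, h2]; simp

/-- Flat charts are related by locally affine maps. -/
theorem flatChart_transition (hs : ∀ x u v, g x u v = g x v u)
    (hnd : ∀ x u, (∀ v, g x u v = 0) → u = 0)
    (he : e ∈ IsManifold.maximalAtlas I ∞ M) (hg : ∀ y ∈ (e.extend I).target, g.coord e y = η)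
    (he' : e' ∈ IsManifold.maximalAtlas I ∞ M)
    (hg' : ∀ y ∈ (e'.extend I).target, g.coord e' y = η') {x : M} (hx : x ∈ e.source)
    (hx' : x ∈ e'.source) :
    ∃ (T : E →L[ℝ] E) (b : E), ∀ᶠ z in 𝓝 x,
      (∀ u, devCoframe I (e.extend I) z u = T (devCoframe I (e'.extend I) z u)) ∧
      e.extend I z = T (e'.extend I z) + b := by
  have hsurj : ∀ v, ∃ u, devCoframe I (e.extend I) x u = v :=
    (devCoframe_extend_invertible he hx).surjective
  have hηs : ∀ u v, η u v = η v u := by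
    intro u v
    obtain ⟨u, rfl⟩ := hsurj u
    obtain ⟨v, rfl⟩ := hsurj v
    rw [← metric_of_coord_eq he hg hx, hs, metric_of_coord_eq he hg hx]
  have hηn : ∀ u, (∀ v, η u v = 0) → u = 0 := by
    intro u hu
    obtain ⟨u, rfl⟩ := hsurj u
    rw [hnd x u fun v => by rw [metric_of_coord_eq he hg hx]; exact hu _, map_zero]
  obtain ⟨y, hy, rfl⟩ := exists_coord_of_mem_source (I := I) hx'
  set ψ := coordMap I (e.extend I) e' with hψ
  have hmem : ∀ᶠ z in 𝓝 y, z ∈ (e'.extend I).target ∧ (e'.extend I).symm z ∈ e.source :=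
    Filter.Eventually.and (e'.isOpen_extend_target.mem_nhds hy)
      ((tendsto_extend_symm hy).eventually (e.open_source.mem_nhds hx))
  have hder : ∀ z, z ∈ (e'.extend I).target ∧ (e'.extend I).symm z ∈ e.source → ∀ u,
      fderiv ℝ ψ z u = devCoframe I (e.extend I) ((e'.extend I).symm z) (coordFrame I e' z u) :=
    fun z hz u => by
      rw [(hasFDerivAt_coordMap he' hz.1 (contMDiffAt_extend_of_mem he hz.2)).fderiv]; rfl
  have hsm : ∀ z, z ∈ (e'.extend I).target ∧ (e'.extend I).symm z ∈ e.source →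
      ContDiffAt ℝ ∞ ψ z := fun z hz =>
    ((contMDiffAt_extend_of_mem he hz.2).comp z (contMDiffAt_extend_symm he' hz.1)).contDiffAt
  -- By `fderiv_christoffel`, ψ'' is the image under dψ of the Christoffel symbols in the chart
  -- `e'`, and these vanish because the metric has constant coefficients there.
  have hflat : ∀ᶠ z in 𝓝 y, fderiv ℝ (fderiv ℝ ψ) z = 0 := by
    filter_upwards [hmem.eventually_nhds, hmem] with z hz hz0
    have hP : IsFlatPullback η (g.coord e') ψ z :=
      { smooth := hsm z hz0
        symm := hηs
        nondeg := hηn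
        metric := by
          filter_upwards [hz] with w hw u v
          rw [FormField.coord_apply, metric_of_coord_eq he hg hw.2, hder w hw, hder w hw]
        inj := fun u hu => by
          rw [hder z hz0] at hu
          rw [← coordCoframe_coordFrame he' hz0.1 u,
            devCoframe_extend_injective he hz0.2 _ hu, map_zero] }
    ext u v
    rw [← hP.fderiv_christoffel, christoffel_of_eventually_const (η := η')]
    · simp
    · filter_upwards [hz] with w hw using hg' w hw.1
  obtain ⟨T, b, hT⟩ := eventually_affine_of_fderiv_fderiv (hsm y hmem.self_of_nhds) hflat
  refine ⟨T, b, ?_⟩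
  have hc : Filter.Tendsto (e'.extend I) (𝓝 ((e'.extend I).symm y)) (𝓝 y) := by
    have := e'.continuousAt_extend (I := I) hx'
    rwa [ContinuousAt, (e'.extend I).right_inv hy] at this
  filter_upwards [hc.eventually (hT.and hmem), e'.open_source.mem_nhds hx'] with z hz hz'
  obtain ⟨w, hw, rfl⟩ := exists_coord_of_mem_source (I := I) hz'
  rw [(e'.extend I).right_inv hw] at hz ⊢
  refine ⟨fun u => ?_, hz.1.2⟩
  rw [← hz.1.1, hder w hz.2]
  exact congrArg _ (coordFrame_coordCoframe he' hw u).symm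

/-- A simply connected flat manifold admits a developing map. -/
theorem FormField.IsFlatMetric.exists_isDeveloping [SimplyConnectedSpace M]
    (h : g.IsFlatMetric) : ∃ (η : E →L[ℝ] E →L[ℝ] ℝ) (D : M → E), IsDeveloping g η D := by
  have : LocallyPathConnectedSpace H := I.toHomeomorph.isOpenEmbedding.locallyPathConnectedSpace
  have : LocallyPathConnectedSpace M := ChartedSpace.locallyPathConnectedSpace H M
  choose e he hxe η hη using h.flat
  have hinv : ∀ i, ∀ x ∈ (e i).source, (devCoframe I ((e i).extend I) x).IsInvertible :=
    fun i x hx => devCoframe_extend_invertible (he i) hx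
  -- The linear part of the transition from chart j to chart i, locally constant on overlaps by
  -- `flatChart_transition`.
  let T : M → M → M → E →L[ℝ] E := fun i j z =>
    (devCoframe I ((e i).extend I) z).comp (devCoframe I ((e j).extend I) z).inverse
  have hT : ∀ i j z, z ∈ (e j).source → ∀ S : E →L[ℝ] E, (∀ u, devCoframe I ((e i).extend I) z u =
      S (devCoframe I ((e j).extend I) z u)) → T i j z = S := by
    intro i j z hz S hS
    refine ContinuousLinearMap.ext fun v => ?_
    change devCoframe I ((e i).extend I) z ((devCoframe I ((e j).extend I) z).inverse v) = S v
    rw [hS, (hinv j z hz).self_apply_inverse]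
  have hTT : ∀ i j k z, z ∈ (e j).source → ∀ v, T i j z (T j k z v) = T i k z v := by
    intro i j k z hz v
    change devCoframe I ((e i).extend I) z ((devCoframe I ((e j).extend I) z).inverse
      (devCoframe I ((e j).extend I) z ((devCoframe I ((e k).extend I) z).inverse v))) = _
    rw [(hinv j z hz).inverse_apply_self]
    rfl
  -- A pair (b, S) stands for the affine function b + S(eᵢ) in the flat chart i; τ rewrites it in
  -- terms of the chart j. A flat section is thus an affine function continued over all of M.
  let τ : M → M → M → E × (E →L[ℝ] E) → E × (E →L[ℝ] E) := fun i j z w =>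
    (w.1 + w.2 ((e i).extend I z - T i j z ((e j).extend I z)), w.2.comp (T i j z))
  obtain ⟨x₀⟩ : Nonempty M := inferInstance
  obtain ⟨s, hs0, hs⟩ := exists_flat_section (fun i => (e i).source) (fun i => (e i).open_source)
    id hxe τ
    (by
      intro i x hx v
      have : T i i x = ContinuousLinearMap.id ℝ E := hT i i x hx _ fun u => rfl
      simp only [τ, this]
      refine Prod.ext ?_ ?_ <;> simp)
    (by
      intro i j k x hx v
      refine Prod.ext ?_ (ContinuousLinearMap.ext fun u => ?_)
      · simp only [τ, ContinuousLinearMap.comp_apply, map_sub, hTT i j k x hx.1.2]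
        abel
      · exact congrArg v.2 (hTT i j k x hx.1.2 u))
    (by
      intro i j x hx v
      obtain ⟨S, b, hS⟩ := flatChart_transition h.symm h.nondegenerate (he i) (hη i) (he j) (hη j)
        hx.1 hx.2
      have key : ∀ᶠ y in 𝓝 x, τ i j y v = (v.1 + v.2 b, v.2.comp S) := by
        filter_upwards [hS, (e j).open_source.mem_nhds hx.2] with y hy hyj
        simp only [τ, hT i j y hyj S hy.1, hy.2, add_sub_cancel_left]
      filter_upwards [key] with y hy
      rw [hy, key.self_of_nhds])
    x₀ (0, ContinuousLinearMap.id ℝ E)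
  -- Each germ is evaluated at its own base point; near x the result is one affine function of the
  -- chart at x. At x₀ the germ is the chart itself.
  let D : M → E := fun z => (s z).1 + (s z).2 ((e z).extend I z)
  have hD : ∀ x, ∀ᶠ z in 𝓝 x, D z = (s x).1 + (s x).2 ((e x).extend I z) := by
    intro x
    filter_upwards [hs x] with z hz
    rw [← hz]
    simp only [τ, D, id, map_sub, ContinuousLinearMap.comp_apply]
    abel
  have hsm : ContMDiff I 𝓘(ℝ, E) ∞ D := by
    intro x
    refine ContMDiffAt.congr_of_eventuallyEq ?_ (hD x)
    exact contMDiffAt_const.add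
      ((s x).2.contMDiff.contMDiffAt.comp x (contMDiffAt_extend_of_mem (he x) (hxe x)))
  have hdev : ∀ x, ∀ᶠ z in 𝓝 x, ∀ u, devCoframe I D z u =
      (s x).2 (devCoframe I ((e x).extend I) z u) := by
    intro x
    filter_upwards [(hD x).eventually_nhds, (e x).open_source.mem_nhds (hxe x)] with z hz hzx u
    have h1 := ((contMDiffAt_extend_of_mem (he x) hzx).mdifferentiableAt (by simp)).hasMFDerivAt
    have h2 : HasMFDerivAt 𝓘(ℝ, E) 𝓘(ℝ, E) (fun y => (s x).1 + (s x).2 y)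
        ((e x).extend I z) (s x).2 :=
      hasMFDerivAt_iff_hasFDerivAt.2 ((s x).2.hasFDerivAt.const_add _)
    have h3 := (h2.comp z h1).congr_of_eventuallyEq hz
    exact congrArg (fun L => L u) h3.mfderiv
  -- Whether `D` is isometric at z depends, for z near x, only on the fixed linear part of the
  -- section at x. The set of isometric points is therefore open and closed, and it contains x₀.
  have hmet : ∀ x, ∀ᶠ z in 𝓝 x, (∀ u v, g z u v = η x₀ (devCoframe I D z u) (devCoframe I D z v)) ↔
      ∀ a b, η x a b = η x₀ ((s x).2 a) ((s x).2 b) := by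
    intro x
    filter_upwards [hdev x, (e x).open_source.mem_nhds (hxe x)] with z hz hzx
    simp only [hz, metric_of_coord_eq (he x) (hη x) hzx]
    constructor
    · intro H a b
      obtain ⟨a, rfl⟩ := (hinv x z hzx).surjective a
      obtain ⟨b, rfl⟩ := (hinv x z hzx).surjective b
      exact H a b
    · exact fun H u v => H _ _
  have hclopen : IsClopen {z | ∀ u v, g z u v = η x₀ (devCoframe I D z u) (devCoframe I D z v)} := by
    constructor
    · rw [← isOpen_compl_iff, isOpen_iff_mem_nhds]
      intro x hx
      filter_upwards [hmet x] with z hz hz'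
      exact hx ((hmet x).self_of_nhds.2 (hz.1 hz'))
    · rw [isOpen_iff_mem_nhds]
      intro x hx
      filter_upwards [hmet x] with z hz
      exact hz.2 ((hmet x).self_of_nhds.1 hx)
  have hmem : x₀ ∈ {z | ∀ u v, g z u v = η x₀ (devCoframe I D z u) (devCoframe I D z v)} := by
    refine (hmet x₀).self_of_nhds.2 fun a b => ?_
    rw [hs0]; rfl
  have hmetric : ∀ x u v, g x u v = η x₀ (devCoframe I D x u) (devCoframe I D x v) := fun x =>
    (hclopen.eq_univ ⟨x₀, hmem⟩).ge (mem_univ x)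
  have hinj : ∀ x u, devCoframe I D x u = 0 → u = 0 := fun x u hu =>
    h.nondegenerate x u fun v => by rw [hmetric, hu]; simp
  have hsurj0 : ∀ a, ∃ u, devCoframe I ((e x₀).extend I) x₀ u = a := (hinv x₀ x₀ (hxe x₀)).surjective
  refine ⟨η x₀, D, ⟨hsm, fun u v => ?_, fun u hu => ?_, hmetric, hinj⟩⟩
  · obtain ⟨u, rfl⟩ := hsurj0 u
    obtain ⟨v, rfl⟩ := hsurj0 v
    rw [← metric_of_coord_eq (he x₀) (hη x₀) (hxe x₀), h.symm,
      metric_of_coord_eq (he x₀) (hη x₀) (hxe x₀)]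
  · obtain ⟨u, rfl⟩ := hsurj0 u
    rw [h.nondegenerate x₀ u fun v => by
      rw [metric_of_coord_eq (he x₀) (hη x₀) (hxe x₀)]; exact hu _, map_zero]

end FlatCharts

/-! ### Functional independence -/

section LinearAlgebra

variable {E : Type*} [NormedAddCommGroup E] [NormedSpace ℝ E]

theorem exists_option_linearIndependent {X : Type*} [AddCommGroup X] [Module ℝ X]
    [FiniteDimensional ℝ X] {k : ℕ} (hX : Module.finrank ℝ X = k + 1) {v : X} (hv : v ≠ 0) :
    ∃ w : Fin k → X, LinearIndependent ℝ fun o : Option (Fin k) => o.elim v w := by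
  obtain ⟨S, hS⟩ := Submodule.exists_isCompl (Submodule.span ℝ {v})
  have hd : Module.finrank ℝ S = k := by
    have := Submodule.finrank_add_eq_of_isCompl hS
    rw [finrank_span_singleton hv, hX] at this
    omega
  let b : Module.Basis (Fin k) ℝ S := Module.finBasisOfFinrankEq ℝ S hd
  refine ⟨fun i => b i, linearIndependent_option.2 ⟨?_, fun h => ?_⟩⟩
  · exact b.linearIndependent.map' S.subtype S.ker_subtype
  · have h1 : v ∈ S := by
      refine Submodule.span_le.2 ?_ h
      rintro _ ⟨i, rfl⟩
      exact (b i).2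
    exact hv ((Submodule.disjoint_def.1 hS.disjoint) v (Submodule.mem_span_singleton_self v) h1)

variable [FiniteDimensional ℝ E]

theorem exists_dual_pair {p r : E} (h : LinearIndependent ℝ ![p, r]) :
    ∃ α β : E →L[ℝ] ℝ, α p = 1 ∧ α r = 0 ∧ β p = 0 ∧ β r = 1 := by
  obtain ⟨L, hL⟩ := LinearMap.exists_leftInverse_of_injective (Fintype.linearCombination ℝ ![p, r])
    (LinearMap.ker_eq_bot.2 h.fintypeLinearCombination_injective)
  have hp : L p = Pi.single 0 1 := by
    have := LinearMap.congr_fun hL (Pi.single 0 1)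
    simpa [Fintype.linearCombination_apply_single] using this
  have hr : L r = Pi.single 1 1 := by
    have := LinearMap.congr_fun hL (Pi.single 1 1)
    simpa [Fintype.linearCombination_apply_single] using this
  refine ⟨LinearMap.toContinuousLinearMap ((LinearMap.proj 0).comp L),
    LinearMap.toContinuousLinearMap ((LinearMap.proj 1).comp L), ?_, ?_, ?_, ?_⟩ <;>
  simp [hp, hr]

/-- A symmetric form can take prescribed values on two independent vectors. -/
theorem exists_symm_form {p r : E} (h : LinearIndependent ℝ ![p, r]) {β ρ : E →L[ℝ] ℝ}
    (hβρ : β r = ρ p) :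
    ∃ B : E →L[ℝ] E →L[ℝ] ℝ, (∀ a b, B a b = B b a) ∧ B p = β ∧ B r = ρ := by
  obtain ⟨x, y, hxp, hxr, hyp, hyr⟩ := exists_dual_pair h
  let t : (E →L[ℝ] ℝ) → (E →L[ℝ] ℝ) → E →L[ℝ] E →L[ℝ] ℝ := fun a b => a.smulRight b
  -- The symmetrized products of x with β and of y with ρ have the right values up to contributions
  -- counted twice on the span of p and r. The subtracted terms remove these; the mixed one uses β r
  -- = ρ p.
  refine ⟨t x β + t β x - β p • t x x + t y ρ + t ρ y - ρ r • t y y - β r • (t x y + t y x),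
    fun a b => ?_, ?_, ?_⟩
  · simp [t]; ring
  · ext a; simp [t, hxp, hyp, hβρ]
  · ext a; simp [t, hxr, hyr]

theorem finrank_strongDual : Module.finrank ℝ (E →L[ℝ] ℝ) = Module.finrank ℝ E := by
  rw [← LinearEquiv.finrank_eq (LinearMap.toContinuousLinearMap : (E →ₗ[ℝ] ℝ) ≃ₗ[ℝ] (E →L[ℝ] ℝ))]
  exact Subspace.dual_finrank_eq

variable {c : E →L[ℝ] E →L[ℝ] E} {η : E →L[ℝ] E →L[ℝ] ℝ}

/-- By the Frobenius property the terms linear and quadratic in z cancel. Consequently H is the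
member B = η of the family of integrals and can be treated on the same footing. -/
theorem generalKilling_metric (hcomm : ∀ a b, c a b = c b a)
    (hassoc : ∀ a b d, c (c a b) d = c a (c b d))
    (hfrob : ∀ a b d, η (c a b) d = η a (c b d)) (z : E) : generalKilling c η z = η := by
  ext a b
  have h1 : η a (c z b) = η (c z a) b := by rw [hcomm z a, hfrob]
  have h2 : η (c z a) (c z b) = η (c z z) (c a b) := by
    rw [hfrob, hfrob, ← hassoc a, hcomm a z, hassoc]
  have h3 : η z (c a b) = η (c z a) b := (hfrob z a b).symm
  simp only [generalKilling_apply, oneSub_apply, subHalfSq, map_sub, map_smul, sub_apply, smul_apply,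
    h1, h2, h3, smul_eq_mul]
  ring

theorem fderiv_generalKilling (hcomm : ∀ a b, c a b = c b a)
    (hassoc : ∀ a b d, c (c a b) d = c a (c b d)) (B : E →L[ℝ] E →L[ℝ] ℝ) (z w u v : E) :
    fderiv ℝ (generalKilling c B) z w u v =
      - B (c w u) (oneSub c z v) - B (oneSub c z u) (c w v) + 2 * B (oneSub c z w) (c u v) := by
  have h1 : HasFDerivAt (generalKilling c B) (fderiv ℝ (generalKilling c B) z) z :=
    ((contDiff_generalKilling (n := 1) B).differentiable (by norm_num) z).hasFDerivAt
  have h2 := hasFDerivAt_generalKilling (z := z) hcomm hassoc (B := B) u v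
  have h3 := (hasFDerivAt_bilin h1 (hasFDerivAt_const u z) (hasFDerivAt_const v z)).unique h2
  have := DFunLike.congr_fun h3 w
  simpa using this

theorem generalKilling_symm (hcomm : ∀ a b, c a b = c b a) {B : E →L[ℝ] E →L[ℝ] ℝ}
    (hB : ∀ a b, B a b = B b a) (z a b : E) :
    generalKilling c B z a b = generalKilling c B z b a := by
  rw [generalKilling_apply, generalKilling_apply, hB, hcomm a b]

/-- At the base point only the covectors B(P, ·) and B(r, ·), with r = 2 P ⋆ P + f, enter the
differential. This reduces functional independence to linear algebra. -/
theorem phaseDifferential_generalKilling_zero (hcomm : ∀ a b, c a b = c b a)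
    (hassoc : ∀ a b d, c (c a b) d = c a (c b d)) {B : E →L[ℝ] E →L[ℝ] ℝ}
    (hB : ∀ a b, B a b = B b a) (f P u δ : E) :
    phaseDifferential B (fderiv ℝ (generalKilling c B) 0) (B f) P (u, δ) =
      B ((2 : ℝ) • c P P + f) u + 2 * B P (δ - c u P) := by
  rw [phaseDifferential_apply, fderiv_generalKilling hcomm hassoc, oneSub_zero,
    one_apply_eq_self, one_apply_eq_self, hB (c u P) P, hB u (c P P)]
  simp
  ring

/-- There are enough general Killing tensors for functional independence at one point. -/
theorem exists_forms_linearIndependent (hs : ∀ u v, η u v = η v u)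
    (hn : ∀ u, (∀ v, η u v = 0) → u = 0) (hcomm : ∀ a b, c a b = c b a)
    (hassoc : ∀ a b d, c (c a b) d = c a (c b d)) {f P : E}
    (hP : LinearIndependent ℝ ![P, (2 : ℝ) • c P P + f]) :
    ∃ B : Option (Fin (2 * Module.finrank ℝ E - 2)) → E →L[ℝ] E →L[ℝ] ℝ,
      (∀ o a b, B o a b = B o b a) ∧ B none = η ∧ LinearIndependent ℝ fun o =>
        phaseDifferential (B o) (fderiv ℝ (generalKilling c (B o)) 0) (B o f) P := by
  set r := (2 : ℝ) • c P P + f with hr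
  have hP0 : P ≠ 0 := hP.ne_zero 0
  obtain ⟨x, y, hxp, hxr, hyp, hyr⟩ := exists_dual_pair hP
  -- The symmetry B(P, r) = B(r, P) is the only constraint on the pair (B(P, ·), B(r, ·)). The
  -- kernel of ℓ has dimension 2n - 1: one place for H and 2n - 2 for the integrals.
  let ℓ : (E →L[ℝ] ℝ) × (E →L[ℝ] ℝ) →ₗ[ℝ] ℝ :=
    (ContinuousLinearMap.apply ℝ ℝ r : (E →L[ℝ] ℝ) →L[ℝ] ℝ).toLinearMap.comp
      (LinearMap.fst ℝ _ _) -
    (ContinuousLinearMap.apply ℝ ℝ P : (E →L[ℝ] ℝ) →L[ℝ] ℝ).toLinearMap.comp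
      (LinearMap.snd ℝ _ _)
  have hℓ : ∀ w, ℓ w = w.1 r - w.2 P := fun w => rfl
  have hdim : Module.finrank ℝ ℓ.ker = (2 * Module.finrank ℝ E - 2) + 1 := by
    have h1 := LinearMap.finrank_range_add_finrank_ker ℓ
    have h2 : ℓ.range = ⊤ := by
      refine LinearMap.range_eq_top.2 fun t => ⟨(t • y, 0), ?_⟩
      simp [hℓ, hyr]
    rw [h2, finrank_top, Module.finrank_prod, finrank_strongDual, Module.finrank_self] at h1
    have h3 := hP.fintype_card_le_finrank
    simp at h3
    omega
  let v₀ : ℓ.ker := ⟨(η P, η r), by rw [LinearMap.mem_ker, hℓ, hs]; exact sub_self _⟩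
  have hv : v₀ ≠ 0 := by
    intro h
    refine hP0 (hn P fun v => ?_)
    have := congrArg (fun z : ℓ.ker => z.1.1 v) h
    simpa using this
  obtain ⟨w, hw⟩ := exists_option_linearIndependent hdim hv
  have hB : ∀ i, ∃ B : E →L[ℝ] E →L[ℝ] ℝ, (∀ a b, B a b = B b a) ∧ B P = (w i).1.1 ∧
      B r = (w i).1.2 := fun i => exists_symm_form hP (sub_eq_zero.1 (w i).2)
  choose B hBs hBP hBr using hB
  refine ⟨fun o => o.elim η B, fun o => ?_, rfl, ?_⟩
  · cases o
    · exact hs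
    · exact hBs _
  -- The differential as a function of the pair of covectors. It is injective, since the momentum
  -- directions recover the first covector and then the position directions the second.
  let Φ : (E →L[ℝ] ℝ) × (E →L[ℝ] ℝ) →ₗ[ℝ] (E × E →L[ℝ] ℝ) :=
    { toFun := fun w => w.2.comp (ContinuousLinearMap.fst ℝ E E) +
        ((2 : ℝ) • w.1).comp (ContinuousLinearMap.snd ℝ E E
          - (c.flip P).comp (ContinuousLinearMap.fst ℝ E E))
      map_add' := fun a b => by
        refine ContinuousLinearMap.ext fun v => ?_
        simp; ring
      map_smul' := fun t a => by
        refine ContinuousLinearMap.ext fun v => ?_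
        simp; ring }
  have hΦ : ∀ w u δ, Φ w (u, δ) = w.2 u + 2 * w.1 (δ - c u P) := fun w u δ => by
    simp [Φ]; ring
  have hker : Φ.ker = ⊥ := by
    rw [LinearMap.ker_eq_bot']
    rintro ⟨a, b⟩ hab
    have h1 : a = 0 := by
      ext δ
      have := DFunLike.congr_fun hab (0, δ)
      rw [hΦ] at this
      simpa using this
    subst h1
    refine Prod.ext rfl ?_
    ext u
    have := DFunLike.congr_fun hab (u, 0)
    rw [hΦ] at this
    simpa using this
  have hli := (hw.map' ℓ.ker.subtype ℓ.ker.ker_subtype).map' Φ hker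
  have heq : (fun o : Option (Fin (2 * Module.finrank ℝ E - 2)) => phaseDifferential (o.elim η B)
      (fderiv ℝ (generalKilling c (o.elim η B)) 0) ((o.elim η B) f) P) =
      (Φ ∘ ℓ.ker.subtype ∘ fun o => o.elim v₀ w) := by
    funext o
    refine ContinuousLinearMap.ext fun v => ?_
    obtain ⟨u, δ⟩ := v
    cases o with
    | none =>
      refine (phaseDifferential_generalKilling_zero hcomm hassoc hs f P u δ).trans ?_
      simp only [Function.comp_apply, Option.elim_none, hΦ]
      rfl
    | some i =>
      refine (phaseDifferential_generalKilling_zero hcomm hassoc (hBs i) f P u δ).trans ?_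
      simp only [Function.comp_apply, Option.elim_some, hΦ, hBP, ← hr, hBr]
      rfl
  change LinearIndependent ℝ fun o : Option (Fin (2 * Module.finrank ℝ E - 2)) =>
    phaseDifferential (o.elim η B) (fderiv ℝ (generalKilling c (o.elim η B)) 0)
      ((o.elim η B) f) P
  rw [heq]
  exact hli

end LinearAlgebra

/-! ### Linear independence on a dense set by analytic continuation -/

section Density

variable {E : Type*} [NormedAddCommGroup E] [NormedSpace ℝ E] {M : Type*} [TopologicalSpace M]
  {D : M → E}

/-- A family of analytic maps that is linearly independent at one point of a connected manifold is
linearly independent on a dense subset. -/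
theorem frequently_linearIndependent [PreconnectedSpace M] (hD : IsLocalHomeomorph D)
    {ι X : Type*} [Fintype ι] [NormedAddCommGroup X] [NormedSpace ℝ X] [FiniteDimensional ℝ X]
    {θ : ι → M → X} (hθ : ∀ i x, FlatContDiffAt ω D (θ i) x) {x₀ : M}
    (h : LinearIndependent ℝ fun i => θ i x₀) (x : M) :
    ∃ᶠ y in 𝓝 x, LinearIndependent ℝ fun i => θ i y := by
  classical
  obtain ⟨L, hL⟩ := LinearMap.exists_leftInverse_of_injective
    (Fintype.linearCombination ℝ fun i => θ i x₀)
    (LinearMap.ker_eq_bot.2 h.fintypeLinearCombination_injective)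
  have hL0 : ∀ i, L (θ i x₀) = Pi.single i 1 := by
    intro i
    have := LinearMap.congr_fun hL (Pi.single i 1)
    simpa [Fintype.linearCombination_apply_single] using this
  -- A maximal minor with respect to a left inverse chosen at x₀: it is analytic, equals 1 at x₀,
  -- and its nonvanishing implies independence.
  let F : M → ℝ := fun y => (Matrix.of fun i j => L (θ i y) j).det
  have hF : ∀ y, FlatContDiffAt ω D F y := by
    intro y
    choose G hG hθG using fun i => hθ i y
    refine ⟨fun z => (Matrix.of fun i j => L (G i z) j).det, ?_, ?_⟩
    · simp only [Matrix.det_apply, Matrix.of_apply]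
      refine ContDiffAt.sum fun σ _ => ContDiffAt.const_smul _ (contDiffAt_prod fun i _ => ?_)
      exact (LinearMap.toContinuousLinearMap ((LinearMap.proj i).comp L)).contDiff.contDiffAt.comp
        (D y) (hG (σ i))
    · filter_upwards [Filter.eventually_all.2 hθG] with z hz
      simp [F, hz]
  have h0 : F x₀ ≠ 0 := by
    have : (Matrix.of fun i j => L (θ i x₀) j) = (1 : Matrix ι ι ℝ) := by
      ext i j
      simp [hL0, Matrix.one_apply, Pi.single_apply, eq_comm]
    simp [F, this]
  refine (not_eventually_eq_zero_of_analytic hD hF h0 x).mono fun y hy => ?_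
  have h1 : IsUnit (Matrix.of fun i j => L (θ i y) j) := by
    rw [Matrix.isUnit_iff_isUnit_det]
    exact isUnit_iff_ne_zero.2 hy
  exact LinearIndependent.of_comp L (Matrix.linearIndependent_rows_iff_isUnit.2 h1)

theorem _root_.IsLocalHomeomorph.prodMap {X Y Z W : Type*} [TopologicalSpace X]
    [TopologicalSpace Y] [TopologicalSpace Z] [TopologicalSpace W] {f : X → Y} {g : Z → W}
    (hf : IsLocalHomeomorph f) (hg : IsLocalHomeomorph g) : IsLocalHomeomorph (Prod.map f g) := by
  rintro ⟨x, z⟩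
  obtain ⟨e, hx, rfl⟩ := hf x
  obtain ⟨e', hz, rfl⟩ := hg z
  exact ⟨e.prod e', ⟨hx, hz⟩, rfl⟩

theorem FlatContDiffAt.comp_fst {X F N : Type*} [NormedAddCommGroup X] [NormedSpace ℝ X]
    [NormedAddCommGroup F] [NormedSpace ℝ F] [TopologicalSpace N] {D' : N → F} {n : WithTop ℕ∞}
    {Φ : M → X} {q : M × N} (h : FlatContDiffAt n D Φ q.1) :
    FlatContDiffAt n (Prod.map D D') (fun q => Φ q.1) q := by
  obtain ⟨G, hG, hΦ⟩ := h
  exact ⟨fun z => G z.1, hG.comp (Prod.map D D' q) (f := Prod.fst) contDiffAt_fst,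
    hΦ.comp_tendsto (continuous_fst.tendsto q)⟩

theorem contDiff_phaseDifferential [FiniteDimensional ℝ E] {n : WithTop ℕ∞} :
    ContDiff ℝ n fun t : ((E →L[ℝ] E →L[ℝ] ℝ) × (E →L[ℝ] E →L[ℝ] E →L[ℝ] ℝ) × (E →L[ℝ] ℝ)) × E =>
      phaseDifferential t.1.1 t.1.2.1 t.1.2.2 t.2 := by
  refine contDiff_iff_contDiffAt.2 fun t => contDiffAt_clm fun u => ?_
  obtain ⟨u, δ⟩ := u
  simp only [phaseDifferential_apply]
  refine ContDiff.contDiffAt ?_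
  have hP : ContDiff ℝ n fun t : ((E →L[ℝ] E →L[ℝ] ℝ) × (E →L[ℝ] E →L[ℝ] E →L[ℝ] ℝ) ×
    (E →L[ℝ] ℝ)) × E => t.2 := contDiff_snd
  fun_prop

end Density

/-! ### Superintegrability -/

section Superintegrability

variable {E : Type*} [NormedAddCommGroup E] [NormedSpace ℝ E] [FiniteDimensional ℝ E]
  {H : Type*} [TopologicalSpace H] {I : ModelWithCorners ℝ E H} [I.Boundaryless]
  {M : Type*} [TopologicalSpace M] [ChartedSpace H M] [IsManifold I ∞ M]
  {g : FormField I M} {η : E →L[ℝ] E →L[ℝ] ℝ} {D : M → E} {m : ProductField I M}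

/-- For p independent of f, the vectors p and 2t² p ⋆ p + f stay independent for small t, because
independence is an open condition. For t ≠ 0 the multiple P = t p has the required property. -/
theorem exists_linearIndependent_quadratic (hn : 2 ≤ Module.finrank ℝ E)
    (c : E →L[ℝ] E →L[ℝ] E) {f : E} (hf : f ≠ 0) :
    ∃ P : E, LinearIndependent ℝ ![P, (2 : ℝ) • c P P + f] := by
  obtain ⟨p, hp⟩ := exists_linearIndependent_pair_of_one_lt_finrank (R := ℝ) (by omega) hf
  rw [LinearIndependent.pair_symm_iff] at hp
  have hc : Continuous fun t : ℝ => ![p, (2 * t ^ 2) • c p p + f] := by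
    refine continuous_pi fun i => ?_
    fin_cases i
    · exact continuous_const
    · exact ((continuous_const.mul (continuous_id.pow 2)).smul continuous_const).add
        continuous_const
  have h0 : ∀ᶠ t : ℝ in 𝓝[≠] 0, LinearIndependent ℝ ![p, (2 * t ^ 2) • c p p + f] := by
    refine Filter.Eventually.filter_mono nhdsWithin_le_nhds (hc.continuousAt.preimage_mem_nhds
      (isOpen_setOfPred_linearIndependent.mem_nhds ?_))
    change LinearIndependent ℝ _
    simpa using hp
  obtain ⟨t, ht, ht0⟩ := (h0.and self_mem_nhdsWithin).exists
  have ht0 : t ≠ 0 := ht0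
  refine ⟨t • p, ?_⟩
  rw [LinearIndependent.pair_iff] at ht ⊢
  intro a b hab
  have := ht (a * t) b (by
    rw [← hab, map_smul, map_smul, smul_apply]
    module)
  exact ⟨(mul_eq_zero.1 this.1).resolve_right ht0, this.2⟩

/-- A vector that is neither orthogonal to nor a multiple of `e`. -/
theorem exists_linearIndependent_of_nondeg (hn : 2 ≤ Module.finrank ℝ E)
    (hη : ∀ u, (∀ v, η u v = 0) → u = 0) {e : E} (he : e ≠ 0) :
    ∃ P : E, η e P ≠ 0 ∧ LinearIndependent ℝ ![P, e] := by
  obtain ⟨w, hw⟩ := exists_linearIndependent_pair_of_one_lt_finrank (R := ℝ) (by omega) he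
  obtain ⟨q, hq⟩ : ∃ q, η e q ≠ 0 := by
    by_contra! h
    exact he (hη e h)
  have hw' := LinearIndependent.pair_symm_iff.1 hw
  by_cases h1 : η e w = 0
  · by_cases h2 : LinearIndependent ℝ ![q, e]
    · exact ⟨q, hq, h2⟩
    -- If q is a multiple of e, then e is not null; so e + w, with w orthogonal to e, is not
    -- orthogonal to e.
    · have h3 : η e e ≠ 0 := by
        intro h3
        refine h2 (LinearIndependent.pair_iff.2 fun a b hab => ?_)
        have ha : a = 0 := by
          have := congrArg (η e) hab
          simpa [h3, hq] using this
        subst ha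
        simpa [he] using hab
      refine ⟨e + w, by simpa [h1] using h3, ?_⟩
      rw [LinearIndependent.pair_iff] at hw' ⊢
      intro a b hab
      obtain ⟨ha, hb⟩ := hw' a (a + b) (by rw [← hab, smul_add, add_smul]; abel)
      subst ha
      exact ⟨rfl, by simpa using hb⟩
  · exact ⟨w, h1, hw'⟩

namespace IsDeveloping

variable (h : IsDeveloping g η D)
include h

/-- The product `c` need not come from the given structure: the tensors are polynomial in z, so N is
not required to be invertible. This lets one argument serve both the nonconstant potentials and the
free motion. -/
theorem isSuperintegrableThrough_general [PreconnectedSpace M] {c : E →L[ℝ] E →L[ℝ] E}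
    (hcomm : ∀ a b, c a b = c b a) (hassoc : ∀ a b d, c (c a b) d = c a (c b d))
    (hfrob : ∀ a b d, η (c a b) d = η a (c b d)) {x₀ : M} {V : M → ℝ} {f : M → E}
    (hV : ∀ x, HasFlatDerivAt D V (η (f x)) x) (hf : ∀ x, FlatContDiffAt ω D f x) {P : E}
    (hP : LinearIndependent ℝ ![P, (2 : ℝ) • c P P + f x₀]) {𝒦 : Set (FormField I M)}
    (h𝒦 : ∀ B : E →L[ℝ] E →L[ℝ] ℝ, (∀ a b, B a b = B b a) →
      pullForm I D (fun x => generalKilling c B (D x - D x₀)) ∈ 𝒦)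
    (hF : ∀ B : E →L[ℝ] E →L[ℝ] ℝ, (∀ a b, B a b = B b a) → ∃ F : M → ℝ,
      ContMDiff I 𝓘(ℝ, ℝ) ∞ F ∧
        ∀ x, HasFlatDerivAt D F (generalKilling c B (D x - D x₀) (f x)) x) :
    IsSuperintegrableThrough g V 𝒦 := by
  obtain ⟨B, hBs, hB0, hli⟩ := exists_forms_linearIndependent h.symm h.nondeg hcomm hassoc hP
  choose F hFs hF' using fun i => hF (B (some i)) (hBs _)
  let K : Fin (2 * Module.finrank ℝ E - 2) → FormField I M := fun i =>
    pullForm I D fun x => generalKilling c (B (some i)) (D x - D x₀)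
  have hpush : ∀ (o : Option (Fin (2 * Module.finrank ℝ E - 2))) x, pushForm D (o.elim g K) x =
      generalKilling c (B o) (D x - D x₀) := by
    intro o x
    cases o with
    | none => rw [hB0, generalKilling_metric hcomm hassoc hfrob]; exact h.pushForm_self x
    | some i => exact h.pushForm_pullForm _ x
  have hder : ∀ (o : Option (Fin (2 * Module.finrank ℝ E - 2))) x,
      HasFlatDerivAt D (pushForm D (o.elim g K))
        (fderiv ℝ (generalKilling c (B o)) (D x - D x₀)) x := by
    intro o x
    rw [show pushForm D (o.elim g K) = fun x => generalKilling c (B o) (D x - D x₀) from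
      funext (hpush o)]
    exact ((contDiff_generalKilling (n := 1) (B o)).differentiable
      (by norm_num) (D x - D x₀)).hasFDerivAt.flat_sub
  have hsym : ∀ (o : Option (Fin (2 * Module.finrank ℝ E - 2))) x a b,
      pushForm D (o.elim g K) x a b = pushForm D (o.elim g K) x b a := fun o x a b => by
    rw [hpush, generalKilling_symm hcomm (hBs o)]
  have hFo : ∀ (o : Option (Fin (2 * Module.finrank ℝ E - 2))) x,
      HasFlatDerivAt D (o.elim V F) (generalKilling c (B o) (D x - D x₀) (f x)) x := by
    intro o x
    cases o with
    | none => rw [hB0, generalKilling_metric hcomm hassoc hfrob]; exact hV x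
    | some i => exact hF' i x
  refine ⟨K, F, fun i => ⟨h𝒦 _ (hBs _), hFs i, h.isIntegralOf (hsym (some i)) (hder (some i))
    (fun x a => ?_) hV fun x => ?_⟩, ?_⟩
  · rw [fderiv_generalKilling hcomm hassoc, hBs _ (c a a)]
    ring
  · rw [show pushForm D (K i) x = _ from hpush (some i) x]
    exact hF' i x
  · have heq : (fun o : Option (Fin (2 * Module.finrank ℝ E - 2)) =>
        o.elim (quadraticFunction g g V) fun i => quadraticFunction g (K i) (F i)) =
        fun o => quadraticFunction g (o.elim g K) (o.elim V F) := by
      funext o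
      cases o <;> rfl
    rw [heq]
    refine h.functionallyIndependent hsym hder hFo fun q => ?_
    simp only [hpush]
    have : PreconnectedSpace (M × E) := inferInstance
    refine frequently_linearIndependent (D := Prod.map D (id : E → E))
      (h.isLocalHomeomorph.prodMap (Homeomorph.refl E).isLocalHomeomorph)
      (θ := fun o q => phaseDifferential (generalKilling c (B o) (D q.1 - D x₀))
        (fderiv ℝ (generalKilling c (B o)) (D q.1 - D x₀))
        (generalKilling c (B o) (D q.1 - D x₀) (f q.1)) q.2) (x₀ := (x₀, P)) (fun o q => ?_) ?_ q
    · have h1 : FlatContDiffAt ω D (fun x => generalKilling c (B o) (D x - D x₀)) q.1 :=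
        (contDiff_generalKilling (B o)).contDiffAt.flat_sub
      have h2 : FlatContDiffAt ω D (fun x => fderiv ℝ (generalKilling c (B o)) (D x - D x₀)) q.1 :=
        ContDiffAt.flat_sub ((contDiff_generalKilling (n := ω) (B o)).fderiv_right
          (m := ω) (by simp)).contDiffAt
      have h3 : FlatContDiffAt ω (Prod.map D (id : E → E)) (fun q : M × E => q.2) q :=
        ⟨fun z => z.2, contDiffAt_snd, Filter.EventuallyEq.rfl⟩
      exact ((h1.comp_fst.prodMk (h2.comp_fst.prodMk (h1.clm_apply (hf q.1)).comp_fst)).prodMk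
        h3).comp contDiff_phaseDifferential.contDiffAt
    · simpa only [sub_self, generalKilling_zero] using hli

/-- Nonconstant potentials are superintegrable through compatible Killing tensors. -/
theorem isSuperintegrableThrough [PreconnectedSpace M] [Nontrivial E]
    (hA : IsFlatHF D η (pushMul D m))
    (hn : 2 ≤ Module.finrank ℝ E) {V : M → ℝ} {f : M → E} {φ : M → ℝ}
    (hV : IsFlatPotential D η (pushMul D m) V f φ) (hc : ¬ ∃ k : ℝ, ∀ x, V x = k) :
    IsSuperintegrableThrough g V {K | IsCompatibleKilling g m K} := by
  have hD := h.isLocalHomeomorph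
  obtain ⟨x₀, hx₀⟩ : ∃ x₀, f x₀ ≠ 0 := by
    by_contra! h0
    by_cases hM : Nonempty M
    · obtain ⟨x₀⟩ := hM
      refine hc ⟨V x₀, fun x => eq_of_flatDeriv_zero hD (fun y => ?_) x x₀⟩
      have := hV.deriv y
      rwa [h0, map_zero] at this
    · exact hc ⟨0, fun x => (hM ⟨x⟩).elim⟩
  obtain ⟨P, hP⟩ := exists_linearIndependent_quadratic hn (pushMul D m x₀) hx₀
  refine h.isSuperintegrableThrough_general (hA.comm x₀) (hA.assoc x₀) (hA.frob x₀) hV.deriv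
    (fun x => ?_) hP (fun B hB => ?_) fun B hB => ?_
  · rw [show f = _ from funext (hA.potential_eq hD x₀ hn hV).2]
    exact (contDiffAt_generalGradient (hA.isUnit_oneSub hD x₀ x) _ _).flat_sub
  · refine (h.isCompatibleKilling_iff hA).2 ?_
    rw [show pushForm D (pullForm I D fun x => generalKilling (pushMul D m x₀) B (D x - D x₀)) = _
      from funext fun x => h.pushForm_pullForm _ x]
    exact (hA.isFlatKilling_iff hD).1 (hA.isFlatKilling_general hD x₀ hB)
  · obtain ⟨F, h1, h2⟩ := hA.exists_integral hD hn hV (hA.isFlatKilling_general hD x₀ hB)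
    exact ⟨F, h.contMDiff_iff.2 h1, h2⟩

theorem isSymmSmooth_pullForm {B : M → E →L[ℝ] E →L[ℝ] ℝ} (hs : ∀ x a b, B x a b = B x b a)
    (hB : ∀ x, FlatContDiffAt ∞ D B x) : (pullForm I D B).IsSymmSmooth where
  symm x u v := by rw [pullForm_apply, pullForm_apply, hs]
  smooth := by
    rw [h.form_smooth_iff, show pushForm D (pullForm I D B) = B from
      funext fun x => h.pushForm_pullForm _ x]
    exact hB

/-- The free motion is superintegrable. -/
theorem isSecondOrderMaximallySuperintegrable_const [PreconnectedSpace M] [Nonempty M]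
    (hn : 2 ≤ Module.finrank ℝ E) {V : M → ℝ} {k : ℝ} (hV : ∀ x, V x = k) :
    IsSecondOrderMaximallySuperintegrable g V := by
  obtain ⟨x₀⟩ : Nonempty M := inferInstance
  have : Nontrivial E := Module.nontrivial_of_finrank_pos (R := ℝ) (by omega)
  obtain ⟨e, he⟩ := exists_ne (0 : E)
  obtain ⟨P, hP, hli⟩ := exists_linearIndependent_of_nondeg hn h.nondeg he
  -- With f = 0 the vector r = 2 P ⋆ P must be independent of P, which is impossible for, say, the
  -- zero product. This rank-one Frobenius algebra has P ⋆ P = η(e, P)² e, so any P independent of e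
  -- with η(e, P) ≠ 0 will do.
  let c : E →L[ℝ] E →L[ℝ] E := (η e).smulRight ((η e).smulRight e)
  have hc : ∀ a b, c a b = (η e a * η e b) • e := fun a b => by simp [c, mul_smul]
  have hcomm : ∀ a b, c a b = c b a := fun a b => by rw [hc, hc, mul_comm]
  refine h.isSuperintegrableThrough_general (c := c) (f := fun _ => 0) (x₀ := x₀) (P := P) hcomm
    (fun a b d => ?_) (fun a b d => ?_) (fun x => ?_) (fun x => flatContDiffAt_const _) ?_
    (fun B hB => ?_) fun B hB => ⟨fun _ => 0, contMDiff_const, fun x => ?_⟩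
  · simp only [hc, map_smul, smul_apply, smul_eq_mul, smul_smul]
    congr 1; ring
  · simp only [hc, map_smul, smul_apply, smul_eq_mul, h.symm a e]
    ring
  · rw [map_zero, show V = fun _ => k from funext hV]
    exact hasFlatDerivAt_const k
  · rw [LinearIndependent.pair_iff] at hli ⊢
    intro a b hab
    have := hli a (b * (2 * (η e P * η e P))) (by rw [← hab, hc, add_zero]; simp only [smul_smul])
    refine ⟨this.1, ?_⟩
    simpa [hP] using this.2
  · exact h.isSymmSmooth_pullForm (fun x => generalKilling_symm hcomm hB _) fun x =>
      (contDiff_generalKilling B).contDiffAt.flat_sub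
  · rw [map_zero]
    exact hasFlatDerivAt_const 0

end IsDeveloping

end Superintegrability

/-! ### Dimensions of the solution spaces -/

theorem exists_basis_of_injective {X Y : Type*} [AddCommGroup X] [Module ℝ X]
    [FiniteDimensional ℝ X] [AddCommGroup Y] [Module ℝ Y] (T : X →ₗ[ℝ] Y)
    (hT : ∀ x, T x = 0 → x = 0) {k : ℕ} (hk : Module.finrank ℝ X = k) {S : Y → Prop}
    (hS : ∀ y, S y ↔ ∃ x, T x = y) :
    ∃ b : Fin k → Y, LinearIndependent ℝ b ∧ ∀ y, S y ↔ y ∈ Submodule.span ℝ (range b) := by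
  let b := Module.finBasisOfFinrankEq ℝ X hk
  refine ⟨T ∘ b, b.linearIndependent.map' T (LinearMap.ker_eq_bot'.2 hT), fun y => ?_⟩
  rw [range_comp, Submodule.span_image, b.span_eq, hS, Submodule.map_top]
  rfl

section SymmetricForms

variable (E : Type*) [NormedAddCommGroup E] [NormedSpace ℝ E]

/-- The space of symmetric bilinear forms. -/
def symmetricForms : Submodule ℝ (E →L[ℝ] E →L[ℝ] ℝ) where
  carrier := {B | ∀ a b, B a b = B b a}
  zero_mem' := fun _ _ => rfl
  add_mem' := fun hB hC a b => congrArg₂ (· + ·) (hB a b) (hC a b)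
  smul_mem' := fun r _ hB a b => congrArg (r • ·) (hB a b)

variable [FiniteDimensional ℝ E]

theorem finrank_symmetricForms : Module.finrank ℝ (symmetricForms E) =
    Module.finrank ℝ E * (Module.finrank ℝ E + 1) / 2 := by
  let b := Module.finBasis ℝ E
  let T : symmetricForms E →ₗ[ℝ] (Sym2 (Fin (Module.finrank ℝ E)) → ℝ) :=
    { toFun := fun B => Sym2.lift ⟨fun i j => B.1 (b i) (b j), fun i j => B.2 _ _⟩
      map_add' := fun B C => by
        funext s
        induction s with | _ i j => rfl
      map_smul' := fun r B => by
        funext s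
        induction s with | _ i j => rfl }
  have hT : ∀ B i j, T B s(i, j) = B.1 (b i) (b j) := fun B i j => rfl
  have hinj : Function.Injective T := by
    rw [injective_iff_map_eq_zero]
    intro B hB
    have h0 : ∀ i j, B.1 (b i) (b j) = 0 := fun i j => by rw [← hT, hB]; rfl
    have h1 : ∀ i, B.1 (b i) = 0 := fun i =>
      ContinuousLinearMap.coe_injective (b.ext fun j => h0 i j)
    exact Subtype.ext (ContinuousLinearMap.coe_injective (b.ext h1))
  have hsurj : Function.Surjective T := by
    intro w
    let x : Fin (Module.finrank ℝ E) → E →L[ℝ] ℝ := fun i =>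
      LinearMap.toContinuousLinearMap (b.coord i)
    have hx : ∀ i j, x i (b j) = if i = j then 1 else 0 := fun i j => by
      simp [x, Finsupp.single_apply, eq_comm]
    let B : E →L[ℝ] E →L[ℝ] ℝ := ∑ i, ∑ j, w s(i, j) • (x i).smulRight (x j)
    have hB : ∀ u v, B u v = ∑ i, ∑ j, w s(i, j) * (x i u * x j v) := fun u v => by
      simp [B]
    refine ⟨⟨B, fun u v => ?_⟩, ?_⟩
    · rw [hB, hB, Finset.sum_comm]
      refine Finset.sum_congr rfl fun i _ => Finset.sum_congr rfl fun j _ => ?_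
      rw [Sym2.eq_swap]
      ring
    · funext s
      induction s with | _ i j =>
      rw [hT, hB]
      simp [hx]
  rw [(LinearEquiv.ofBijective T ⟨hinj, hsurj⟩).finrank_eq, Module.finrank_fintype_fun_eq_card,
    Sym2.card, Fintype.card_fin, Nat.choose_two_right, Nat.add_sub_cancel, mul_comm]

end SymmetricForms

section Spaces

variable {E : Type*} [NormedAddCommGroup E] [NormedSpace ℝ E] [FiniteDimensional ℝ E]
  {H : Type*} [TopologicalSpace H] {I : ModelWithCorners ℝ E H} [I.Boundaryless]
  {M : Type*} [TopologicalSpace M] [ChartedSpace H M] [IsManifold I ∞ M] [PreconnectedSpace M]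
  {g : FormField I M} {η : E →L[ℝ] E →L[ℝ] ℝ} {D : M → E} {m : ProductField I M}

namespace IsDeveloping

variable (h : IsDeveloping g η D) (hA : IsFlatHF D η (pushMul D m))
  (hn : 2 ≤ Module.finrank ℝ E) [Nontrivial E] (x₀ : M)
include h hA

theorem isCompatibleKilling_iff_isFlatKilling {K : FormField I M} :
    IsCompatibleKilling g m K ↔ IsFlatKilling D (pushMul D m) (pushForm D K) :=
  (h.isCompatibleKilling_iff hA).trans (hA.isFlatKilling_iff h.isLocalHomeomorph).symm

include x₀

theorem exists_killing_basis :
    ∃ κ : Fin (Module.finrank ℝ E * (Module.finrank ℝ E + 1) / 2) → FormField I M,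
      LinearIndependent ℝ κ ∧
        ∀ K, IsCompatibleKilling g m K ↔ K ∈ Submodule.span ℝ (range κ) := by
  let T : symmetricForms E →ₗ[ℝ] FormField I M :=
    { toFun := fun B =>
        pullForm I D fun x => generalKilling (pushMul D m x₀) B.1 (D x - D x₀)
      map_add' := fun B C => by
        funext x
        refine ContinuousLinearMap.ext fun u => ContinuousLinearMap.ext fun v => ?_
        change pullForm I D _ x u v = pullForm I D _ x u v + pullForm I D _ x u v
        simp only [pullForm_apply, generalKilling_apply, Submodule.coe_add, add_apply]
        ring
      map_smul' := fun r B => by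
        funext x
        refine ContinuousLinearMap.ext fun u => ContinuousLinearMap.ext fun v => ?_
        change pullForm I D _ x u v = r * pullForm I D _ x u v
        simp only [pullForm_apply, generalKilling_apply, Submodule.coe_smul, smul_apply,
          smul_eq_mul]
        ring }
  have hT : ∀ B x, pushForm D (T B) x = generalKilling (pushMul D m x₀) B.1 (D x - D x₀) :=
    fun B x => h.pushForm_pullForm _ x
  refine exists_basis_of_injective T (fun B hB => ?_) (finrank_symmetricForms E) fun K => ?_
  · have := hT B x₀
    rw [hB, sub_self, generalKilling_zero] at this
    refine Subtype.ext (this.symm.trans ?_)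
    ext a b
    rfl
  · rw [h.isCompatibleKilling_iff_isFlatKilling hA]
    constructor
    · intro hK
      refine ⟨⟨pushForm D K x₀, hK.symm x₀⟩, ?_⟩
      refine Eq.trans ?_ (h.pullForm_pushForm K)
      exact congrArg (pullForm I D)
        (funext fun x => (hA.killing_eq h.isLocalHomeomorph x₀ hK x).symm)
    · rintro ⟨B, rfl⟩
      rw [funext (hT B)]
      exact hA.isFlatKilling_general h.isLocalHomeomorph x₀ B.2

include hn

theorem exists_potential_basis :
    ∃ b : Fin (Module.finrank ℝ E + 2) → M → ℝ, LinearIndependent ℝ b ∧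
      ∀ V, IsWilczynskiPotential g m V ↔ V ∈ Submodule.span ℝ (range b) := by
  have hD := h.isLocalHomeomorph
  let T : ℝ × E × ℝ →ₗ[ℝ] (M → ℝ) :=
    { toFun := fun w x => generalPotential (pushMul D m x₀) η w.1 w.2.1 w.2.2 (D x - D x₀)
      map_add' := fun v w => by
        funext x
        simp only [generalPotential, Prod.fst_add, Prod.snd_add, map_add, add_apply, Pi.add_apply]
        ring
      map_smul' := fun r v => by
        funext x
        simp only [generalPotential, Prod.smul_fst, Prod.smul_snd, map_smul, smul_apply,
          Pi.smul_apply, smul_eq_mul, RingHom.id_apply]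
        ring }
  have hT : ∀ w, IsFlatPotential D η (pushMul D m) (T w) _ _ := fun w =>
    hA.isFlatPotential_general hD x₀ w.1 w.2.1 w.2.2
  refine exists_basis_of_injective T (fun w hw => ?_) (by simp; ring) fun V => ?_
  · have h0 := hT w
    rw [hw] at h0
    have hf : ∀ x, generalGradient (pushMul D m x₀) w.2.1 w.2.2 (D x - D x₀) = 0 := fun x =>
      hA.nondeg _ fun v => DFunLike.congr_fun
        ((h0.deriv x).unique hD (hasFlatDerivAt_const (0 : ℝ))) v
    -- The gradient vanishes identically, so its derivative 3 f⋆ + φ id reduces to φ id = 0.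
    have hφ : w.2.2 = 0 := by
      obtain ⟨v, hv⟩ := exists_ne (0 : E)
      have h1 := h0.deriv_grad x₀
      rw [funext hf] at h1
      have h2 := DFunLike.congr_fun (h1.unique hD (hasFlatDerivAt_const (0 : E))) v
      have h3 := hf x₀
      rw [sub_self] at h3
      simpa [hv, h3] using h2
    have ha : w.2.1 = 0 := by
      have := hf x₀
      rwa [sub_self, generalGradient_zero] at this
    have hk : w.1 = 0 := by
      have := congrFun hw x₀
      simpa only [T, LinearMap.coe_mk, AddHom.coe_mk, sub_self, generalPotential_zero,
        Pi.zero_apply] using this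
    exact Prod.ext hk (Prod.ext ha hφ)
  · rw [h.isWilczynskiPotential_iff hA]
    constructor
    · rintro ⟨f, φ, hV⟩
      exact ⟨(V x₀, f x₀, φ x₀), funext fun x => ((hA.potential_eq hD x₀ hn hV).1 x).symm⟩
    · rintro ⟨w, rfl⟩
      exact ⟨_, _, hT w⟩

theorem isSecondOrderMaximallySuperintegrable {V : M → ℝ} (hV : IsWilczynskiPotential g m V) :
    IsSecondOrderMaximallySuperintegrable g V := by
  have : Nonempty M := ⟨x₀⟩
  by_cases hc : ∃ k : ℝ, ∀ x, V x = k
  · obtain ⟨k, hk⟩ := hc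
    exact h.isSecondOrderMaximallySuperintegrable_const hn hk
  · obtain ⟨f, φ, hf⟩ := (h.isWilczynskiPotential_iff hA).1 hV
    obtain ⟨K, F, hK, hind⟩ := h.isSuperintegrableThrough hA hn hf hc
    exact ⟨K, F, fun a => ⟨(hK a).1.toIsSymmSmooth, (hK a).2⟩, hind⟩

omit x₀

theorem exists_integral_of_isCompatibleKilling {V : M → ℝ} (hV : IsWilczynskiPotential g m V)
    {K : FormField I M} (hK : IsCompatibleKilling g m K) :
    ∃ F : M → ℝ, ContMDiff I 𝓘(ℝ, ℝ) ∞ F ∧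
      IsIntegralOf (quadraticFunction g K F) (quadraticFunction g g V) := by
  have hD := h.isLocalHomeomorph
  obtain ⟨f, φ, hf⟩ := (h.isWilczynskiPotential_iff hA).1 hV
  have hKf := (h.isCompatibleKilling_iff_isFlatKilling hA).1 hK
  obtain ⟨F, h1, h2⟩ := hA.exists_integral hD hn hf hKf
  obtain ⟨K', hK', -⟩ := exists_smooth_flatDeriv hD hKf.smooth
  refine ⟨F, h.contMDiff_iff.2 h1, h.isIntegralOf hKf.symm hK' (fun x a => ?_) hf.deriv h2⟩
  have := (((h.isCompatibleKilling_iff hA).1 hK).2.2 x _ (hK' x)).1 a a a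
  linarith

end IsDeveloping

end Spaces

/-! ### Products -/

section FlatProduct

variable {E : Type*} [NormedAddCommGroup E] [NormedSpace ℝ E]
  {E' : Type*} [NormedAddCommGroup E'] [NormedSpace ℝ E']

/-- The orthogonal sum of two bilinear forms. -/
def prodForm (η : E →L[ℝ] E →L[ℝ] ℝ) (η' : E' →L[ℝ] E' →L[ℝ] ℝ) : E × E' →L[ℝ] E × E' →L[ℝ] ℝ :=
  (ContinuousLinearMap.precomp ℝ (ContinuousLinearMap.fst ℝ E E')).comp
      (η.comp (ContinuousLinearMap.fst ℝ E E'))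
    + (ContinuousLinearMap.precomp ℝ (ContinuousLinearMap.snd ℝ E E')).comp
      (η'.comp (ContinuousLinearMap.snd ℝ E E'))

/-- The direct sum of two algebras. -/
def prodBilin (c : E →L[ℝ] E →L[ℝ] E) (c' : E' →L[ℝ] E' →L[ℝ] E') :
    E × E' →L[ℝ] E × E' →L[ℝ] E × E' :=
  (ContinuousLinearMap.postcomp (E × E') (ContinuousLinearMap.inl ℝ E E')).comp
      ((ContinuousLinearMap.precomp E (ContinuousLinearMap.fst ℝ E E')).comp
        (c.comp (ContinuousLinearMap.fst ℝ E E')))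
    + (ContinuousLinearMap.postcomp (E × E') (ContinuousLinearMap.inr ℝ E E')).comp
      ((ContinuousLinearMap.precomp E' (ContinuousLinearMap.snd ℝ E E')).comp
        (c'.comp (ContinuousLinearMap.snd ℝ E E')))

theorem prodForm_apply (η : E →L[ℝ] E →L[ℝ] ℝ) (η' : E' →L[ℝ] E' →L[ℝ] ℝ) (u v : E × E') :
    prodForm η η' u v = η u.1 v.1 + η' u.2 v.2 := rfl

theorem prodBilin_apply (c : E →L[ℝ] E →L[ℝ] E) (c' : E' →L[ℝ] E' →L[ℝ] E') (u v : E × E') :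
    prodBilin c c' u v = (c u.1 v.1, c' u.2 v.2) := by
  simp [prodBilin]

variable {M : Type*} [TopologicalSpace M] {D : M → E} {N : Type*} [TopologicalSpace N] {D' : N → E'}
  {X : Type*} [NormedAddCommGroup X] [NormedSpace ℝ X] {n : WithTop ℕ∞}

theorem FlatContDiffAt.comp_snd {Φ : N → X} {q : M × N} (h : FlatContDiffAt n D' Φ q.2) :
    FlatContDiffAt n (Prod.map D D') (fun q => Φ q.2) q := by
  obtain ⟨G, hG, hΦ⟩ := h
  exact ⟨fun z => G z.2, hG.comp (Prod.map D D' q) (f := Prod.snd) contDiffAt_snd,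
    hΦ.comp_tendsto (continuous_snd.tendsto q)⟩

theorem HasFlatDerivAt.comp_fst {Φ : M → X} {Φ' : E →L[ℝ] X} {q : M × N}
    (h : HasFlatDerivAt D Φ Φ' q.1) :
    HasFlatDerivAt (Prod.map D D') (fun q => Φ q.1)
      (Φ'.comp (ContinuousLinearMap.fst ℝ E E')) q := by
  obtain ⟨G, hG, hΦ⟩ := h
  exact ⟨fun z => G z.1, HasFDerivAt.comp (Prod.map D D' q) (f := Prod.fst) hG hasFDerivAt_fst,
    hΦ.comp_tendsto (continuous_fst.tendsto q)⟩

theorem HasFlatDerivAt.comp_snd {Φ : N → X} {Φ' : E' →L[ℝ] X} {q : M × N}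
    (h : HasFlatDerivAt D' Φ Φ' q.2) :
    HasFlatDerivAt (Prod.map D D') (fun q => Φ q.2)
      (Φ'.comp (ContinuousLinearMap.snd ℝ E E')) q := by
  obtain ⟨G, hG, hΦ⟩ := h
  exact ⟨fun z => G z.2, HasFDerivAt.comp (Prod.map D D' q) (f := Prod.snd) hG hasFDerivAt_snd,
    hΦ.comp_tendsto (continuous_snd.tendsto q)⟩

theorem FlatContDiffAt.left {Φ : M × N → X} {x : M} {y : N}
    (h : FlatContDiffAt n (Prod.map D D') Φ (x, y)) :
    FlatContDiffAt n D (fun x => Φ (x, y)) x := by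
  obtain ⟨G, hG, hΦ⟩ := h
  exact ⟨fun z => G (z, D' y), ContDiffAt.comp (D x) (f := fun z => (z, D' y)) hG
    (contDiffAt_id.prodMk contDiffAt_const),
    hΦ.comp_tendsto ((Continuous.prodMk_left y).tendsto x)⟩

theorem FlatContDiffAt.right {Φ : M × N → X} {x : M} {y : N}
    (h : FlatContDiffAt n (Prod.map D D') Φ (x, y)) :
    FlatContDiffAt n D' (fun y => Φ (x, y)) y := by
  obtain ⟨G, hG, hΦ⟩ := h
  exact ⟨fun z => G (D x, z), ContDiffAt.comp (D' y) (f := fun z => (D x, z)) hG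
    (contDiffAt_const.prodMk contDiffAt_id),
    hΦ.comp_tendsto ((Continuous.prodMk_right x).tendsto y)⟩

theorem HasFlatDerivAt.left {Φ : M × N → X} {Φ' : E × E' →L[ℝ] X} {x : M} {y : N}
    (h : HasFlatDerivAt (Prod.map D D') Φ Φ' (x, y)) :
    HasFlatDerivAt D (fun x => Φ (x, y)) (Φ'.comp (ContinuousLinearMap.inl ℝ E E')) x := by
  obtain ⟨G, hG, hΦ⟩ := h
  exact ⟨fun z => G (z, D' y), HasFDerivAt.comp (D x) (f := fun z => (z, D' y)) hG
    (hasFDerivAt_prodMk_left _ _), hΦ.comp_tendsto ((Continuous.prodMk_left y).tendsto x)⟩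

theorem HasFlatDerivAt.right {Φ : M × N → X} {Φ' : E × E' →L[ℝ] X} {x : M} {y : N}
    (h : HasFlatDerivAt (Prod.map D D') Φ Φ' (x, y)) :
    HasFlatDerivAt D' (fun y => Φ (x, y)) (Φ'.comp (ContinuousLinearMap.inr ℝ E E')) y := by
  obtain ⟨G, hG, hΦ⟩ := h
  exact ⟨fun z => G (D x, z), HasFDerivAt.comp (D' y) (f := fun z => (D x, z)) hG
    (hasFDerivAt_prodMk_right _ _), hΦ.comp_tendsto ((Continuous.prodMk_right x).tendsto y)⟩

variable {η : E →L[ℝ] E →L[ℝ] ℝ} {η' : E' →L[ℝ] E' →L[ℝ] ℝ} {A : M → E →L[ℝ] E →L[ℝ] E}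
  {A' : N → E' →L[ℝ] E' →L[ℝ] E'}

theorem prodForm_symm (hη : ∀ u v, η u v = η v u) (hη' : ∀ u v, η' u v = η' v u) (u v : E × E') :
    prodForm η η' u v = prodForm η η' v u := by
  rw [prodForm_apply, prodForm_apply, hη, hη']

theorem prodForm_nondeg (hη : ∀ u, (∀ v, η u v = 0) → u = 0)
    (hη' : ∀ u, (∀ v, η' u v = 0) → u = 0) (u : E × E') (h : ∀ v, prodForm η η' u v = 0) :
    u = 0 := by
  refine Prod.ext (hη _ fun v => ?_) (hη' _ fun v => ?_)
  · simpa [prodForm_apply] using h (v, 0)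
  · simpa [prodForm_apply] using h (0, v)

theorem IsFlatHF.prod [FiniteDimensional ℝ E] [FiniteDimensional ℝ E'] (hD : IsLocalHomeomorph D)
    (hD' : IsLocalHomeomorph D') (hA : IsFlatHF D η A) (hA' : IsFlatHF D' η' A') :
    IsFlatHF (Prod.map D D') (prodForm η η') fun z : M × N => prodBilin (A z.1) (A' z.2) where
  symm := prodForm_symm hA.symm hA'.symm
  nondeg := prodForm_nondeg hA.nondeg hA'.nondeg
  smooth z := by
    refine flatContDiffAt_clm (hD.prodMap hD') fun u => flatContDiffAt_clm (hD.prodMap hD') fun v => ?_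
    simp only [prodBilin_apply]
    exact ((((hA.smooth z.1).clm_apply (flatContDiffAt_const _)).clm_apply
        (flatContDiffAt_const _)).comp_fst).prodMk
      ((((hA'.smooth z.2).clm_apply (flatContDiffAt_const _)).clm_apply
        (flatContDiffAt_const _)).comp_snd)
  comm z a b := by rw [prodBilin_apply, prodBilin_apply, hA.comm, hA'.comm]
  assoc z a b d := by simp only [prodBilin_apply, hA.assoc, hA'.assoc]
  frob z a b d := by simp only [prodBilin_apply, prodForm_apply, hA.frob, hA'.frob]
  deriv z a b := by
    simp only [prodBilin_apply]
    refine ((hA.deriv z.1 a.1 b.1).comp_fst.prodMk (hA'.deriv z.2 a.2 b.2).comp_snd).congr_deriv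
      fun w => ?_
    rw [prodBilin_apply]
    rfl

namespace IsFlatPotential

theorem add_prod {V : M → ℝ} {f : M → E} {V' : N → ℝ} {f' : N → E'} {φ : ℝ}
    (h : IsFlatPotential D η A V f fun _ => φ) (h' : IsFlatPotential D' η' A' V' f' fun _ => φ) :
    IsFlatPotential (Prod.map D D') (prodForm η η') (fun z : M × N => prodBilin (A z.1) (A' z.2))
      (fun z => V z.1 + V' z.2) (fun z => (f z.1, f' z.2)) fun _ => φ where
  smooth z := ((h.smooth z.1).comp_fst.prodMk (h'.smooth z.2).comp_snd).comp
    (Φ := fun q : ℝ × ℝ => q.1 + q.2) (contDiffAt_fst.add contDiffAt_snd)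
  smooth_grad z := (h.smooth_grad z.1).comp_fst.prodMk (h'.smooth_grad z.2).comp_snd
  deriv z := ((h.deriv z.1).comp_fst.add (h'.deriv z.2).comp_snd).congr_deriv fun w => rfl
  deriv_grad z := ((h.deriv_grad z.1).comp_fst.prodMk (h'.deriv_grad z.2).comp_snd).congr_deriv
    fun w => by
      simp only [prodBilin_apply, ContinuousLinearMap.prod_apply, ContinuousLinearMap.comp_apply,
        add_apply, smul_apply]
      rfl

variable {V : M × N → ℝ} {f : M × N → E × E'} {φ : M × N → ℝ}
  (h : IsFlatPotential (Prod.map D D') (prodForm η η')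
    (fun z : M × N => prodBilin (A z.1) (A' z.2)) V f φ)
include h

theorem left (y : N) : IsFlatPotential D η A (fun x => V (x, y)) (fun x => (f (x, y)).1)
    fun x => φ (x, y) where
  smooth x := (h.smooth (x, y)).left
  smooth_grad x := (h.smooth_grad (x, y)).left.comp contDiffAt_fst
  deriv x := (h.deriv (x, y)).left.congr_deriv fun w => by
    simp [prodForm_apply]
  deriv_grad x := ((h.deriv_grad (x, y)).left.clm (ContinuousLinearMap.fst ℝ E E')).congr_deriv
    fun w => by simp [prodBilin_apply]

theorem right (x : M) : IsFlatPotential D' η' A' (fun y => V (x, y)) (fun y => (f (x, y)).2)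
    fun y => φ (x, y) where
  smooth y := (h.smooth (x, y)).right
  smooth_grad y := (h.smooth_grad (x, y)).right.comp contDiffAt_snd
  deriv y := (h.deriv (x, y)).right.congr_deriv fun w => by
    simp [prodForm_apply]
  deriv_grad y := ((h.deriv_grad (x, y)).right.clm (ContinuousLinearMap.snd ℝ E E')).congr_deriv
    fun w => by simp [prodBilin_apply]

end IsFlatPotential

theorem IsFlatPotential.add_const {V : M → ℝ} {f : M → E} {φ : M → ℝ}
    (h : IsFlatPotential D η A V f φ) (k : ℝ) :
    IsFlatPotential D η A (fun x => V x + k) f φ where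
  smooth x := (h.smooth x).comp (Φ := fun t => t + k) (contDiffAt_id.add contDiffAt_const)
  smooth_grad := h.smooth_grad
  deriv x := ((h.deriv x).add (hasFlatDerivAt_const k)).congr_deriv fun w => by simp
  deriv_grad := h.deriv_grad

end FlatProduct

/-! ### Product manifolds: developing maps, algebras and separation of potentials -/

section ManifoldProduct

variable {E : Type*} [NormedAddCommGroup E] [NormedSpace ℝ E] [FiniteDimensional ℝ E]
  {H : Type*} [TopologicalSpace H] {I : ModelWithCorners ℝ E H} [I.Boundaryless]
  {M : Type*} [TopologicalSpace M] [ChartedSpace H M] [IsManifold I ∞ M]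
  {E' : Type*} [NormedAddCommGroup E'] [NormedSpace ℝ E'] [FiniteDimensional ℝ E']
  {H' : Type*} [TopologicalSpace H'] {J : ModelWithCorners ℝ E' H'} [J.Boundaryless]
  {N : Type*} [TopologicalSpace N] [ChartedSpace H' N] [IsManifold J ∞ N]
  {g : FormField I M} {m : ProductField I M} {h : FormField J N} {m' : ProductField J N}
  {η : E →L[ℝ] E →L[ℝ] ℝ} {D : M → E} {η' : E' →L[ℝ] E' →L[ℝ] ℝ} {D' : N → E'}

theorem devCoframe_prodMap (hD : ContMDiff I 𝓘(ℝ, E) ∞ D) (hD' : ContMDiff J 𝓘(ℝ, E') ∞ D')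
    (z : M × N) (u : TangentSpace (I.prod J) z) :
    devCoframe (I.prod J) (Prod.map D D') z u =
      (devCoframe I D z.1 (tangentFst I J z u), devCoframe J D' z.2 (tangentSnd I J z u)) := by
  have h1 := ((hD z.1).mdifferentiableAt (by simp)).hasMFDerivAt
  have h2 := ((hD' z.2).mdifferentiableAt (by simp)).hasMFDerivAt
  have hP : ContMDiff (I.prod J) 𝓘(ℝ, E × E') ∞ (Prod.map D D') :=
    (hD.comp contMDiff_fst).prodMk_space (hD'.comp contMDiff_snd)
  have h3 := ((hP z).mdifferentiableAt (by simp)).hasMFDerivAt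
  have h4 := hasMFDerivAt_unique (((ContinuousLinearMap.fst ℝ E E').hasMFDerivAt).comp z h3)
    (h1.comp z (hasMFDerivAt_fst (I := I) (I' := J) z))
  have h5 := hasMFDerivAt_unique (((ContinuousLinearMap.snd ℝ E E').hasMFDerivAt).comp z h3)
    (h2.comp z (hasMFDerivAt_snd (I := I) (I' := J) z))
  exact Prod.ext (congrArg (fun L => L u) h4) (congrArg (fun L => L u) h5)

namespace IsDeveloping

variable (hg : IsDeveloping g η D) (hh : IsDeveloping h η' D')
include hg hh

theorem prod : IsDeveloping (prodMetric g h) (prodForm η η') (Prod.map D D') where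
  smooth := (hg.smooth.comp contMDiff_fst).prodMk_space (hh.smooth.comp contMDiff_snd)
  symm := prodForm_symm hg.symm hh.symm
  nondeg := prodForm_nondeg hg.nondeg hh.nondeg
  metric z u v := by
    rw [prodMetric_apply, devCoframe_prodMap hg.smooth hh.smooth,
      devCoframe_prodMap hg.smooth hh.smooth, hg.metric, hh.metric]
    rfl
  inj z u hu := by
    rw [devCoframe_prodMap hg.smooth hh.smooth] at hu
    exact Prod.ext (hg.inj _ _ (congrArg Prod.fst hu)) (hh.inj _ _ (congrArg Prod.snd hu))

theorem pushMul_prod (z : M × N) : pushMul (Prod.map D D') (prodMul m m') z =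
    prodBilin (pushMul D m z.1) (pushMul D' m' z.2) := by
  refine ContinuousLinearMap.ext fun a => ContinuousLinearMap.ext fun b => ?_
  obtain ⟨u, rfl⟩ := (hg.prod hh).surj z a
  obtain ⟨v, rfl⟩ := (hg.prod hh).surj z b
  rw [(hg.prod hh).pushMul_dev, prodBilin_apply, devCoframe_prodMap hg.smooth hh.smooth,
    devCoframe_prodMap hg.smooth hh.smooth, devCoframe_prodMap hg.smooth hh.smooth,
    hg.pushMul_dev, hh.pushMul_dev, prodMul_apply]
  exact Prod.ext (congrArg (devCoframe I D z.1) (add_zero (m z.1 _ _)))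
    (congrArg (devCoframe J D' z.2) (zero_add (m' z.2 _ _)))

theorem isFlatMetric_prod (fg : g.IsFlatMetric) (fh : h.IsFlatMetric) :
    (prodMetric g h).IsFlatMetric where
  symm z u v := by
    rw [(hg.prod hh).metric, (hg.prod hh).metric, (hg.prod hh).symm]
  smooth := (hg.prod hh).form_smooth_iff.2 fun z =>
    (flatContDiffAt_const (prodForm η η')).congr (hg.prod hh).pushForm_self
  nondegenerate z u hu := (hg.prod hh).inj z u <| (hg.prod hh).nondeg _ fun v => by
    obtain ⟨v, rfl⟩ := (hg.prod hh).surj z v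
    rw [← (hg.prod hh).metric, hu]
  flat z := by
    obtain ⟨e, he, hx, γ, hγ⟩ := fg.flat z.1
    obtain ⟨e', he', hy, γ', hγ'⟩ := fh.flat z.2
    have hee := IsManifold.mem_maximalAtlas_prod (I := I) (I' := J) he he'
    -- The product of two flat charts is flat, as the Jacobian of D × D' is block diagonal in it.
    refine ⟨e.prod e', hee, ⟨hx, hy⟩, prodForm γ γ', fun w hw => ?_⟩
    have hw1 := hw
    rw [OpenPartialHomeomorph.extend_prod] at hw1
    obtain ⟨hw1, hw2⟩ := hw1
    have hd : HasFDerivAt (coordMap (I.prod J) (Prod.map D D') (e.prod e'))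
        ((fderiv ℝ (coordMap I D e) w.1).prodMap (fderiv ℝ (coordMap J D' e') w.2)) w :=
      HasFDerivAt.prodMap w
        ((hg.contDiffAt_coordMap he hw1).differentiableAt (by simp)).hasFDerivAt
        ((hh.contDiffAt_coordMap he' hw2).differentiableAt (by simp)).hasFDerivAt
    refine ContinuousLinearMap.ext fun u => ContinuousLinearMap.ext fun v => ?_
    rw [((hg.prod hh).isFlatPullback hee hw).metric_at, hd.fderiv, prodForm_apply, prodForm_apply,
      ← hγ w.1 hw1, ← hγ' w.2 hw2, (hg.isFlatPullback he hw1).metric_at,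
      (hh.isFlatPullback he' hw2).metric_at]
    rfl

theorem isFlatHF_prod (hA : IsFlatHF D η (pushMul D m)) (hA' : IsFlatHF D' η' (pushMul D' m')) :
    IsFlatHF (Prod.map D D') (prodForm η η') (pushMul (Prod.map D D') (prodMul m m')) := by
  rw [funext (hg.pushMul_prod hh)]
  exact hA.prod hg.isLocalHomeomorph hh.isLocalHomeomorph hA'

variable [Nontrivial E] [Nontrivial E'] (hA : IsFlatHF D η (pushMul D m))
  (hA' : IsFlatHF D' η' (pushMul D' m'))
include hA hA'

theorem isWilczynskiPotential_prod_iff {V : M × N → ℝ} :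
    IsWilczynskiPotential (prodMetric g h) (prodMul m m') V ↔ ∃ f φ,
      IsFlatPotential (Prod.map D D') (prodForm η η')
        (fun z : M × N => prodBilin (pushMul D m z.1) (pushMul D' m' z.2)) V f φ := by
  rw [(hg.prod hh).isWilczynskiPotential_iff (hg.isFlatHF_prod hh hA hA'),
    funext (hg.pushMul_prod hh)]

omit hA hA' in
theorem two_le_finrank_prod : 2 ≤ Module.finrank ℝ (E × E') := by
  have h1 : 0 < Module.finrank ℝ E := Module.finrank_pos
  have h2 : 0 < Module.finrank ℝ E' := Module.finrank_pos
  rw [Module.finrank_prod]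
  omega

variable [PreconnectedSpace M] [PreconnectedSpace N]

/-- Potentials on a product are additively separated. -/
theorem exists_separation [Nonempty M] [Nonempty N] {V : M × N → ℝ}
    (hV : IsWilczynskiPotential (prodMetric g h) (prodMul m m') V) :
    ∃ (V₁ : M → ℝ) (V₂ : N → ℝ), IsWilczynskiPotential g m V₁ ∧ IsWilczynskiPotential h m' V₂ ∧
      ∀ x y, V (x, y) = V₁ x + V₂ y := by
  obtain ⟨x₀⟩ : Nonempty M := inferInstance
  obtain ⟨y₀⟩ : Nonempty N := inferInstance
  obtain ⟨f, φ, hf⟩ := (hg.isWilczynskiPotential_prod_iff hh hA hA').1 hV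
  have hAA := hA.prod hg.isLocalHomeomorph hh.isLocalHomeomorph hA'
  have hDD := hg.isLocalHomeomorph.prodMap hh.isLocalHomeomorph
  have hφ : φ = fun _ => φ (x₀, y₀) := funext fun z =>
    hAA.coefficient_const hDD (x₀, y₀) (two_le_finrank_prod hg hh) hf z
  rw [hφ] at hf
  have h1 := hf.left y₀
  -- Subtracting V(x₀, y₀) keeps the value at the base point from being counted twice. The sum of
  -- the two restrictions then has the value, the gradient and the coefficient of V there, and
  -- uniqueness applies.
  have h2 := (hf.right x₀).add_const (-V (x₀, y₀))
  refine ⟨_, _, (hg.isWilczynskiPotential_iff hA).2 ⟨_, _, h1⟩,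
    (hh.isWilczynskiPotential_iff hA').2 ⟨_, _, h2⟩, fun x y => ?_⟩
  exact congrFun (hAA.potential_ext hDD (x₀, y₀) hf (h1.add_prod h2) (by simp) rfl).1 (x, y)

theorem isWilczynskiPotential_add_iff [Nonempty M] [Nonempty N] (V₁ : M → ℝ) (V₂ : N → ℝ) :
    IsWilczynskiPotential (prodMetric g h) (prodMul m m') (fun z => V₁ z.1 + V₂ z.2) ↔
      IsWilczynskiPotential g m V₁ ∧ IsWilczynskiPotential h m' V₂ ∧
        ∀ x y, traceCoefficientOn g m V₁ x = traceCoefficientOn h m' V₂ y := by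
  obtain ⟨x₀⟩ : Nonempty M := inferInstance
  obtain ⟨y₀⟩ : Nonempty N := inferInstance
  rw [hg.isWilczynskiPotential_prod_iff hh hA hA', hg.isWilczynskiPotential_iff hA,
    hh.isWilczynskiPotential_iff hA']
  have hAA := hA.prod hg.isLocalHomeomorph hh.isLocalHomeomorph hA'
  have hDD := hg.isLocalHomeomorph.prodMap hh.isLocalHomeomorph
  constructor
  · rintro ⟨f, φ, hf⟩
    have hφ : φ = fun _ => φ (x₀, y₀) := funext fun z =>
      hAA.coefficient_const hDD (x₀, y₀) (two_le_finrank_prod hg hh) hf z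
    rw [hφ] at hf
    have h1 := (hf.left y₀).add_const (-V₂ y₀)
    have h2 := (hf.right x₀).add_const (-V₁ x₀)
    simp only [add_neg_cancel_right] at h1
    simp only [add_neg_cancel_comm] at h2
    refine ⟨⟨_, _, h1⟩, ⟨_, _, h2⟩, fun x y => ?_⟩
    rw [hg.traceCoefficientOn_eq hA h1, hh.traceCoefficientOn_eq hA' h2]
  · rintro ⟨⟨f, φ, hf⟩, ⟨f', φ', hf'⟩, heq⟩
    have hφφ : ∀ x y, φ x = φ' y := fun x y => by
      rw [← hg.traceCoefficientOn_eq hA hf, ← hh.traceCoefficientOn_eq hA' hf', heq x y]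
    -- A factor may be one-dimensional, where its own equation does not make φ constant. Constancy
    -- comes from equating a function of x with a function of y.
    have hφ : φ = fun _ => φ x₀ := funext fun x => (hφφ x y₀).trans (hφφ x₀ y₀).symm
    have hφ' : φ' = fun _ => φ x₀ := funext fun y => (hφφ x₀ y).symm
    rw [hφ] at hf
    rw [hφ'] at hf'
    exact ⟨_, _, hf.add_prod hf'⟩

end IsDeveloping

end ManifoldProduct

end HesseFrobenius

end

theorem mainTheorem2
    {E : Type*} [NormedAddCommGroup E] [NormedSpace ℝ E] [FiniteDimensional ℝ E] [Nontrivial E]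
    {H : Type*} [TopologicalSpace H] (I : ModelWithCorners ℝ E H) [I.Boundaryless]
    {U : Type*} [TopologicalSpace U] [ChartedSpace H U] [IsManifold I ∞ U]
    [T2Space U] [SecondCountableTopology U] [SimplyConnectedSpace U]
    {E' : Type*} [NormedAddCommGroup E'] [NormedSpace ℝ E'] [FiniteDimensional ℝ E'] [Nontrivial E']
    {H' : Type*} [TopologicalSpace H'] (J : ModelWithCorners ℝ E' H') [J.Boundaryless]
    {W : Type*} [TopologicalSpace W] [ChartedSpace H' W] [IsManifold J ∞ W]
    [T2Space W] [SecondCountableTopology W] [SimplyConnectedSpace W]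
    (g : HesseFrobenius.FormField I U) (m : HesseFrobenius.ProductField I U)
    (hU : HesseFrobenius.IsHesseFrobenius g m)
    (h : HesseFrobenius.FormField J W) (m' : HesseFrobenius.ProductField J W)
    (hW : HesseFrobenius.IsHesseFrobenius h m')
    (n : ℕ) (hn : n = Module.finrank ℝ (E × E'))
    (G : HesseFrobenius.FormField (I.prod J) (U × W)) (hG : G = HesseFrobenius.prodMetric g h)
    (μ : HesseFrobenius.ProductField (I.prod J) (U × W)) (hμ : μ = HesseFrobenius.prodMul m m') :
    -- the product is a Hesse-Frobenius structure
    HesseFrobenius.IsHesseFrobenius G μ ∧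
    -- the general solution of the Wilczynski equation depends linearly on `n + 2` constants
    (∃ b : Fin (n + 2) → U × W → ℝ, LinearIndependent ℝ b ∧
      ∀ V : U × W → ℝ,
        HesseFrobenius.IsWilczynskiPotential G μ V ↔ V ∈ Submodule.span ℝ (Set.range b)) ∧
    -- the compatible Killing tensors form a space of dimension `n (n + 1) / 2`
    (∃ κ : Fin (n * (n + 1) / 2) → HesseFrobenius.FormField (I.prod J) (U × W),
      LinearIndependent ℝ κ ∧
      ∀ K : HesseFrobenius.FormField (I.prod J) (U × W),
        HesseFrobenius.IsCompatibleKilling G μ K ↔ K ∈ Submodule.span ℝ (Set.range κ)) ∧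
    -- each compatible Killing tensor gives an integral of the motion for each of the potentials
    (∀ V : U × W → ℝ, HesseFrobenius.IsWilczynskiPotential G μ V →
      ∀ K : HesseFrobenius.FormField (I.prod J) (U × W), HesseFrobenius.IsCompatibleKilling G μ K →
        ∃ F : U × W → ℝ, ContMDiff (I.prod J) 𝓘(ℝ, ℝ) ∞ F ∧
          HesseFrobenius.IsIntegralOf (HesseFrobenius.quadraticFunction G K F)
            (HesseFrobenius.quadraticFunction G G V)) ∧
    -- each of the potentials is second-order maximally superintegrable ...
    (∀ V : U × W → ℝ, HesseFrobenius.IsWilczynskiPotential G μ V →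
      HesseFrobenius.IsSecondOrderMaximallySuperintegrable G V) ∧
    -- ... and, unless it is constant, this is achieved by the compatible Killing tensors
    (∀ V : U × W → ℝ, HesseFrobenius.IsWilczynskiPotential G μ V → (¬ ∃ c : ℝ, ∀ z, V z = c) →
      HesseFrobenius.IsSuperintegrableThrough G V
        {K | HesseFrobenius.IsCompatibleKilling G μ K}) ∧
    -- the potentials are additively separated into potentials on the factors
    (∀ V : U × W → ℝ, HesseFrobenius.IsWilczynskiPotential G μ V →
      ∃ (V₁ : U → ℝ) (V₂ : W → ℝ), HesseFrobenius.IsWilczynskiPotential g m V₁ ∧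
        HesseFrobenius.IsWilczynskiPotential h m' V₂ ∧ ∀ x y, V (x, y) = V₁ x + V₂ y) ∧
    -- the restriction that the Wilczynski equation imposes on the two summands
    (∀ (V₁ : U → ℝ) (V₂ : W → ℝ),
      HesseFrobenius.IsWilczynskiPotential G μ (fun z => V₁ z.1 + V₂ z.2) ↔
        HesseFrobenius.IsWilczynskiPotential g m V₁ ∧
        HesseFrobenius.IsWilczynskiPotential h m' V₂ ∧
        ∀ x y, HesseFrobenius.traceCoefficientOn g m V₁ x =
          HesseFrobenius.traceCoefficientOn h m' V₂ y) := by
  subst hn hG hμ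
  obtain ⟨η, D, hg⟩ := hU.flatMetric.exists_isDeveloping
  obtain ⟨η', D', hh⟩ := hW.flatMetric.exists_isDeveloping
  have hA := hg.isFlatHF hU
  have hA' := hh.isFlatHF hW
  have hP := hg.prod hh
  have hAP := hg.isFlatHF_prod hh hA hA'
  have hn := hg.two_le_finrank_prod hh
  obtain ⟨x₀⟩ : Nonempty U := inferInstance
  obtain ⟨y₀⟩ : Nonempty W := inferInstance
  refine ⟨hP.isHesseFrobenius (hg.isFlatMetric_prod hh hU.flatMetric hW.flatMetric) hAP,
    hP.exists_potential_basis hAP hn (x₀, y₀), hP.exists_killing_basis hAP (x₀, y₀),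
    fun V hV K hK => hP.exists_integral_of_isCompatibleKilling hAP hn hV hK,
    fun V hV => hP.isSecondOrderMaximallySuperintegrable hAP hn (x₀, y₀) hV,
    fun V hV hc => ?_, fun V hV => hg.exists_separation hh hA hA' hV,
    hg.isWilczynskiPotential_add_iff hh hA hA'⟩
  obtain ⟨f, φ, hf⟩ := (hP.isWilczynskiPotential_iff hAP).1 hV
  exact hP.isSuperintegrableThrough hAP hn hf hc
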